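/- Let $R(x)=Ax^4+4Bx^3+6Cx^2+4B'x+A'$ have complex coefficients, $A\neq 0$, and no repeated factor. Put $$g_2=AA'-4BB'+3C^2,\quad g_3=ACA'+2BCB'-AB'^2-A'B^2-C^3,\quad D=B^2-AC,\quad E=A^2B'-3ABC+2B^3 .$$ Then $g_2^3-27g_3^2\ne 0$, so that there is a lattice with invariants $g_2,g_3$; let $\wp,\sigma$ be its Weierstrass functions, $(2\omega_1,2\omega_3)$ any pair of primitive periods, $\omega_0=0$, $\omega_2=\omega_1+\omega_3$, $e_j=\wp(\omega_j)$ and $\sigma_j(u)=e^{-\eta_j u}\sigma(u+\omega_j)/\sigma(\omega_j)$ with $\eta_j=\frac{\sigma'}{\sigma}(\omega_j)$ $(j=1,2,3)$. Fix either value of $\sqrt A$. **(a) General solution.** There is $w$ with $\wp(w)=D/A$ and $\wp'(w)=-E/(A\sqrt A)$. For each such $w$ set $$\varphi_0(u)=-\frac BA+\frac1{\sqrt A}\Big\{\frac{\sigma'}{\sigma}(u-w)-\frac{\sigma'}{\sigma}(u)+\frac{\sigma'}{\sigma}(w)\Big\}=-\frac BA+\frac1{2\sqrt A}\,\frac{\wp'(u)+\wp'(w)}{\wp(u)-\wp(w)}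 .$$ On every connected non-empty open set $U\subset\mathbb C$, the non-constant meromorphic solutions of $du=dx/\sqrt{R(x)}$, i.e. of $(dx/du)^2=R(x)$, are exactly the functions $x=\varphi_0(u-u_0)$, $u_0\in\mathbb C$. As $u\to u_0$, $x\to\infty$ and $\frac1{x^2}\frac{dx}{du}\to\sqrt A$. Moreover $\varphi_0(-u+w)=\varphi_0(u)$. **(b) Even solutions.** Let $\varphi(u,w)=\varphi_0(u+\frac w2)$. Then $$\varphi(u,w)=-\frac BA+\frac1{\sqrt A}\Big\{\frac{\wp'(w/2)}{\wp(u)-\wp(w/2)}+\frac12\frac{\wp''(w/2)}{\wp'(w/2)}\Big\},$$ and, for every period $l$, $w+l$ also satisfies the two equations for $w$, and $\varphi(u,w+l)=\varphi(u+\frac l2,w)$. The functions $\varphi(u+\omega_k,w)$, $k=0,1,2,3$, are even non-constant solutions, and every non-constant even meromorphic solution on $\mathbb C$ is one of them. They are finite at $u=0$, and their values $a_k=\varphi(\omega_k,w)$ there are the four different roots of $R$. **(c) Explicit formulas.** Write $s_j=\sigma_j(w)/\sigma(w)$. Then $s_j^2=D/A-e_j$, $s_1s_2s_3=E/(2A\sqrt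 A)$. Let $\delta_{kj}=1$ if $k=0$ or $k=j$, and $\delta_{kj}=-1$ otherwise, and put $$h_0^{(k)}=\delta_{k1}s_1+\delta_{k2}s_2+\delta_{k3}s_3,\qquad h_1^{(k)}=\delta_{k1}(e_2-e_3)s_1+\delta_{k2}(e_3-e_1)s_2+\delta_{k3}(e_1-e_2)s_3,$$ $$h_2^{(k)}=\delta_{k1}(e_2^2-e_3^2)s_1+\delta_{k2}(e_3^2-e_1^2)s_2+\delta_{k3}(e_1^2-e_2^2)s_3 .$$ Then, for $k=0,1,2,3$, $$a_k=-\frac BA+\frac1{2\sqrt A}\frac{\wp''(\frac w2+\omega_k)}{\wp'(\frac w2+\omega_k)}=-\frac BA-\frac{h_0^{(k)}}{\sqrt A},$$ $$\varphi(u+\omega_k,w)=-\frac BA-\frac{h_0^{(k)}}{\sqrt A}-\frac2{\sqrt A}\,\frac{(e_2-e_3)(e_3-e_1)(e_1-e_2)}{h_1^{(k)}\wp(u)+h_2^{(k)}}$$ (the last for $u$ that are neither periods nor poles of the left side). **(d) Reality.** Let now the coefficients be real, $\sqrt A>0$ if $A>0$ and $\sqrt A\in i\,\mathbb R_{>0}$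 if $A<0$. Let $\omega$, $\tilde\omega$ be the smallest positive real zeros of $\wp'(u;g_2,g_3)$ and $\wp'(u;g_2,-g_3)$; they exist. "Conjugate", "real" and "non-real" for functions refer to their finite values at real $u$. *Case I: $g_2^3-27g_3^2>0$.* One may take $\omega_1=\omega$, $\omega_2=\omega+\tilde\omega i$, $\omega_3=\tilde\omega i$; then $e_1>e_2>e_3$ are real and are the roots of $4t^3-g_2t-g_3$. If $A>0$, then $D/A\ge e_1$ or $e_3\le D/A\le e_2$; if $A<0$, then $D/A\le e_3$ or $e_2\le D/A\le e_1$. 1) $A>0$, $D/A\ge e_1$: one can take $w=2\epsilon\omega$ with $0<\epsilon<1$. 2) $A<0$, $D/A\le e_3$: one can take $w=2\epsilon\tilde\omega i$ with $0<\epsilon<1$. In both cases, for any such $w$: $\epsilon<\frac12$ iff $E>0$, $\epsilon>\frac12$ iff $E<0$; all $s_j/\sqrt A$, all $a_k$ and all four functions $\varphi(u+\omega_k,w)$ are real. 3) $A>0$, $e_3\le D/A\le e_2$: one can take $w=2\epsilon\omega+\tilde\omega i$ with $0\le\epsilon<1$. For any such $w$: $0<\epsilon<\frac12$ iff $E<0$,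 $\epsilon>\frac12$ iff $E>0$; $s_1/\sqrt A$, $s_2/\sqrt A$ are purely imaginary (possibly $0$) and $s_3/\sqrt A$ is real; all $a_k$ are non-real, $\overline{a_0}=a_3$, $\overline{a_1}=a_2$; the functions with $k=0,3$ and those with $k=1,2$ are conjugate; all four are non-real for every real $u$. 4) $A<0$, $e_2\le D/A\le e_1$: one can take $w=\omega+2\epsilon\tilde\omega i$ with $0\le\epsilon<1$. For any such $w$: $0<\epsilon<\frac12$ iff $E<0$, $\epsilon>\frac12$ iff $E>0$; $s_1/\sqrt A$ is real and $s_2/\sqrt A$, $s_3/\sqrt A$ are purely imaginary (possibly $0$); all $a_k$ are non-real, $\overline{a_0}=a_1$, $\overline{a_2}=a_3$; the functions with $k=0,1$ and those with $k=2,3$ are conjugate; all four are non-real for every real $u$ that is not an odd multiple of $\omega/2$. *Case II: $g_2^3-27g_3^2<0$.* One may take $\omega_1=\frac{\omega-\tilde\omega i}2$, $\omega_2=\omega$, $\omega_3=\frac{\omega+\tilde\omega i}2$; then $e_2=-(e_1+e_3)$ is real, $\overline{e_1}=e_3$, $(e_1-e_3)/i>0$, and $e_1,e_2,e_3$ are the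 roots of $4t^3-g_2t-g_3$. 5) If $A>0$, then $D/A\ge e_2$ and one can take $w=2\epsilon\omega$; 6) if $A<0$, then $D/A\le e_2$ and one can take $w=2\epsilon\tilde\omega i$; here $0<\epsilon<1$. In both cases, for any such $w$: $\epsilon<\frac12$ iff $E>0$, $\epsilon>\frac12$ iff $E<0$; $s_1/\sqrt A$ and $s_3/\sqrt A$ are conjugate and $s_2/\sqrt A$ is real; $a_0,a_2$ are real, $a_1,a_3$ are non-real and conjugate; the functions with $k=0,2$ are real, those with $k=1,3$ are conjugate, and non-real for every real $u$ that is not an odd multiple of $\omega/2$. -/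

import Mathlib

open Filter Topology Polynomial

noncomputable section

namespace PeriodPair

/-- The Weierstrass `σ`-function of the lattice `L`,
`σ(z) = z ∏_{l ≠ 0} (1 - z / l) exp (z / l + z² / (2 l²))`. -/
def weierstrassSigma (L : PeriodPair) (z : ℂ) : ℂ :=
  z * ∏' l : L.lattice,
    if (l : ℂ) = 0 then 1
    else (1 - z / (l : ℂ)) * Complex.exp (z / (l : ℂ) + z ^ 2 / (2 * (l : ℂ) ^ 2))

/-- The quotient `σ' / σ`. -/
def weierstrassZeta (L : PeriodPair) (z : ℂ) : ℂ :=
  deriv L.weierstrassSigma z / L.weierstrassSigma z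

/-- The half periods `0`, `ω₁`, `ω₂ = ω₁ + ω₃`, `ω₃`, where `(2 ω₁, 2 ω₃)` is the given pair of
primitive periods. (The fields `L.ω₁`, `L.ω₂` are the full periods `2 ω₁`, `2 ω₃`.) -/
def halfPeriod (L : PeriodPair) : Fin 4 → ℂ :=
  ![0, L.ω₁ / 2, (L.ω₁ + L.ω₂) / 2, L.ω₂ / 2]

/-- `e_j = ℘(ω_j)`, used for `j = 1, 2, 3`. -/
def e (L : PeriodPair) (j : Fin 4) : ℂ := L.weierstrassP (L.halfPeriod j)

/-- The function `σ_j(z) = exp (- η_j z) σ(z + ω_j) / σ(ω_j)` with `η_j = σ'(ω_j) / σ(ω_j)`,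
used for `j = 1, 2, 3`. -/
def sigmaFun (L : PeriodPair) (j : Fin 4) (z : ℂ) : ℂ :=
  Complex.exp (-(L.weierstrassZeta (L.halfPeriod j)) * z) *
    L.weierstrassSigma (z + L.halfPeriod j) / L.weierstrassSigma (L.halfPeriod j)

/-- `σ_j(z) / σ(z)`. -/
def sigmaRatio (L : PeriodPair) (j : Fin 4) (z : ℂ) : ℂ :=
  L.sigmaFun j z / L.weierstrassSigma z

/-- The sign of `σ_j(w) / σ(w)` in the formulas for the `k`-th function: `+1` for `k = 0` and for
`k = j`, and `-1` otherwise. -/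
def shiftSign (k j : Fin 4) : ℂ := if k = 0 ∨ k = j then 1 else -1

/-- `h₀, h₀', h₀'', h₀'''` for `k = 0, 1, 2, 3`. -/
def h0 (L : PeriodPair) (k : Fin 4) (w : ℂ) : ℂ :=
  shiftSign k 1 * L.sigmaRatio 1 w + shiftSign k 2 * L.sigmaRatio 2 w
    + shiftSign k 3 * L.sigmaRatio 3 w

/-- `h₁, h₁', h₁'', h₁'''` for `k = 0, 1, 2, 3`. -/
def h1 (L : PeriodPair) (k : Fin 4) (w : ℂ) : ℂ :=
  shiftSign k 1 * (L.e 2 - L.e 3) * L.sigmaRatio 1 w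
    + shiftSign k 2 * (L.e 3 - L.e 1) * L.sigmaRatio 2 w
    + shiftSign k 3 * (L.e 1 - L.e 2) * L.sigmaRatio 3 w

/-- `h₂, h₂', h₂'', h₂'''` for `k = 0, 1, 2, 3`. -/
def h2 (L : PeriodPair) (k : Fin 4) (w : ℂ) : ℂ :=
  shiftSign k 1 * (L.e 2 ^ 2 - L.e 3 ^ 2) * L.sigmaRatio 1 w
    + shiftSign k 2 * (L.e 3 ^ 2 - L.e 1 ^ 2) * L.sigmaRatio 2 w
    + shiftSign k 3 * (L.e 1 ^ 2 - L.e 2 ^ 2) * L.sigmaRatio 3 w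

end PeriodPair

/-- The coefficients of `R(x) = A x⁴ + 4 B x³ + 6 C x² + 4 B' x + A'`. -/
structure QuarticForm (K : Type) where
  A : K
  B : K
  C : K
  B' : K
  A' : K

namespace QuarticForm

section Field

variable {K : Type} [Field K] (Q : QuarticForm K)

/-- `R(x) = A x⁴ + 4 B x³ + 6 C x² + 4 B' x + A'`. -/
def poly : K[X] :=
  Polynomial.C Q.A * X ^ 4 + Polynomial.C (4 * Q.B) * X ^ 3 + Polynomial.C (6 * Q.C) * X ^ 2
    + Polynomial.C (4 * Q.B') * X + Polynomial.C Q.A'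

def g₂ : K := Q.A * Q.A' - 4 * Q.B * Q.B' + 3 * Q.C ^ 2

def g₃ : K :=
  Q.A * Q.C * Q.A' + 2 * Q.B * Q.C * Q.B' - Q.A * Q.B' ^ 2 - Q.A' * Q.B ^ 2 - Q.C ^ 3

def D : K := Q.B ^ 2 - Q.A * Q.C

def E : K := Q.A ^ 2 * Q.B' - 3 * Q.A * Q.B * Q.C + 2 * Q.B ^ 3

end Field

/-- A real quartic, regarded as a complex one. -/
def toComplex (Q : QuarticForm ℝ) : QuarticForm ℂ :=
  ⟨(Q.A : ℂ), (Q.B : ℂ), (Q.C : ℂ), (Q.B' : ℂ), (Q.A' : ℂ)⟩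

/-- The choice of `√A` for real `A`: positive if `A > 0`, and `i` times a positive number if
`A < 0`. -/
def rootA (Q : QuarticForm ℝ) : ℂ :=
  if 0 < Q.A then (Real.sqrt Q.A : ℂ) else Complex.I * (Real.sqrt (-Q.A) : ℂ)

variable (Q : QuarticForm ℂ) (s : ℂ) (L : PeriodPair) (w : ℂ)

/-- `℘(w) = D / A` and `℘'(w) = - E / (A √A)`, where `s` is the chosen value of `√A`. -/
def IsParameter : Prop :=
  w ∉ L.lattice ∧ L.weierstrassP w = Q.D / Q.A ∧ L.derivWeierstrassP w = -Q.E / (Q.A * s)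

/-- `φ₀(u) = - B / A + (1 / √A) (σ'(u - w) / σ(u - w) - σ'(u) / σ(u) + σ'(w) / σ(w))`. Its poles
are the `u` with `u ∈ L` or `u - w ∈ L`. -/
def phi0 (u : ℂ) : ℂ :=
  -Q.B / Q.A + 1 / s * (L.weierstrassZeta (u - w) - L.weierstrassZeta u + L.weierstrassZeta w)

/-- `φ(u, w) = φ₀(u + w / 2)`. -/
def phi (u : ℂ) : ℂ := phi0 Q s L w (u + w / 2)

/-- The values `a, a₁, a₂, a₃` of `φ(u, w), φ(u + ω₁, w), φ(u + ω₂, w), φ(u + ω₃, w)` at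
`u = 0`. -/
def root (k : Fin 4) : ℂ := phi Q s L w (L.halfPeriod k)

/-- For real `u`, the function `φ(u + ω_k, w)` is real (wherever it is finite). -/
def RealValued (k : Fin 4) : Prop :=
  ∀ u : ℝ, (u : ℂ) + L.halfPeriod k - w / 2 ∉ L.lattice →
    (u : ℂ) + L.halfPeriod k + w / 2 ∉ L.lattice →
    (phi Q s L w (u + L.halfPeriod k)).im = 0

/-- For real `u`, `φ(u + ω_k, w)` and `φ(u + ω_m, w)` are complex conjugates (wherever the former
is finite). -/
def ConjugateValued (k m : Fin 4) : Prop :=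
  ∀ u : ℝ, (u : ℂ) + L.halfPeriod k - w / 2 ∉ L.lattice →
    (u : ℂ) + L.halfPeriod k + w / 2 ∉ L.lattice →
    (starRingEnd ℂ) (phi Q s L w (u + L.halfPeriod k)) = phi Q s L w (u + L.halfPeriod m)

end QuarticForm

/-- `x` is a (non-constant, meromorphic) solution of `du = dx / √R(x)` on `U`, i.e. of
`(dx/du)² = R(x)`. Meromorphic functions are regarded up to their values on a discrete set. -/
def IsQuarticSolution (R : ℂ[X]) (U : Set ℂ) (x : ℂ → ℂ) : Prop :=
  MeromorphicOn x U ∧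
  (¬ ∃ c : ℂ, x =ᶠ[codiscreteWithin U] fun _ => c) ∧
  ∀ᶠ u in codiscreteWithin U, deriv x u ^ 2 = R.eval (x u)

/-- `ω` is the smallest positive real number with `℘'(ω) = 0`. -/
def IsLeastRealZero (L : PeriodPair) (ω : ℝ) : Prop :=
  IsLeast {u : ℝ | 0 < u ∧ (u : ℂ) ∉ L.lattice ∧ L.derivWeierstrassP (u : ℂ) = 0} ω

end

/-!
The theorem rests on three facts about the Weierstrass functions of a lattice `L`.

* **`℘` and `σ`.** The product for `σ` converges locally uniformly together with its derivatives, so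
  `ζ = σ' / σ` satisfies `ζ' = -℘`; hence `ζ` and `σ` are quasi-periodic. Liouville's theorem for
  periodic functions (`PeriodPair.exists_eq_const_of_periodic`) gives
  `℘(u) - ℘(w) = -σ(u + w) σ(u - w) / (σ(u)² σ(w)²)` (`PeriodPair.weierstrassP_sub_mul_sigma_sq`),
  and with it everything elementary: where `℘` takes equal values, the zeros of `℘'`, the addition
  formula for `ζ`, and by differentiation the duplication formulas. The functions `σ_j / σ` are
  square roots of `℘ - e_j`; identities between them hold up to sign by squaring, and the sign is
  determined by the behaviour at the origin, since the complement of a countable set is connected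
  (`PeriodPair.eqOn_of_sq_eq`).

* **Existence of the lattice.** If `g₂³ ≠ 27 g₃²`, the modular form `27 g₃² E₄³ - g₂³ E₆²` has a zero
  `τ` in the upper half plane: otherwise the quotient of the discriminant form by it would have weight
  `0` and vanish at the cusp (`exists_mul_E₄_cube_eq`). The lattice `ℤ τ + ℤ` can be scaled to have
  the invariants `g₂, g₃` (`PeriodPair.exists_g₂_eq_and_g₃_eq`).

* **Uniqueness for first-order equations.** If two analytic solutions of `x'² = R(x)` have the same
  value and the same non-zero derivative at a point, their difference satisfies a linear homogeneous
  equation there and vanishes (`QuarticForm.eventuallyEq_of_deriv_sq_eq`).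

For complex coefficients, the invariants of `R` make `D / A` and `E / (A √A)` satisfy the equation
of `℘` and `℘'`, so a parameter `w` exists; the differential equation of `φ₀` is then an algebraic
identity in `℘(u), ℘'(u)` and the coefficients. As `φ₀` takes every value with both derivatives
allowed by the equation, a non-constant solution agrees with a translate of `φ₀` near some point and
so everywhere (`QuarticForm.isQuarticSolution_iff`). Since `φ(·, w)` takes equal values only at
points equal or opposite modulo `L`, evenness singles out the four translates by half periods, and
their values at `0` are four different zeros of `R`. The explicit formulas are the duplication
formulas at the point `w / 2 + ω_k`.

For real coefficients, the uniqueness theorem applied to `℘` shows that a lattice is determined by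
its invariants (`PeriodPair.lattice_eq_of_invariants_eq`). So `L` is invariant under conjugation,
hence rectangular or rhombic, and the lattice for `g₂, -g₃` is `i L`
(`PeriodPair.exists_isLeastRealZero`); the sign of the discriminant distinguishes the two shapes. On
the horizontal and vertical lines through half periods `℘` is real, up to the direction of the line,
and monotonic between half periods. This places the `e_j`, locates `w` on one of these lines and
gives the sign of `℘'(w)`, that is, of `E`. Conjugation replaces `w` by its mirror image, which
differs from `w` by a period, and so permutes the functions `φ(u + ω_k, w)`. A function which is
exchanged with a different one cannot take a real value at a real `u`, as then two of the four
functions would agree at `u`.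
-/

noncomputable section

namespace PeriodPair

variable (L : PeriodPair)

open scoped PeriodPair

/-! ### The functions `σ` and `ζ` -/

/-- The second Weierstrass elementary factor deviates from `1` by at most a cubic term. -/
lemma norm_elementaryFactor_sub_one_le {x : ℂ} (hx : ‖x‖ ≤ 1 / 2) :
    ‖(1 - x) * Complex.exp (x + x ^ 2 / 2) - 1‖ ≤ 2 * ‖x‖ ^ 3 := by
  have h1 : (1 - x) ≠ 0 := by
    intro h
    have : x = 1 := by linear_combination -h
    rw [this] at hx
    norm_num at hx
  have hlog := Complex.norm_log_sub_logTaylor_le 2 (z := -x) (by rw [norm_neg]; linarith)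
  have ht : Complex.logTaylor (2 + 1) (-x) = -(x + x ^ 2 / 2) := by
    simp [Complex.logTaylor, Finset.sum_range_succ]
    ring
  rw [ht, norm_neg, sub_neg_eq_add, ← sub_eq_add_neg] at hlog
  have hb : ‖Complex.log (1 - x) + (x + x ^ 2 / 2)‖ ≤ ‖x‖ ^ 3 := by
    refine hlog.trans ?_
    have h2 : (1 - ‖x‖)⁻¹ ≤ 2 := by
      rw [inv_le_comm₀ (by linarith) (by norm_num)]
      linarith
    have h3 : ‖x‖ ^ (2 + 1) * (1 - ‖x‖)⁻¹ ≤ ‖x‖ ^ 3 * 2 := by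
      gcongr
    have : 0 ≤ ‖x‖ ^ 3 := by positivity
    push_cast
    linarith
  have he : (1 - x) * Complex.exp (x + x ^ 2 / 2) =
      Complex.exp (Complex.log (1 - x) + (x + x ^ 2 / 2)) := by
    rw [Complex.exp_add (Complex.log _), Complex.exp_log h1]
  rw [he]
  have h5 : ‖x‖ ^ 3 ≤ 1 := pow_le_one₀ (norm_nonneg _) (by linarith)
  exact (Complex.norm_exp_sub_one_le (hb.trans h5)).trans (by linarith)

/-- The factor of the product for `σ(z) / z` that belongs to the lattice point `l`. -/
def sigmaFactor (l z : ℂ) : ℂ :=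
  if l = 0 then 1 else (1 - z / l) * Complex.exp (z / l + z ^ 2 / (2 * l ^ 2))

/-- The entire function `σ(z) / z`. -/
def sigmaQuot (z : ℂ) : ℂ := ∏' l : L.lattice, sigmaFactor l z

lemma weierstrassSigma_eq (z : ℂ) : L.weierstrassSigma z = z * L.sigmaQuot z := rfl

lemma differentiable_sigmaFactor (l : ℂ) : Differentiable ℂ (sigmaFactor l) := by
  unfold sigmaFactor
  split_ifs
  · fun_prop
  · fun_prop

lemma norm_sigmaFactor_sub_one_le {l z : ℂ} {r : ℝ} (hz : ‖z‖ ≤ r) (hl : 2 * r ≤ ‖l‖) :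
    ‖sigmaFactor l z - 1‖ ≤ 2 * r ^ 3 * ‖l‖ ^ (-3 : ℝ) := by
  have hr : 0 ≤ r := (norm_nonneg _).trans hz
  unfold sigmaFactor
  split_ifs with h
  · simp only [sub_self, norm_zero]
    positivity
  · have hl0 : 0 < ‖l‖ := norm_pos_iff.mpr h
    have hzl : ‖z / l‖ ≤ 1 / 2 := by
      rw [norm_div, div_le_iff₀ hl0]
      linarith
    have h1 := norm_elementaryFactor_sub_one_le hzl
    rw [show z / l + z ^ 2 / (2 * l ^ 2) = z / l + (z / l) ^ 2 / 2 by field_simp]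
    refine h1.trans ?_
    rw [norm_div, div_pow, Real.rpow_neg hl0.le, show (3 : ℝ) = (3 : ℕ) by norm_num,
      Real.rpow_natCast, mul_assoc, div_eq_mul_inv]
    gcongr

lemma eventually_norm_sigmaFactor_sub_one_le (r : ℝ) :
    ∀ᶠ l : L.lattice in cofinite, ∀ z ∈ Metric.ball (0 : ℂ) r,
      ‖sigmaFactor l z - 1‖ ≤ 2 * r ^ 3 * ‖l‖ ^ (-3 : ℝ) := by
  have hfin : {l : L.lattice | ‖l‖ ≤ 2 * r}.Finite := by
    refine (isCompact_iff_finite.mp (isCompact_closedBall (0 : L.lattice) (2 * r))).subset ?_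
    intro l hl
    simpa using hl
  filter_upwards [hfin.compl_mem_cofinite] with l hl z hz
  simp only [Set.mem_compl_iff, Set.mem_ofPred_eq, not_le] at hl
  exact norm_sigmaFactor_sub_one_le (by simpa using (mem_ball_zero_iff.mp hz).le) hl.le

lemma summable_norm_rpow_neg_three (r : ℝ) :
    Summable fun l : L.lattice ↦ 2 * r ^ 3 * ‖l‖ ^ (-3 : ℝ) :=
  (ZLattice.summable_norm_rpow _ _ (by simp; norm_num)).mul_left _

lemma hasProdLocallyUniformlyOn_sigmaQuot :
    HasProdLocallyUniformlyOn (fun (l : L.lattice) z ↦ sigmaFactor l z) L.sigmaQuot Set.univ := by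
  have hball (r : ℝ) : HasProdLocallyUniformlyOn (fun (l : L.lattice) z ↦ sigmaFactor l z)
      L.sigmaQuot (Metric.ball (0 : ℂ) r) := by
    have := (L.summable_norm_rpow_neg_three r).hasProdLocallyUniformlyOn_one_add
      (f := fun (l : L.lattice) z ↦ sigmaFactor l z - 1) (K := Metric.ball (0 : ℂ) r)
      Metric.isOpen_ball (L.eventually_norm_sigmaFactor_sub_one_le r)
      (fun l ↦ ((differentiable_sigmaFactor l).continuous.sub continuous_const).continuousOn)
    simpa only [add_sub_cancel] using! this
  rw [hasProdLocallyUniformlyOn_iff_tendstoLocallyUniformlyOn, tendstoLocallyUniformlyOn_univ]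
  intro u hu x
  have := hball (‖x‖ + 1)
  rw [hasProdLocallyUniformlyOn_iff_tendstoLocallyUniformlyOn] at this
  have hx : x ∈ Metric.ball (0 : ℂ) (‖x‖ + 1) := by simp
  obtain ⟨t, ht, h⟩ := this u hu x hx
  rw [Metric.isOpen_ball.nhdsWithin_eq hx] at ht
  exact ⟨t, ht, h⟩

lemma differentiable_prod_sigmaFactor (s : Finset L.lattice) :
    Differentiable ℂ (fun z ↦ ∏ l ∈ s, sigmaFactor l z) :=
  Differentiable.fun_finsetProd fun l _ ↦ differentiable_sigmaFactor l

lemma tendstoLocallyUniformlyOn_sigmaQuot :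
    TendstoLocallyUniformlyOn (fun (s : Finset L.lattice) z ↦ ∏ l ∈ s, sigmaFactor l z)
      L.sigmaQuot atTop Set.univ :=
  L.hasProdLocallyUniformlyOn_sigmaQuot

lemma differentiable_sigmaQuot : Differentiable ℂ L.sigmaQuot := by
  rw [← differentiableOn_univ]
  exact L.tendstoLocallyUniformlyOn_sigmaQuot.differentiableOn
    (.of_forall fun s ↦ (L.differentiable_prod_sigmaFactor s).differentiableOn) isOpen_univ

@[fun_prop]
lemma differentiable_weierstrassSigma : Differentiable ℂ L.weierstrassSigma :=
  differentiable_id.mul L.differentiable_sigmaQuot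

lemma sigmaFactor_ne_zero {l z : ℂ} (h : l = 0 ∨ z ≠ l) : sigmaFactor l z ≠ 0 := by
  unfold sigmaFactor
  split_ifs with h0
  · simp
  · refine mul_ne_zero ?_ (Complex.exp_ne_zero _)
    rw [sub_ne_zero]
    intro h1
    rw [eq_div_iff h0, one_mul] at h1
    exact (h.resolve_left h0) h1.symm

lemma sigmaQuot_ne_zero {z : ℂ} (hz : z ∈ (↑L.lattice \ {0} : Set ℂ)ᶜ) : L.sigmaQuot z ≠ 0 := by
  have hfac (l : L.lattice) : sigmaFactor l z ≠ 0 := by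
    refine sigmaFactor_ne_zero ?_
    by_contra! h
    exact hz ⟨h.2 ▸ l.2, by simpa [h.2] using h.1⟩
  have h := tprod_one_add_ne_zero_of_summable (f := fun l : L.lattice ↦ sigmaFactor l z - 1)
    (by simpa using hfac) ?_
  · simpa [sigmaQuot] using h
  · refine Summable.of_norm_bounded_eventually (L.summable_norm_rpow_neg_three (‖z‖ + 1)) ?_
    filter_upwards [L.eventually_norm_sigmaFactor_sub_one_le (‖z‖ + 1)] with l hl
    simpa using hl z (by simp)

lemma weierstrassSigma_of_mem {z : ℂ} (hz : z ∈ L.lattice) : L.weierstrassSigma z = 0 := by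
  by_cases h0 : z = 0
  · simp [weierstrassSigma_eq, h0]
  rw [weierstrassSigma_eq]
  have h : sigmaFactor z z = 0 := by simp [sigmaFactor, h0]
  have : L.sigmaQuot z = 0 := tprod_of_exists_eq_zero ⟨⟨z, hz⟩, h⟩
  rw [this, mul_zero]

lemma weierstrassSigma_eq_zero_iff {z : ℂ} : L.weierstrassSigma z = 0 ↔ z ∈ L.lattice := by
  refine ⟨fun h ↦ ?_, L.weierstrassSigma_of_mem⟩
  by_contra hz
  rw [weierstrassSigma_eq] at h
  rcases mul_eq_zero.mp h with h | h
  · exact hz (h ▸ zero_mem _)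
  · exact L.sigmaQuot_ne_zero (fun h ↦ hz h.1) h

lemma weierstrassSigma_ne_zero {z : ℂ} (hz : z ∉ L.lattice) : L.weierstrassSigma z ≠ 0 :=
  fun h ↦ hz (L.weierstrassSigma_eq_zero_iff.mp h)

lemma sigmaQuot_zero : L.sigmaQuot 0 = 1 := by
  have : ∀ l : L.lattice, sigmaFactor l 0 = 1 := fun l ↦ by simp [sigmaFactor]
  simp [sigmaQuot, this]

lemma sigmaQuot_neg (z : ℂ) : L.sigmaQuot (-z) = L.sigmaQuot z := by
  rw [sigmaQuot, sigmaQuot, ← (Equiv.neg L.lattice).tprod_eq]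
  refine tprod_congr fun l ↦ ?_
  simp [sigmaFactor, neg_div_neg_eq]

@[simp]
lemma weierstrassSigma_neg (z : ℂ) : L.weierstrassSigma (-z) = -L.weierstrassSigma z := by
  rw [weierstrassSigma_eq, weierstrassSigma_eq, sigmaQuot_neg]
  ring

lemma deriv_weierstrassSigma_zero : deriv L.weierstrassSigma 0 = 1 := by
  have h : HasDerivAt L.weierstrassSigma (1 * L.sigmaQuot 0 + 0 * deriv L.sigmaQuot 0) 0 :=
    (hasDerivAt_id _).mul (L.differentiable_sigmaQuot 0).hasDerivAt
  simpa [sigmaQuot_zero] using h.deriv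

@[simp]
lemma weierstrassZeta_neg (z : ℂ) : L.weierstrassZeta (-z) = -L.weierstrassZeta z := by
  have h : deriv L.weierstrassSigma (-z) = deriv L.weierstrassSigma z := by
    have h1 := deriv_comp_neg L.weierstrassSigma z
    simp only [weierstrassSigma_neg, deriv.fun_neg] at h1
    linear_combination h1
  rw [weierstrassZeta, weierstrassZeta, h, weierstrassSigma_neg, div_neg]

lemma weierstrassZeta_of_mem {z : ℂ} (hz : z ∈ L.lattice) : L.weierstrassZeta z = 0 := by
  rw [weierstrassZeta, L.weierstrassSigma_of_mem hz, div_zero]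

lemma weierstrassZeta_eq_logDeriv : L.weierstrassZeta = logDeriv L.weierstrassSigma := rfl

/-- The derivative of the logarithmic derivative of one factor of `σ(z) / z`. -/
lemma hasDerivAt_logDeriv_sigmaFactor {l z : ℂ} (h : l = 0 ∨ z ≠ l) :
    HasDerivAt (logDeriv (sigmaFactor l))
      (-(if l = 0 then 0 else (1 / (z - l) ^ 2 - 1 / l ^ 2))) z := by
  by_cases h0 : l = 0
  · have : sigmaFactor l = fun _ ↦ 1 := by ext; simp [sigmaFactor, h0]
    rw [this, if_pos h0, neg_zero]
    have h2 : logDeriv (fun _ : ℂ ↦ (1 : ℂ)) = fun _ ↦ 0 := by ext; simp [logDeriv]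
    rw [h2]
    exact hasDerivAt_const _ _
  have hz : z ≠ l := h.resolve_left h0
  rw [if_neg h0]
  have hlog : ∀ y, y ≠ l → logDeriv (sigmaFactor l) y = 1 / (y - l) + 1 / l + y / l ^ 2 := by
    intro y hy
    have hd : HasDerivAt (sigmaFactor l)
        ((-(1 / l)) * Complex.exp (y / l + y ^ 2 / (2 * l ^ 2)) +
          (1 - y / l) * (Complex.exp (y / l + y ^ 2 / (2 * l ^ 2)) *
            (1 / l + (2 * y) / (2 * l ^ 2)))) y := by
      have e : sigmaFactor l =
          fun z ↦ (1 - z / l) * Complex.exp (z / l + z ^ 2 / (2 * l ^ 2)) := by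
        ext; simp [sigmaFactor, h0]
      rw [e]
      have h1 : HasDerivAt (fun y : ℂ ↦ y / l) (1 / l) y := (hasDerivAt_id y).div_const l
      have h2 : HasDerivAt (fun y : ℂ ↦ y ^ 2 / (2 * l ^ 2)) ((2 * y) / (2 * l ^ 2)) y := by
        simpa using (hasDerivAt_pow 2 y).div_const (2 * l ^ 2)
      exact (h1.const_sub 1).mul (h1.add h2).cexp
    rw [logDeriv_apply, hd.deriv]
    have hne : y - l ≠ 0 := sub_ne_zero.mpr hy
    have hne' : 1 - y / l ≠ 0 := by
      intro h; apply hne; field_simp at h; linear_combination -h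
    have he := Complex.exp_ne_zero (y / l + y ^ 2 / (2 * l ^ 2))
    simp only [sigmaFactor, if_neg h0]
    generalize Complex.exp (y / l + y ^ 2 / (2 * l ^ 2)) = E at he
    rw [div_eq_iff (mul_ne_zero hne' he)]
    field_simp
    ring
  have hev : logDeriv (sigmaFactor l) =ᶠ[𝓝 z] fun y ↦ 1 / (y - l) + 1 / l + y / l ^ 2 := by
    filter_upwards [isOpen_ne.mem_nhds hz] with y hy using hlog y hy
  refine HasDerivAt.congr_of_eventuallyEq ?_ hev
  have hne : z - l ≠ 0 := sub_ne_zero.mpr hz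
  have h1 : HasDerivAt (fun y : ℂ ↦ 1 / (y - l)) (-1 / (z - l) ^ 2) z := by
    simpa using ((hasDerivAt_id z).sub_const l).fun_inv hne
  refine ((h1.add_const (1 / l)).add ((hasDerivAt_id z).div_const (l ^ 2))).congr_deriv ?_
  field_simp
  ring

lemma deriv_logDeriv_prod_sigmaFactor {z : ℂ} (hz : z ∈ (↑L.lattice \ {0} : Set ℂ)ᶜ)
    (s : Finset L.lattice) :
    deriv (logDeriv (fun z ↦ ∏ l ∈ s, sigmaFactor l z)) z =
      -∑ l ∈ s, (if (l : ℂ) = 0 then 0 else (1 / (z - l) ^ 2 - 1 / (l : ℂ) ^ 2)) := by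
  have hne {y : ℂ} (hy : y ∈ (↑L.lattice \ {0} : Set ℂ)ᶜ) (l : L.lattice) :
      (l : ℂ) = 0 ∨ y ≠ l := by
    by_contra! h
    exact hy ⟨h.2 ▸ l.2, by simpa [h.2] using h.1⟩
  have hev : logDeriv (fun z ↦ ∏ l ∈ s, sigmaFactor l z) =ᶠ[𝓝 z]
      fun y ↦ ∑ l ∈ s, logDeriv (sigmaFactor l) y := by
    filter_upwards [L.isOpen_compl_lattice_sdiff.mem_nhds hz] with y hy
    exact logDeriv_prod (fun l _ ↦ sigmaFactor_ne_zero (hne hy l))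
      (fun l _ ↦ differentiable_sigmaFactor l y)
  rw [hev.deriv_eq, ← Finset.sum_neg_distrib]
  exact (HasDerivAt.fun_sum fun l _ ↦ hasDerivAt_logDeriv_sigmaFactor (hne hz l)).deriv

/-- `(log (σ(z) / z))'' = -(℘(z) - 1 / z²)`: the partial products of `σ(z) / z` converge together
with their first two derivatives. -/
lemma hasDerivAt_logDeriv_sigmaQuot {z : ℂ} (hz : z ∈ (↑L.lattice \ {0} : Set ℂ)ᶜ) :
    HasDerivAt (logDeriv L.sigmaQuot) (-L.weierstrassPExcept 0 z) z := by
  set P : Finset L.lattice → ℂ → ℂ := fun s z ↦ ∏ l ∈ s, sigmaFactor l z with hP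
  have hPd (s) : Differentiable ℂ (P s) := L.differentiable_prod_sigmaFactor s
  have hd {f : ℂ → ℂ} (hf : Differentiable ℂ f) : Differentiable ℂ (deriv f) := by
    rw [← differentiableOn_univ]
    exact (hf.differentiableOn (s := Set.univ)).deriv isOpen_univ
  have t0 := L.tendstoLocallyUniformlyOn_sigmaQuot
  have t1 := t0.deriv (.of_forall fun s ↦ (hPd s).differentiableOn) isOpen_univ
  have t2 := t1.deriv (.of_forall fun s ↦ (hd (hPd s)).differentiableOn) isOpen_univ
  have hdq {f : ℂ → ℂ} (hf : Differentiable ℂ f) (h0 : f z ≠ 0) : HasDerivAt (logDeriv f)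
      ((deriv (deriv f) z * f z - deriv f z * deriv f z) / f z ^ 2) z :=
    (hd hf z).hasDerivAt.div (hf z).hasDerivAt h0
  have hT0 := L.sigmaQuot_ne_zero hz
  have hTd := L.differentiable_sigmaQuot
  refine (hdq hTd hT0).congr_deriv ?_
  have hz' := Set.mem_univ z
  have lim1 := (((t2.tendsto_at hz').mul (t0.tendsto_at hz')).sub
    ((t1.tendsto_at hz').mul (t1.tendsto_at hz'))).div ((t0.tendsto_at hz').pow 2)
      (pow_ne_zero 2 hT0)
  have lim2 : Tendsto (fun s : Finset L.lattice ↦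
      -∑ l ∈ s, (if (l : ℂ) = 0 then 0 else (1 / (z - l) ^ 2 - 1 / (l : ℂ) ^ 2))) atTop
        (𝓝 (-L.weierstrassPExcept 0 z)) :=
    Tendsto.neg (L.hasSum_weierstrassPExcept 0 z)
  refine tendsto_nhds_unique (lim1.congr fun s ↦ ?_) lim2
  have hs0 : P s z ≠ 0 := by
    refine Finset.prod_ne_zero_iff.mpr fun l _ ↦ sigmaFactor_ne_zero ?_
    by_contra! h
    exact hz ⟨h.2 ▸ l.2, by simpa [h.2] using h.1⟩
  rw [← L.deriv_logDeriv_prod_sigmaFactor hz s]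
  exact (hdq (hPd s) hs0).deriv.symm

lemma weierstrassZeta_eq_inv_add {z : ℂ} (hz : z ∉ L.lattice) :
    L.weierstrassZeta z = 1 / z + logDeriv L.sigmaQuot z := by
  have h0 : z ≠ 0 := fun h ↦ hz (h ▸ zero_mem _)
  have h1 := L.sigmaQuot_ne_zero (fun h ↦ hz h.1 : z ∈ (↑L.lattice \ {0} : Set ℂ)ᶜ)
  rw [weierstrassZeta_eq_logDeriv]
  have : L.weierstrassSigma = fun z ↦ id z * L.sigmaQuot z := rfl
  rw [this, logDeriv_mul _ (by simpa using h0) h1 differentiableAt_id (L.differentiable_sigmaQuot z),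
    logDeriv_id]

lemma isOpen_compl_lattice : IsOpen ((L.lattice : Set ℂ)ᶜ) := L.isClosed_lattice.isOpen_compl

lemma weierstrassPExcept_zero_eq (z : ℂ) :
    L.weierstrassPExcept 0 z = L.weierstrassP z - 1 / z ^ 2 := by
  have := L.weierstrassPExcept_def 0 z
  simp only [ZeroMemClass.coe_zero, sub_zero] at this
  rw [this]
  simp
  ring

lemma hasDerivAt_weierstrassZeta {z : ℂ} (hz : z ∉ L.lattice) :
    HasDerivAt L.weierstrassZeta (-L.weierstrassP z) z := by
  have h0 : z ≠ 0 := fun h ↦ hz (h ▸ zero_mem _)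
  have hev : L.weierstrassZeta =ᶠ[𝓝 z] fun z ↦ 1 / z + logDeriv L.sigmaQuot z := by
    filter_upwards [L.isOpen_compl_lattice.mem_nhds hz] with y hy
    exact L.weierstrassZeta_eq_inv_add hy
  refine HasDerivAt.congr_of_eventuallyEq ?_ hev
  have h1 : HasDerivAt (fun y : ℂ ↦ 1 / y) (-1 / z ^ 2) z := by
    simpa using (hasDerivAt_id z).fun_inv h0
  refine (h1.add (L.hasDerivAt_logDeriv_sigmaQuot (fun h ↦ hz h.1))).congr_deriv ?_
  rw [weierstrassPExcept_zero_eq]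
  ring

lemma hasDerivAt_weierstrassSigma {z : ℂ} (hz : z ∉ L.lattice) :
    HasDerivAt L.weierstrassSigma (L.weierstrassZeta z * L.weierstrassSigma z) z := by
  exact (L.differentiable_weierstrassSigma z).hasDerivAt.congr_deriv
    (div_mul_cancel₀ _ (L.weierstrassSigma_ne_zero hz)).symm

lemma countable_lattice : (L.lattice : Set ℂ).Countable :=
  Set.countable_coe_iff.mp (inferInstanceAs (Countable L.lattice))

lemma isPreconnected_compl_lattice : IsPreconnected ((L.lattice : Set ℂ)ᶜ) :=
  (L.countable_lattice.isConnected_compl_of_one_lt_rank (by simp)).isPreconnected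

end PeriodPair

/-- Functions continuous at `z` agree at `z` if they agree near `z` off a countable set. -/
lemma ContinuousAt.eq_of_eventually_eq_compl_countable {f g : ℂ → ℂ} {z : ℂ} {S : Set ℂ}
    (hS : S.Countable) (hf : ContinuousAt f z) (hg : ContinuousAt g z)
    (h : ∀ᶠ y in 𝓝 z, y ∉ S → f y = g y) : f z = g z := by
  have hfr : ∃ᶠ y in 𝓝 z, y ∈ Sᶜ := mem_closure_iff_frequently.mp (hS.dense_compl ℂ z)
  exact tendsto_nhds_unique_of_frequently_eq hf hg
    ((hfr.and_eventually h).mono fun y hy ↦ hy.2 hy.1)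

namespace PeriodPair

variable (L : PeriodPair)

open scoped PeriodPair

lemma add_mem_iff_notMem {z l : ℂ} (hl : l ∈ L.lattice) : z + l ∉ L.lattice ↔ z ∉ L.lattice :=
  not_congr (Submodule.add_mem_iff_left _ hl)

lemma neg_notMem {z : ℂ} (hz : z ∉ L.lattice) : -z ∉ L.lattice :=
  fun h ↦ hz (by simpa using neg_mem h)

lemma weierstrassP_add_mem {l : ℂ} (hl : l ∈ L.lattice) (z : ℂ) : ℘[L] (z + l) = ℘[L] z :=
  L.weierstrassP_add_coe z ⟨l, hl⟩

lemma derivWeierstrassP_add_mem {l : ℂ} (hl : l ∈ L.lattice) (z : ℂ) : ℘'[L] (z + l) = ℘'[L] z :=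
  L.derivWeierstrassP_add_coe z ⟨l, hl⟩

lemma analyticAt_weierstrassP {z : ℂ} (hz : z ∉ L.lattice) : AnalyticAt ℂ ℘[L] z :=
  L.analyticOnNhd_weierstrassP z hz

lemma analyticAt_derivWeierstrassP {z : ℂ} (hz : z ∉ L.lattice) : AnalyticAt ℂ ℘'[L] z :=
  L.analyticOnNhd_derivWeierstrassP z hz

lemma hasDerivAt_weierstrassP {z : ℂ} (hz : z ∉ L.lattice) : HasDerivAt ℘[L] (℘'[L] z) z := by
  have := (L.analyticAt_weierstrassP hz).differentiableAt.hasDerivAt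
  rwa [deriv_weierstrassP] at this

lemma hasDerivAt_derivWeierstrassP {z : ℂ} (hz : z ∉ L.lattice) :
    HasDerivAt ℘'[L] (deriv ℘'[L] z) z :=
  (L.analyticAt_derivWeierstrassP hz).differentiableAt.hasDerivAt

/-! ### Quasi-periodicity of `ζ` and `σ` -/

/-- `ζ` is quasi-periodic, as its derivative `-℘` is periodic. -/
lemma exists_weierstrassZeta_add {l : ℂ} (hl : l ∈ L.lattice) :
    ∃ η : ℂ, ∀ z ∉ L.lattice, L.weierstrassZeta (z + l) = L.weierstrassZeta z + η := by
  have hd : ∀ z ∈ (L.lattice : Set ℂ)ᶜ,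
      HasDerivAt (fun z ↦ L.weierstrassZeta (z + l) - L.weierstrassZeta z) 0 z := by
    intro z hz
    have h1 := (L.hasDerivAt_weierstrassZeta
      ((L.add_mem_iff_notMem (z := z) hl).mpr hz)).comp_add_const z l
    refine (h1.sub (L.hasDerivAt_weierstrassZeta hz)).congr_deriv ?_
    rw [L.weierstrassP_add_mem hl, sub_self]
  obtain ⟨η, hη⟩ := L.isOpen_compl_lattice.exists_is_const_of_deriv_eq_zero
    L.isPreconnected_compl_lattice
    (fun z hz ↦ (hd z hz).differentiableAt.differentiableWithinAt) (fun z hz ↦ (hd z hz).deriv)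
  exact ⟨η, fun z hz ↦ by linear_combination hη z hz⟩

/-- If `2h` is a period and `h` is not, the quasi-period of `ζ` for `2h` is `2 ζ(h)`. -/
lemma weierstrassZeta_add_two_mul {h z : ℂ} (hh : h ∉ L.lattice) (h2 : 2 * h ∈ L.lattice)
    (hz : z ∉ L.lattice) :
    L.weierstrassZeta (z + 2 * h) = L.weierstrassZeta z + 2 * L.weierstrassZeta h := by
  obtain ⟨η, hη⟩ := L.exists_weierstrassZeta_add h2
  have h1 := hη (-h) (L.neg_notMem hh)
  rw [show -h + 2 * h = h by ring, weierstrassZeta_neg] at h1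
  rw [hη z hz]
  linear_combination -h1

/-- The logarithmic derivative of `σ(z + l) exp (-η z) / σ(z)` vanishes. -/
lemma exists_weierstrassSigma_add {l : ℂ} {η : ℂ} (hl : l ∈ L.lattice)
    (hη : ∀ z ∉ L.lattice, L.weierstrassZeta (z + l) = L.weierstrassZeta z + η) :
    ∃ C : ℂ, ∀ z, L.weierstrassSigma (z + l) =
      C * Complex.exp (η * z) * L.weierstrassSigma z := by
  have hd : ∀ z ∈ (L.lattice : Set ℂ)ᶜ, HasDerivAt (fun z ↦ L.weierstrassSigma (z + l) *
      Complex.exp (-(η * z)) / L.weierstrassSigma z) 0 z := by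
    intro z hz
    have h1 := (L.hasDerivAt_weierstrassSigma
      ((L.add_mem_iff_notMem (z := z) hl).mpr hz)).comp_add_const z l
    have h2 : HasDerivAt (fun z ↦ Complex.exp (-(η * z))) (Complex.exp (-(η * z)) * (-(η * 1))) z :=
      (((hasDerivAt_id z).const_mul η).neg).cexp
    refine ((h1.mul h2).div (L.hasDerivAt_weierstrassSigma hz)
      (L.weierstrassSigma_ne_zero hz)).congr_deriv ?_
    rw [Pi.mul_apply, hη z hz]
    ring
  obtain ⟨C, hC⟩ := L.isOpen_compl_lattice.exists_is_const_of_deriv_eq_zero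
    L.isPreconnected_compl_lattice
    (fun z hz ↦ (hd z hz).differentiableAt.differentiableWithinAt) (fun z hz ↦ (hd z hz).deriv)
  refine ⟨C, fun z ↦ ?_⟩
  by_cases hz : z ∈ L.lattice
  · rw [L.weierstrassSigma_of_mem hz, L.weierstrassSigma_of_mem (add_mem hz hl), mul_zero]
  · have h3 := hC z hz
    rw [div_eq_iff (L.weierstrassSigma_ne_zero hz), Complex.exp_neg,
      mul_inv_eq_iff_eq_mul₀ (Complex.exp_ne_zero _)] at h3
    rw [h3]
    ring

/-- Quasi-periodicity of `σ` for a period `2h` whose half is not a period. -/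
lemma weierstrassSigma_add_two_mul {h : ℂ} (hh : h ∉ L.lattice) (h2 : 2 * h ∈ L.lattice) (z : ℂ) :
    L.weierstrassSigma (z + 2 * h) =
      -Complex.exp (2 * L.weierstrassZeta h * (z + h)) * L.weierstrassSigma z := by
  obtain ⟨C, hC⟩ := L.exists_weierstrassSigma_add h2
    (fun z hz ↦ L.weierstrassZeta_add_two_mul hh h2 hz)
  have h1 := hC (-h)
  rw [show -h + 2 * h = h by ring, weierstrassSigma_neg] at h1
  have hs := L.weierstrassSigma_ne_zero hh
  have h3 : C = -Complex.exp (2 * L.weierstrassZeta h * h) := by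
    have h4 : C * Complex.exp (2 * L.weierstrassZeta h * -h) = -1 := by
      apply mul_right_cancel₀ hs
      linear_combination h1
    rw [mul_neg, Complex.exp_neg, mul_inv_eq_iff_eq_mul₀ (Complex.exp_ne_zero _)] at h4
    rw [h4]
    ring
  rw [hC z, h3, mul_add, Complex.exp_add]
  ring

/-! ### Liouville's theorem for periodic functions and the first identities -/

/-- A function that is periodic, holomorphic off the lattice and `o(1 / z)` at the origin is
constant. -/
lemma exists_eq_const_of_periodic {f : ℂ → ℂ} (hd : DifferentiableOn ℂ f (L.lattice : Set ℂ)ᶜ)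
    (hp : ∀ l ∈ L.lattice, ∀ z ∉ L.lattice, f (z + l) = f z)
    (h0 : Tendsto (fun z ↦ z * f z) (𝓝[≠] 0) (𝓝 0)) : ∃ c, ∀ z ∉ L.lattice, f z = c := by
  classical
  set c := (𝓝[≠] (0 : ℂ)).limUnder f with hc
  set g : ℂ → ℂ := fun z ↦ if z ∈ L.lattice then c else f z with hg
  have hs : (↑L.lattice \ {(0 : ℂ)})ᶜ ∈ 𝓝 (0 : ℂ) := L.compl_lattice_sdiff_singleton_mem_nhds 0
  have hsub : ((↑L.lattice \ {(0 : ℂ)})ᶜ : Set ℂ) \ {0} ⊆ (L.lattice : Set ℂ)ᶜ := by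
    rintro z ⟨h1, h2⟩ h3
    exact h1 ⟨h3, h2⟩
  have hlo : (fun z ↦ f z - f 0) =o[𝓝[≠] 0] fun z ↦ (z - 0)⁻¹ := by
    rw [Asymptotics.isLittleO_iff_tendsto']
    · have h1 : Tendsto (fun z : ℂ ↦ z * f 0) (𝓝[≠] 0) (𝓝 0) := by
        have : Tendsto (fun z : ℂ ↦ z * f 0) (𝓝 0) (𝓝 (0 * f 0)) :=
          (continuous_id.mul continuous_const).tendsto 0
        rw [zero_mul] at this
        exact this.mono_left nhdsWithin_le_nhds
      have h2 := h0.sub h1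
      rw [sub_zero] at h2
      refine h2.congr fun z ↦ ?_
      rw [sub_zero, div_inv_eq_mul]
      ring
    · filter_upwards [self_mem_nhdsWithin] with z hz h
      simp only [sub_zero, inv_eq_zero] at h
      exact absurd h hz
  have hd0 := Complex.differentiableOn_update_limUnder_of_isLittleO hs (hd.mono hsub) hlo
  have hg0 : DifferentiableAt ℂ g 0 := by
    refine ((hd0 0 (mem_of_mem_nhds hs)).differentiableAt hs).congr_of_eventuallyEq ?_
    filter_upwards [hs] with z hz
    by_cases hz0 : z = 0
    · simp [hg, hz0, hc]
    · rw [Function.update_of_ne hz0, hg]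
      exact if_neg fun h ↦ hz ⟨h, hz0⟩
  have hgp : ∀ z l : ℂ, l ∈ L.lattice → g (z + l) = g z := by
    intro z l hl
    by_cases hz : z ∈ L.lattice
    · simp only [hg]
      rw [if_pos hz, if_pos (add_mem hz hl)]
    · simp only [hg]
      rw [if_neg hz, if_neg ((L.add_mem_iff_notMem hl).mpr hz), hp l hl z hz]
  have hgd : Differentiable ℂ g := by
    intro z
    by_cases hz : z ∈ L.lattice
    · have h1 : g = fun y ↦ g (y - z) := by
        ext y
        rw [← hgp (y - z) z hz, sub_add_cancel]
      rw [h1]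
      have : DifferentiableAt ℂ g (z - z) := by rwa [sub_self]
      exact this.comp (f := fun y ↦ y - z) z (differentiableAt_id.sub_const z)
    · have h1 := L.isOpen_compl_lattice.mem_nhds hz
      refine (hd.differentiableAt h1).congr_of_eventuallyEq ?_
      filter_upwards [h1] with y hy
      exact if_neg hy
  refine ⟨g 0, fun z hz ↦ ?_⟩
  have h2 := hgd.apply_eq_apply_of_bounded
    (IsZLattice.isCompact_range_of_periodic L.lattice g hgd.continuous
      (fun z w hw ↦ hgp z w hw)).isBounded z 0
  rw [← h2, hg]
  exact (if_neg hz).symm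

/-- The principal part of `℘` at the origin is `z⁻²`: the function on the right is holomorphic near
the origin, with value `1` there. -/
lemma sq_mul_weierstrassP_eq {z : ℂ} (hz : z ≠ 0) :
    z ^ 2 * ℘[L] z = z ^ 2 * ℘[L - (0 : ℂ)] z + 1 := by
  rw [weierstrassPExcept_zero_eq]
  field_simp
  ring

lemma tendsto_sq_mul_weierstrassP : Tendsto (fun z ↦ z ^ 2 * ℘[L] z) (𝓝[≠] 0) (𝓝 1) := by
  have h1 : Tendsto (fun z ↦ z ^ 2 * ℘[L - (0 : ℂ)] z + 1) (𝓝 0)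
      (𝓝 (0 ^ 2 * ℘[L - (0 : ℂ)] 0 + 1)) :=
    ((continuousAt_id.pow 2).mul (L.analyticAt_weierstrassPExcept 0).continuousAt).add
      continuousAt_const
  simp only [ne_eq, OfNat.ofNat_ne_zero, not_false_eq_true, zero_pow, zero_mul, zero_add] at h1
  refine (h1.mono_left nhdsWithin_le_nhds).congr' ?_
  filter_upwards [self_mem_nhdsWithin] with z hz
  rw [L.sq_mul_weierstrassP_eq hz]

lemma tendsto_cube_mul_derivWeierstrassP :
    Tendsto (fun z ↦ z ^ 3 * ℘'[L] z) (𝓝[≠] 0) (𝓝 (-2)) := by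
  have h1 : Tendsto (fun z ↦ z ^ 3 * ℘'[L - (0 : ℂ)] z - 2) (𝓝 0)
      (𝓝 (0 ^ 3 * ℘'[L - (0 : ℂ)] 0 - 2)) :=
    ((continuousAt_id.pow 3).mul (L.analyticAt_derivWeierstrassPExcept 0).continuousAt).sub
      continuousAt_const
  simp only [ne_eq, OfNat.ofNat_ne_zero, not_false_eq_true, zero_pow, zero_mul, zero_sub] at h1
  refine (h1.mono_left nhdsWithin_le_nhds).congr' ?_
  filter_upwards [self_mem_nhdsWithin] with z hz
  have h2 := L.derivWeierstrassPExcept_def 0 z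
  simp only [ZeroMemClass.coe_zero, sub_zero] at h2
  rw [h2]
  have : z ≠ 0 := hz
  field_simp
  ring

/-- `℘(u) - ℘(w) = - σ(u + w) σ(u - w) / (σ(u)² σ(w)²)`. -/
lemma weierstrassP_sub_mul_sigma_sq {u w : ℂ} (hu : u ∉ L.lattice) (hw : w ∉ L.lattice) :
    (℘[L] u - ℘[L] w) * L.weierstrassSigma u ^ 2 * L.weierstrassSigma w ^ 2 =
      -(L.weierstrassSigma (u + w) * L.weierstrassSigma (u - w)) := by
  set f : ℂ → ℂ := fun u ↦ L.weierstrassSigma (u + w) * L.weierstrassSigma (u - w) /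
    L.weierstrassSigma u ^ 2 + L.weierstrassSigma w ^ 2 * ℘[L] u with hf
  have hd : DifferentiableOn ℂ f (L.lattice : Set ℂ)ᶜ := by
    intro z hz
    have h1 := (L.hasDerivAt_weierstrassP hz).differentiableAt
    have h2 := L.weierstrassSigma_ne_zero hz
    have h3 : DifferentiableAt ℂ (fun u ↦ L.weierstrassSigma (u + w) * L.weierstrassSigma (u - w) /
      L.weierstrassSigma u ^ 2) z := by
      refine DifferentiableAt.div ?_ ?_ (pow_ne_zero 2 h2)
      · exact ((L.differentiable_weierstrassSigma _).comp z (differentiableAt_id.add_const w)).mul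
          ((L.differentiable_weierstrassSigma _).comp z (differentiableAt_id.sub_const w))
      · exact (L.differentiable_weierstrassSigma z).pow 2
    exact (h3.add (h1.const_mul _)).differentiableWithinAt
  have hp : ∀ l ∈ L.lattice, ∀ z ∉ L.lattice, f (z + l) = f z := by
    intro l hl z hz
    obtain ⟨η, hη⟩ := L.exists_weierstrassZeta_add hl
    obtain ⟨C, hC⟩ := L.exists_weierstrassSigma_add hl hη
    have h1 : C * Complex.exp (η * z) ≠ 0 := by
      intro h
      have h2 := hC z
      rw [h, zero_mul] at h2
      exact L.weierstrassSigma_ne_zero ((L.add_mem_iff_notMem hl).mpr hz) h2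
    have h3 : Complex.exp (η * (z + w)) * Complex.exp (η * (z - w)) =
        Complex.exp (η * z) ^ 2 := by
      rw [← Complex.exp_add, sq, ← Complex.exp_add]
      congr 1
      ring
    simp only [hf]
    rw [L.weierstrassP_add_mem hl, show z + l + w = z + w + l by ring,
      show z + l - w = z - w + l by ring, hC, hC, hC]
    congr 1
    have h2 := L.weierstrassSigma_ne_zero hz
    rw [div_eq_div_iff (pow_ne_zero 2 (mul_ne_zero h1 h2)) (pow_ne_zero 2 h2)]
    linear_combination (C ^ 2 * L.weierstrassSigma (z + w) * L.weierstrassSigma (z - w) *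
      L.weierstrassSigma z ^ 2) * h3
  -- `z² f(z)` extends to an even holomorphic function that vanishes at the origin.
  have h0 : Tendsto (fun z ↦ z * f z) (𝓝[≠] 0) (𝓝 0) := by
    set h : ℂ → ℂ := fun z ↦ L.weierstrassSigma (z + w) * L.weierstrassSigma (z - w) /
      L.sigmaQuot z ^ 2 + L.weierstrassSigma w ^ 2 * (z ^ 2 * ℘[L - (0 : ℂ)] z + 1) with hh
    have hq0 : L.sigmaQuot 0 ≠ 0 := by rw [sigmaQuot_zero]; exact one_ne_zero
    have hdh : DifferentiableAt ℂ h 0 := by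
      refine DifferentiableAt.add (DifferentiableAt.div ?_ ?_ (pow_ne_zero 2 hq0)) ?_
      · exact ((L.differentiable_weierstrassSigma _).comp 0 (differentiableAt_id.add_const w)).mul
          ((L.differentiable_weierstrassSigma _).comp 0 (differentiableAt_id.sub_const w))
      · exact (L.differentiable_sigmaQuot 0).pow 2
      · exact (((differentiableAt_id.pow 2).mul
          (L.analyticAt_weierstrassPExcept 0).differentiableAt).add_const 1).const_mul _
    have hev : ∀ z, h (-z) = h z := by
      intro z
      simp only [hh]
      rw [sigmaQuot_neg, weierstrassPExcept_neg, show -z + w = -(z - w) by ring,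
        show -z - w = -(z + w) by ring, weierstrassSigma_neg, weierstrassSigma_neg, neg_zero]
      ring
    have hd0 : deriv h 0 = 0 := by
      have h1 := deriv_comp_neg h 0
      simp only [hev, neg_zero] at h1
      exact self_eq_neg.mp h1
    have hh0 : h 0 = 0 := by
      simp [hh, sigmaQuot_zero]
      ring
    have h2 := hdh.hasDerivAt
    rw [hd0, hasDerivAt_iff_tendsto_slope] at h2
    refine h2.congr' ?_
    filter_upwards [self_mem_nhdsWithin, mem_nhdsWithin_of_mem_nhds
      (L.compl_lattice_sdiff_singleton_mem_nhds 0)] with z hz hz'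
    have hz0 : z ≠ 0 := hz
    have hq := L.sigmaQuot_ne_zero hz'
    rw [slope_def_field, hh0, sub_zero, sub_zero]
    simp only [hh, hf]
    rw [← L.sq_mul_weierstrassP_eq hz0, L.weierstrassSigma_eq z]
    field_simp
  obtain ⟨c, hc⟩ := L.exists_eq_const_of_periodic hd hp h0
  have h1 := hc w hw
  have h2 := hc u hu
  have hs := L.weierstrassSigma_ne_zero hu
  have hz : L.weierstrassSigma 0 = 0 := L.weierstrassSigma_of_mem (zero_mem _)
  simp only [hf, sub_self, hz, mul_zero, zero_div, zero_add] at h1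
  rw [← h1] at h2
  simp only [hf] at h2
  field_simp at h2
  linear_combination h2

/-- Read off from the factorization of `℘(u) - ℘(w)` into values of `σ`. -/
lemma weierstrassP_eq_iff {u w : ℂ} (hu : u ∉ L.lattice) (hw : w ∉ L.lattice) :
    ℘[L] u = ℘[L] w ↔ u + w ∈ L.lattice ∨ u - w ∈ L.lattice := by
  have h1 := L.weierstrassP_sub_mul_sigma_sq hu hw
  have hs := L.weierstrassSigma_ne_zero hu
  have hs' := L.weierstrassSigma_ne_zero hw
  rw [← sub_eq_zero, ← L.weierstrassSigma_eq_zero_iff, ← L.weierstrassSigma_eq_zero_iff,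
    ← mul_eq_zero, ← neg_eq_zero (a := _ * _), ← h1]
  simp [hs, hs']

/-- `℘'(u) / (℘(u) - ℘(w)) = ζ(u + w) + ζ(u - w) - 2 ζ(u)`. -/
lemma derivWeierstrassP_eq_mul_zeta {u w : ℂ} (hu : u ∉ L.lattice) (hw : w ∉ L.lattice)
    (hne : ℘[L] u ≠ ℘[L] w) :
    ℘'[L] u = (℘[L] u - ℘[L] w) * (L.weierstrassZeta (u + w) + L.weierstrassZeta (u - w) -
      2 * L.weierstrassZeta u) := by
  have h2 := mt (L.weierstrassP_eq_iff hu hw).mpr hne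
  push Not at h2
  obtain ⟨hp, hm⟩ := h2
  have hev : (fun u ↦ (℘[L] u - ℘[L] w) * L.weierstrassSigma u ^ 2 * L.weierstrassSigma w ^ 2)
      =ᶠ[𝓝 u] fun u ↦ -(L.weierstrassSigma (u + w) * L.weierstrassSigma (u - w)) := by
    filter_upwards [L.isOpen_compl_lattice.mem_nhds hu] with y hy
    exact L.weierstrassP_sub_mul_sigma_sq hy hw
  have d1 := ((((L.hasDerivAt_weierstrassP hu).sub_const (℘[L] w)).mul
    ((L.hasDerivAt_weierstrassSigma hu).pow 2)).mul_const (L.weierstrassSigma w ^ 2))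
  have d2 := (((L.hasDerivAt_weierstrassSigma hp).comp_add_const u w).mul
    ((L.hasDerivAt_weierstrassSigma hm).comp_sub_const u w)).neg
  have h3 := (d1.congr_of_eventuallyEq hev.symm).unique d2
  have h1 := L.weierstrassP_sub_mul_sigma_sq hu hw
  have hs := L.weierstrassSigma_ne_zero hu
  have hs' := L.weierstrassSigma_ne_zero hw
  apply mul_right_cancel₀ (mul_ne_zero (pow_ne_zero 2 hs) (pow_ne_zero 2 hs'))
  simp only [Nat.cast_ofNat, Pi.pow_apply] at h3
  linear_combination h3 - (L.weierstrassZeta (u + w) + L.weierstrassZeta (u - w)) * h1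

/-- The addition formula for `ζ`: combine `derivWeierstrassP_eq_mul_zeta` for `(u, w)` and
`(w, u)`. -/
lemma zeta_sub_sub_zeta_add_zeta {u w : ℂ} (hu : u ∉ L.lattice) (hw : w ∉ L.lattice)
    (hne : ℘[L] u ≠ ℘[L] w) :
    L.weierstrassZeta (u - w) - L.weierstrassZeta u + L.weierstrassZeta w =
      1 / 2 * ((℘'[L] u + ℘'[L] w) / (℘[L] u - ℘[L] w)) := by
  have h1 := L.derivWeierstrassP_eq_mul_zeta hu hw hne
  have h2 := L.derivWeierstrassP_eq_mul_zeta hw hu hne.symm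
  have h3 : L.weierstrassZeta (w - u) = -L.weierstrassZeta (u - w) := by
    rw [← weierstrassZeta_neg, neg_sub]
  rw [h1, h2, h3, add_comm w u]
  have : ℘[L] u - ℘[L] w ≠ 0 := sub_ne_zero.mpr hne
  field_simp
  ring

/-- `℘'(w) = - σ(2w) / σ(w)⁴`. -/
lemma derivWeierstrassP_mul_sigma_pow {w : ℂ} (hw : w ∉ L.lattice) :
    ℘'[L] w * L.weierstrassSigma w ^ 4 = -L.weierstrassSigma (2 * w) := by
  have hev : (fun u ↦ (℘[L] u - ℘[L] w) * L.weierstrassSigma u ^ 2 * L.weierstrassSigma w ^ 2)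
      =ᶠ[𝓝 w] fun u ↦ -(L.weierstrassSigma (u + w) * L.weierstrassSigma (u - w)) := by
    filter_upwards [L.isOpen_compl_lattice.mem_nhds hw] with y hy
    exact L.weierstrassP_sub_mul_sigma_sq hy hw
  have d1 := ((((L.hasDerivAt_weierstrassP hw).sub_const (℘[L] w)).mul
    ((L.hasDerivAt_weierstrassSigma hw).pow 2)).mul_const (L.weierstrassSigma w ^ 2))
  have hd (z) := (L.differentiable_weierstrassSigma z).hasDerivAt
  have d2 := (((hd (w + w)).comp_add_const w w).mul ((hd (w - w)).comp_sub_const w w)).neg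
  have h3 := (d1.congr_of_eventuallyEq hev.symm).unique d2
  have hz : L.weierstrassSigma 0 = 0 := L.weierstrassSigma_of_mem (zero_mem _)
  simp only [sub_self, hz, deriv_weierstrassSigma_zero, ← two_mul, Pi.pow_apply] at h3
  linear_combination h3

/-- The zeros of `℘'` are the half periods, as `℘'(w) σ(w)⁴ = -σ(2w)`. -/
lemma derivWeierstrassP_eq_zero_iff {w : ℂ} (hw : w ∉ L.lattice) :
    ℘'[L] w = 0 ↔ 2 * w ∈ L.lattice := by
  have h1 := L.derivWeierstrassP_mul_sigma_pow hw
  have hs := L.weierstrassSigma_ne_zero hw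
  rw [← L.weierstrassSigma_eq_zero_iff, ← neg_eq_zero (a := L.weierstrassSigma _), ← h1]
  simp [hs]

/-- The duplication formula for `ζ`. -/
lemma zeta_two_mul {v : ℂ} (hv : 2 * v ∉ L.lattice) :
    L.weierstrassZeta (2 * v) = 2 * L.weierstrassZeta v + 1 / 2 * (deriv ℘'[L] v / ℘'[L] v) := by
  have hv1 : v ∉ L.lattice := fun h ↦ hv (by rw [two_mul]; exact add_mem h h)
  have hev : (fun u ↦ ℘'[L] u * L.weierstrassSigma u ^ 4) =ᶠ[𝓝 v]
      fun u ↦ -L.weierstrassSigma (2 * u) := by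
    filter_upwards [L.isOpen_compl_lattice.mem_nhds hv1] with y hy
    exact L.derivWeierstrassP_mul_sigma_pow hy
  have d1 := (L.hasDerivAt_derivWeierstrassP hv1).mul ((L.hasDerivAt_weierstrassSigma hv1).pow 4)
  have d2 : HasDerivAt (fun u ↦ -L.weierstrassSigma (2 * u))
      (-(L.weierstrassZeta (2 * v) * L.weierstrassSigma (2 * v) * (2 * 1))) v :=
    ((L.hasDerivAt_weierstrassSigma hv).comp v ((hasDerivAt_id v).const_mul 2)).neg
  have h3 := (d1.congr_of_eventuallyEq hev.symm).unique d2
  have h1 := L.derivWeierstrassP_mul_sigma_pow hv1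
  have hs := L.weierstrassSigma_ne_zero hv1
  have hp : ℘'[L] v ≠ 0 := mt (L.derivWeierstrassP_eq_zero_iff hv1).mp hv
  simp only [Nat.cast_ofNat, Pi.pow_apply, Nat.add_one_sub_one] at h3
  have h4 : deriv ℘'[L] v + 4 * ℘'[L] v * L.weierstrassZeta v =
      2 * L.weierstrassZeta (2 * v) * ℘'[L] v := by
    apply mul_right_cancel₀ (pow_ne_zero 4 hs)
    linear_combination h3 - 2 * L.weierstrassZeta (2 * v) * h1
  field_simp
  linear_combination -h4

lemma countable_two_mul : {z : ℂ | 2 * z ∈ L.lattice}.Countable :=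
  L.countable_lattice.preimage (mul_right_injective₀ two_ne_zero)

/-- `℘'' = 6 ℘² - g₂ / 2`. -/
lemma deriv_derivWeierstrassP {z : ℂ} (hz : z ∉ L.lattice) :
    deriv ℘'[L] z = 6 * ℘[L] z ^ 2 - L.g₂ / 2 := by
  have hmem := L.isOpen_compl_lattice.mem_nhds hz
  refine ContinuousAt.eq_of_eventually_eq_compl_countable L.countable_two_mul
    (g := fun z ↦ 6 * ℘[L] z ^ 2 - L.g₂ / 2)
    (L.analyticAt_derivWeierstrassP hz).deriv.continuousAt ?_ ?_
  · exact (((L.analyticAt_weierstrassP hz).continuousAt.pow 2).const_mul 6).sub continuousAt_const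
  · filter_upwards [hmem] with y hy hy2
    have hp : ℘'[L] y ≠ 0 := mt (L.derivWeierstrassP_eq_zero_iff hy).mp hy2
    have hev : (fun u ↦ ℘'[L] u ^ 2) =ᶠ[𝓝 y]
        fun u ↦ 4 * ℘[L] u ^ 3 - L.g₂ * ℘[L] u - L.g₃ := by
      filter_upwards [L.isOpen_compl_lattice.mem_nhds hy] with x hx
      exact L.derivWeierstrassP_sq x hx
    have d1 := (L.hasDerivAt_derivWeierstrassP hy).pow 2
    have d0 := L.hasDerivAt_weierstrassP hy
    have d2 := (((d0.pow 3).const_mul 4).sub (d0.const_mul L.g₂)).sub_const L.g₃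
    have h3 := (d1.congr_of_eventuallyEq hev.symm).unique d2
    simp only [Nat.cast_ofNat, Nat.add_one_sub_one, pow_one] at h3
    apply mul_left_cancel₀ hp
    linear_combination h3 / 2

/-- `℘` takes every value, as otherwise `1 / (℘ - c)` would be constant. -/
lemma exists_weierstrassP_eq (c : ℂ) : ∃ z ∉ L.lattice, ℘[L] z = c := by
  by_contra! hne
  have hne' : ∀ z ∉ L.lattice, ℘[L] z - c ≠ 0 := fun z hz ↦ sub_ne_zero.mpr (hne z hz)
  have hl : Tendsto (fun z ↦ z ^ 2 * (℘[L] z - c)) (𝓝[≠] 0) (𝓝 1) := by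
    have h1 : Tendsto (fun z : ℂ ↦ z ^ 2 * c) (𝓝[≠] 0) (𝓝 (0 ^ 2 * c)) :=
      (((continuous_pow 2).mul continuous_const).tendsto 0).mono_left nhdsWithin_le_nhds
    have h2 := L.tendsto_sq_mul_weierstrassP.sub h1
    simp only [ne_eq, OfNat.ofNat_ne_zero, not_false_eq_true, zero_pow, zero_mul, sub_zero] at h2
    exact h2.congr fun z ↦ by ring
  have hid (n : ℕ) (hn : n ≠ 0) : Tendsto (fun z : ℂ ↦ z ^ n) (𝓝[≠] 0) (𝓝 0) := by
    have := (continuous_pow (M := ℂ) n).tendsto 0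
    rw [zero_pow hn] at this
    exact this.mono_left nhdsWithin_le_nhds
  obtain ⟨b, hb⟩ := L.exists_eq_const_of_periodic (f := fun z ↦ (℘[L] z - c)⁻¹)
    (fun z hz ↦ ((((L.hasDerivAt_weierstrassP hz).sub_const c).differentiableAt.inv
      (hne' z hz))).differentiableWithinAt)
    (fun l hl z hz ↦ by rw [L.weierstrassP_add_mem hl]) (by
      have h1 := (hid 3 (by norm_num)).mul (hl.inv₀ one_ne_zero)
      rw [zero_mul] at h1
      refine h1.congr' ?_
      filter_upwards [self_mem_nhdsWithin] with z hz
      have : z ≠ 0 := hz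
      rw [mul_inv]
      field_simp)
  have hoff : ∀ᶠ z in 𝓝[≠] (0 : ℂ), z ∉ L.lattice := by
    filter_upwards [self_mem_nhdsWithin, mem_nhdsWithin_of_mem_nhds
      (L.compl_lattice_sdiff_singleton_mem_nhds 0)] with z hz hz' h
    exact hz' ⟨h, hz⟩
  have h2 : Tendsto (fun z : ℂ ↦ z ^ 2 * b⁻¹) (𝓝[≠] 0) (𝓝 1) := by
    refine hl.congr' ?_
    filter_upwards [hoff] with z hz
    rw [← hb z hz, inv_inv]
  have h3 := (hid 2 (by norm_num)).mul_const b⁻¹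
  rw [zero_mul] at h3
  exact one_ne_zero (tendsto_nhds_unique h2 h3)

end PeriodPair

namespace PeriodPair

variable (L : PeriodPair)

open scoped PeriodPair

/-! ### Half periods -/

lemma add_mul_mem_lattice_iff {x y : ℝ} :
    (x : ℂ) * L.ω₁ + (y : ℂ) * L.ω₂ ∈ L.lattice ↔ (∃ m : ℤ, x = m) ∧ ∃ n : ℤ, y = n := by
  constructor
  · intro h
    obtain ⟨m, n, e⟩ := mem_lattice.mp h
    have := LinearIndependent.pair_iff.mp L.indep (m - x) (n - y) (by
      simp only [Complex.real_smul, Complex.ofReal_sub, Complex.ofReal_intCast]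
      linear_combination e)
    exact ⟨⟨m, by linarith [this.1]⟩, ⟨n, by linarith [this.2]⟩⟩
  · rintro ⟨⟨m, rfl⟩, n, rfl⟩
    exact mem_lattice.mpr ⟨m, n, by push_cast; ring⟩

lemma half_mem_lattice_iff (m n : ℤ) :
    ((m : ℂ) * L.ω₁ + n * L.ω₂) / 2 ∈ L.lattice ↔ Even m ∧ Even n := by
  have h := L.add_mul_mem_lattice_iff (x := m / 2) (y := n / 2)
  rw [show ((m / 2 : ℝ) : ℂ) * L.ω₁ + ((n / 2 : ℝ) : ℂ) * L.ω₂ = (m * L.ω₁ + n * L.ω₂) / 2 by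
    push_cast; ring] at h
  have key (k : ℤ) : (∃ r : ℤ, (k : ℝ) / 2 = r) ↔ Even k := by
    constructor
    · rintro ⟨r, hr⟩
      refine ⟨r, ?_⟩
      have : (k : ℝ) = r + r := by linarith
      exact_mod_cast this
    · rintro ⟨r, rfl⟩
      exact ⟨r, by push_cast; ring⟩
  rw [h, key, key]

@[simp] lemma halfPeriod_zero : L.halfPeriod 0 = 0 := rfl
lemma halfPeriod_one : L.halfPeriod 1 = L.ω₁ / 2 := rfl
lemma halfPeriod_two : L.halfPeriod 2 = (L.ω₁ + L.ω₂) / 2 := rfl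
lemma halfPeriod_three : L.halfPeriod 3 = L.ω₂ / 2 := rfl

/-- The half periods with their coordinates in `½ℤ`. -/
lemma halfPeriod_eq (k : Fin 4) : L.halfPeriod k =
    (((![0, 1, 1, 0] : Fin 4 → ℤ) k : ℂ) * L.ω₁ + ((![0, 0, 1, 1] : Fin 4 → ℤ) k : ℂ) * L.ω₂) / 2 := by
  fin_cases k <;> simp [halfPeriod]

lemma two_mul_halfPeriod_mem (k : Fin 4) : 2 * L.halfPeriod k ∈ L.lattice := by
  rw [halfPeriod_eq]
  exact mem_lattice.mpr ⟨_, _, (mul_div_cancel₀ _ two_ne_zero).symm⟩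

lemma halfPeriod_add_mem_iff (j k : Fin 4) : L.halfPeriod j + L.halfPeriod k ∈ L.lattice ↔ j = k := by
  rw [halfPeriod_eq, halfPeriod_eq, ← add_div, add_add_add_comm, ← add_mul, ← add_mul,
    ← Int.cast_add, ← Int.cast_add, half_mem_lattice_iff]
  revert j k
  decide

lemma halfPeriod_sub_mem_iff (j k : Fin 4) : L.halfPeriod j - L.halfPeriod k ∈ L.lattice ↔ j = k := by
  rw [← halfPeriod_add_mem_iff, show L.halfPeriod j + L.halfPeriod k =
    L.halfPeriod j - L.halfPeriod k + 2 * L.halfPeriod k by ring,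
    Submodule.add_mem_iff_left _ (L.two_mul_halfPeriod_mem k)]

lemma halfPeriod_notMem {k : Fin 4} (hk : k ≠ 0) : L.halfPeriod k ∉ L.lattice := by
  have := L.halfPeriod_add_mem_iff k 0
  rw [halfPeriod_zero, add_zero] at this
  rwa [this]

lemma exists_sub_halfPeriod_mem {h : ℂ} (h2 : 2 * h ∈ L.lattice) :
    ∃ k, h - L.halfPeriod k ∈ L.lattice := by
  obtain ⟨m, n, e⟩ := mem_lattice.mp h2
  have hh : ∀ k, h - L.halfPeriod k = (((m - (![0, 1, 1, 0] : Fin 4 → ℤ) k : ℤ) : ℂ) * L.ω₁ +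
      ((n - (![0, 0, 1, 1] : Fin 4 → ℤ) k : ℤ) : ℂ) * L.ω₂) / 2 := by
    intro k
    rw [halfPeriod_eq]
    push_cast
    linear_combination -e / 2
  simp_rw [hh, half_mem_lattice_iff]
  rcases Int.even_or_odd m with hm | hm <;> rcases Int.even_or_odd n with hn | hn
  · exact ⟨0, by simpa using ⟨hm, hn⟩⟩
  · exact ⟨3, by simpa [Int.even_sub_one] using ⟨hm, hn⟩⟩
  · exact ⟨1, by simpa [Int.even_sub_one] using ⟨hm, hn⟩⟩
  · exact ⟨2, by simpa [Int.even_sub_one] using ⟨hm, hn⟩⟩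

lemma e_injOn {j k : Fin 4} (hj : j ≠ 0) (hk : k ≠ 0) (h : L.e j = L.e k) : j = k := by
  rcases (L.weierstrassP_eq_iff (L.halfPeriod_notMem hj) (L.halfPeriod_notMem hk)).mp h with h | h
  · exact (L.halfPeriod_add_mem_iff j k).mp h
  · exact (L.halfPeriod_sub_mem_iff j k).mp h

lemma e_sub_e_ne_zero {j k : Fin 4} (hj : j ≠ 0) (hk : k ≠ 0) (h : j ≠ k) : L.e j - L.e k ≠ 0 :=
  sub_ne_zero.mpr fun h' ↦ h (L.e_injOn hj hk h')

lemma e_cubic {j : Fin 4} (hj : j ≠ 0) : 4 * L.e j ^ 3 - L.g₂ * L.e j - L.g₃ = 0 := by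
  have h := L.derivWeierstrassP_sq _ (L.halfPeriod_notMem hj)
  rw [(L.derivWeierstrassP_eq_zero_iff (L.halfPeriod_notMem hj)).mpr (L.two_mul_halfPeriod_mem j)]
    at h
  rw [e, ← h]
  simp

/-- The elementary symmetric functions of `e₁, e₂, e₃`. -/
lemma e_symm : L.e 1 + L.e 2 + L.e 3 = 0 ∧
    L.g₂ = -4 * (L.e 1 * L.e 2 + L.e 2 * L.e 3 + L.e 3 * L.e 1) ∧
    L.g₃ = 4 * L.e 1 * L.e 2 * L.e 3 := by
  have h1 := L.e_cubic (j := 1) (by decide)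
  have h2 := L.e_cubic (j := 2) (by decide)
  have h3 := L.e_cubic (j := 3) (by decide)
  have d12 := L.e_sub_e_ne_zero (j := 1) (k := 2) (by decide) (by decide) (by decide)
  have d13 := L.e_sub_e_ne_zero (j := 1) (k := 3) (by decide) (by decide) (by decide)
  have d23 := L.e_sub_e_ne_zero (j := 2) (k := 3) (by decide) (by decide) (by decide)
  generalize L.e 1 = a at *
  generalize L.e 2 = b at *
  generalize L.e 3 = c at *
  have q1 : 4 * (a ^ 2 + a * b + b ^ 2) = L.g₂ := by
    apply mul_left_cancel₀ d12; linear_combination h1 - h2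
  have q2 : 4 * (a ^ 2 + a * c + c ^ 2) = L.g₂ := by
    apply mul_left_cancel₀ d13; linear_combination h1 - h3
  have s : a + b + c = 0 := by
    apply mul_left_cancel₀ d23; linear_combination (q1 - q2) / 4
  have hc : c = -a - b := by linear_combination s
  subst hc
  refine ⟨s, ?_, ?_⟩
  · linear_combination -q1
  · linear_combination -h1 + a * q1

lemma cubic_eq (t : ℂ) : 4 * t ^ 3 - L.g₂ * t - L.g₃ =
    4 * (t - L.e 1) * (t - L.e 2) * (t - L.e 3) := by
  obtain ⟨h1, h2, h3⟩ := L.e_symm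
  rw [h2, h3]
  linear_combination 4 * t ^ 2 * h1

lemma discriminant_eq : L.g₂ ^ 3 - 27 * L.g₃ ^ 2 =
    16 * ((L.e 1 - L.e 2) * (L.e 2 - L.e 3) * (L.e 3 - L.e 1)) ^ 2 := by
  obtain ⟨h1, h2, h3⟩ := L.e_symm
  have hc : L.e 3 = -L.e 1 - L.e 2 := by linear_combination h1
  rw [h2, h3, hc]
  ring

/-! ### The functions `σ_j / σ` -/

/-- The function `exp (-ζ(h) z) σ(z + h) / (σ(h) σ(z))`; for a half period `h` this is a square
root of `℘(z) - ℘(h)`. -/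
def coRatio (h z : ℂ) : ℂ :=
  Complex.exp (-(L.weierstrassZeta h) * z) * L.weierstrassSigma (z + h) / L.weierstrassSigma h /
    L.weierstrassSigma z

section coRatio

variable {L} {h : ℂ} (hh : h ∉ L.lattice) (h2 : 2 * h ∈ L.lattice)
include hh h2

lemma weierstrassSigma_sub_half (z : ℂ) : L.weierstrassSigma (z - h) =
    -Complex.exp (-(2 * L.weierstrassZeta h * z)) * L.weierstrassSigma (z + h) := by
  have h1 := L.weierstrassSigma_add_two_mul hh h2 (z - h)
  rw [show z - h + 2 * h = z + h by ring, sub_add_cancel] at h1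
  rw [h1, Complex.exp_neg]
  field_simp [Complex.exp_ne_zero]

lemma coRatio_sq {z : ℂ} (hz : z ∉ L.lattice) : L.coRatio h z ^ 2 = ℘[L] z - ℘[L] h := by
  have h1 := L.weierstrassP_sub_mul_sigma_sq hz hh
  rw [weierstrassSigma_sub_half hh h2] at h1
  have hs := L.weierstrassSigma_ne_zero hz
  have hs' := L.weierstrassSigma_ne_zero hh
  have he : Complex.exp (-(L.weierstrassZeta h) * z) ^ 2 =
      Complex.exp (-(2 * L.weierstrassZeta h * z)) := by
    rw [sq, ← Complex.exp_add]
    congr 1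
    ring
  rw [coRatio, div_div, div_pow, mul_pow, he, div_eq_iff (pow_ne_zero 2 (mul_ne_zero hs' hs))]
  linear_combination -h1

lemma coRatio_neg (z : ℂ) : L.coRatio h (-z) = -L.coRatio h z := by
  have h1 : L.weierstrassSigma (-z + h) =
      Complex.exp (-(2 * L.weierstrassZeta h * z)) * L.weierstrassSigma (z + h) := by
    rw [show -z + h = -(z - h) by ring, weierstrassSigma_neg, weierstrassSigma_sub_half hh h2]
    ring
  have he : Complex.exp (-(L.weierstrassZeta h) * -z) *
      Complex.exp (-(2 * L.weierstrassZeta h * z)) = Complex.exp (-(L.weierstrassZeta h) * z) := by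
    rw [← Complex.exp_add]
    congr 1
    ring
  rw [coRatio, coRatio, weierstrassSigma_neg, h1, ← mul_assoc, he, div_neg]

omit hh h2 in
lemma coRatio_ne_zero {z : ℂ} (hh : h ∉ L.lattice) (hz : z ∉ L.lattice) (hzh : z + h ∉ L.lattice) :
    L.coRatio h z ≠ 0 :=
  div_ne_zero (div_ne_zero (mul_ne_zero (Complex.exp_ne_zero _) (L.weierstrassSigma_ne_zero hzh))
    (L.weierstrassSigma_ne_zero hh)) (L.weierstrassSigma_ne_zero hz)

omit h2 in
/-- Under a period `2k`, the function `σ_h / σ` is multiplied by a constant. -/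
lemma coRatio_add_two_mul {k : ℂ} (hk : k ∉ L.lattice) (hk2 : 2 * k ∈ L.lattice) (z : ℂ) :
    L.coRatio h (z + 2 * k) =
      Complex.exp (2 * (L.weierstrassZeta k * h - L.weierstrassZeta h * k)) * L.coRatio h z := by
  have hs' := L.weierstrassSigma_ne_zero hh
  rw [coRatio, coRatio, show z + 2 * k + h = z + h + 2 * k by ring,
    L.weierstrassSigma_add_two_mul hk hk2, L.weierstrassSigma_add_two_mul hk hk2]
  by_cases hz : z ∈ L.lattice
  · simp [L.weierstrassSigma_of_mem hz]
  have hs := L.weierstrassSigma_ne_zero hz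
  have he := Complex.exp_ne_zero (2 * L.weierstrassZeta k * (z + k))
  have e : Complex.exp (-L.weierstrassZeta h * (z + 2 * k)) *
      Complex.exp (2 * L.weierstrassZeta k * (z + h + k)) =
      Complex.exp (2 * (L.weierstrassZeta k * h - L.weierstrassZeta h * k)) *
        Complex.exp (-L.weierstrassZeta h * z) * Complex.exp (2 * L.weierstrassZeta k * (z + k)) := by
    rw [← Complex.exp_add, ← Complex.exp_add, ← Complex.exp_add]
    congr 1
    ring
  rw [div_div, div_div, mul_div_assoc', div_eq_div_iff
    (mul_ne_zero hs' (mul_ne_zero (neg_ne_zero.mpr he) hs)) (mul_ne_zero hs' hs)]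
  linear_combination (-L.weierstrassSigma (z + h) * L.weierstrassSigma h * L.weierstrassSigma z) * e

lemma coRatio_add_two_mul_self (z : ℂ) : L.coRatio h (z + 2 * h) = L.coRatio h z := by
  rw [coRatio_add_two_mul hh hh h2]
  simp

/-- For different half periods `h, k`, the function `σ_h / σ` changes sign under `2k`: compare the
values at `k` and `-k`. -/
lemma coRatio_add_two_mul_of_add_notMem {k : ℂ} (hk : k ∉ L.lattice) (hk2 : 2 * k ∈ L.lattice)
    (hkh : k + h ∉ L.lattice) (z : ℂ) : L.coRatio h (z + 2 * k) = -L.coRatio h z := by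
  rw [coRatio_add_two_mul hh hk hk2]
  have h1 := coRatio_add_two_mul hh hk hk2 (-k)
  rw [show -k + 2 * k = k by ring, coRatio_neg hh h2] at h1
  have h3 := coRatio_ne_zero hh hk hkh
  have h4 : Complex.exp (2 * (L.weierstrassZeta k * h - L.weierstrassZeta h * k)) = -1 := by
    apply mul_right_cancel₀ h3
    linear_combination h1
  rw [h4]
  ring

omit h2 in
lemma continuousAt_coRatio {z : ℂ} (hz : z ∉ L.lattice) : ContinuousAt (L.coRatio h) z := by
  have hs := L.weierstrassSigma_ne_zero hz
  have hc := L.differentiable_weierstrassSigma.continuous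
  unfold coRatio
  refine ContinuousAt.div (ContinuousAt.div ?_ continuousAt_const (L.weierstrassSigma_ne_zero hh))
    hc.continuousAt hs
  exact (by fun_prop : Continuous fun z ↦ Complex.exp (-L.weierstrassZeta h * z) *
    L.weierstrassSigma (z + h)).continuousAt

omit h2 in
lemma tendsto_mul_coRatio : Tendsto (fun z ↦ z * L.coRatio h z) (𝓝[≠] 0) (𝓝 1) := by
  have hs' := L.weierstrassSigma_ne_zero hh
  have hq0 : L.sigmaQuot 0 ≠ 0 := by rw [sigmaQuot_zero]; exact one_ne_zero
  have h1 : Tendsto (fun z ↦ Complex.exp (-(L.weierstrassZeta h) * z) *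
      L.weierstrassSigma (z + h) / L.weierstrassSigma h / L.sigmaQuot z) (𝓝 0) (𝓝 1) := by
    have hc := L.differentiable_weierstrassSigma.continuous
    have : ContinuousAt (fun z ↦ Complex.exp (-(L.weierstrassZeta h) * z) *
        L.weierstrassSigma (z + h) / L.weierstrassSigma h / L.sigmaQuot z) 0 := by
      refine ContinuousAt.div (ContinuousAt.div ?_ continuousAt_const hs')
        (L.differentiable_sigmaQuot 0).continuousAt hq0
      exact (by fun_prop : Continuous fun z ↦ Complex.exp (-L.weierstrassZeta h * z) *
        L.weierstrassSigma (z + h)).continuousAt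
    have h3 := this.tendsto
    simpa [sigmaQuot_zero, hs'] using h3
  refine (h1.mono_left nhdsWithin_le_nhds).congr' ?_
  filter_upwards [self_mem_nhdsWithin, mem_nhdsWithin_of_mem_nhds
      (L.compl_lattice_sdiff_singleton_mem_nhds 0)] with z hz hz'
  have hz0 : z ≠ 0 := hz
  have hq := L.sigmaQuot_ne_zero hz'
  rw [coRatio, L.weierstrassSigma_eq z]
  field_simp

end coRatio

lemma eventually_notMem_nhdsNE : ∀ᶠ z in 𝓝[≠] (0 : ℂ), z ∉ L.lattice := by
  filter_upwards [self_mem_nhdsWithin, mem_nhdsWithin_of_mem_nhds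
    (L.compl_lattice_sdiff_singleton_mem_nhds 0)] with z hz hz' h
  exact hz' ⟨h, hz⟩

lemma tendsto_mul_nhdsNE_zero {c : ℂ} (hc : c ≠ 0) :
    Tendsto (fun z : ℂ ↦ c * z) (𝓝[≠] 0) (𝓝[≠] 0) := by
  refine tendsto_nhdsWithin_of_tendsto_nhds_of_eventually_within _ ?_ ?_
  · have := (continuous_const_mul c).tendsto 0
    rw [mul_zero] at this
    exact this.mono_left nhdsWithin_le_nhds
  · filter_upwards [self_mem_nhdsWithin] with z hz
    exact mul_ne_zero hc hz

/-- Two continuous functions without zeros on the complement of a countable set, whose squares agree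
and which have the same leading term at the origin, are equal: the complement is connected. -/
lemma eqOn_of_sq_eq {f g : ℂ → ℂ} {S : Set ℂ} (hS : S.Countable) {n : ℕ} {a : ℂ} (ha : a ≠ 0)
    (hf : ContinuousOn f Sᶜ) (hg : ContinuousOn g Sᶜ) (hsq : ∀ z ∉ S, f z ^ 2 = g z ^ 2)
    (hg0 : ∀ z ∉ S, g z ≠ 0) (hS0 : ∀ᶠ z in 𝓝[≠] (0 : ℂ), z ∉ S)
    (hfl : Tendsto (fun z ↦ z ^ n * f z) (𝓝[≠] 0) (𝓝 a))
    (hgl : Tendsto (fun z ↦ z ^ n * g z) (𝓝[≠] 0) (𝓝 a)) : ∀ z ∉ S, f z = g z := by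
  have hpre : IsPreconnected Sᶜ := (hS.isConnected_compl_of_one_lt_rank (by simp)).isPreconnected
  rcases hpre.eq_or_eq_neg_of_sq_eq hf hg (fun z hz ↦ hsq z hz) (fun {z} hz ↦ hg0 z hz) with h | h
  · exact fun z hz ↦ h hz
  · exfalso
    have h1 : Tendsto (fun z ↦ z ^ n * f z) (𝓝[≠] 0) (𝓝 (-a)) := by
      refine hgl.neg.congr' ?_
      filter_upwards [hS0] with z hz
      rw [h hz, Pi.neg_apply]
      ring
    have h2 := tendsto_nhds_unique hfl h1
    exact ha (self_eq_neg.mp h2)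

lemma e_sq_mul {z : ℂ} (hz : z ∉ L.lattice) :
    ℘'[L] z ^ 2 = 4 * (℘[L] z - L.e 1) * (℘[L] z - L.e 2) * (℘[L] z - L.e 3) := by
  rw [L.derivWeierstrassP_sq z hz, L.cubic_eq]

lemma sigmaRatio_sq {j : Fin 4} (hj : j ≠ 0) {z : ℂ} (hz : z ∉ L.lattice) :
    L.sigmaRatio j z ^ 2 = ℘[L] z - L.e j :=
  coRatio_sq (L.halfPeriod_notMem hj) (L.two_mul_halfPeriod_mem j) hz

lemma sigmaRatio_neg {j : Fin 4} (hj : j ≠ 0) (z : ℂ) : L.sigmaRatio j (-z) = -L.sigmaRatio j z :=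
  coRatio_neg (L.halfPeriod_notMem hj) (L.two_mul_halfPeriod_mem j) z

lemma sigmaRatio_add_two_mul_halfPeriod {j : Fin 4} (hj : j ≠ 0) (k : Fin 4) (z : ℂ) :
    L.sigmaRatio j (z + 2 * L.halfPeriod k) = shiftSign k j * L.sigmaRatio j z := by
  have hh := L.halfPeriod_notMem hj
  have h2 := L.two_mul_halfPeriod_mem j
  unfold shiftSign
  by_cases hk : k = 0
  · simp [hk]
  by_cases hkj : k = j
  · rw [if_pos (Or.inr hkj), hkj, one_mul]
    exact coRatio_add_two_mul_self hh h2 z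
  · rw [if_neg (by tauto), neg_one_mul]
    refine coRatio_add_two_mul_of_add_notMem hh h2 (L.halfPeriod_notMem hk)
      (L.two_mul_halfPeriod_mem k) ?_ z
    rwa [halfPeriod_add_mem_iff]

/-- `(σ₁ σ₂ σ₃ / σ³)(z) = -℘'(z) / 2`; the sign is found at the origin. -/
lemma sigmaRatio_mul {z : ℂ} (hz : z ∉ L.lattice) :
    L.sigmaRatio 1 z * L.sigmaRatio 2 z * L.sigmaRatio 3 z = -℘'[L] z / 2 := by
  have hsq : ∀ z ∉ L.lattice, (L.sigmaRatio 1 z * L.sigmaRatio 2 z * L.sigmaRatio 3 z) ^ 2 =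
      (-℘'[L] z / 2) ^ 2 := by
    intro z hz
    rw [mul_pow, mul_pow, L.sigmaRatio_sq (by decide) hz, L.sigmaRatio_sq (by decide) hz,
      L.sigmaRatio_sq (by decide) hz, div_pow, neg_sq, L.e_sq_mul hz]
    ring
  have hmem {z : ℂ} (hz : 2 * z ∉ L.lattice) : z ∉ L.lattice :=
    fun h ↦ hz (by rw [two_mul]; exact add_mem h h)
  by_cases h2 : 2 * z ∈ L.lattice
  · have h1 := hsq z hz
    rw [(L.derivWeierstrassP_eq_zero_iff hz).mpr h2] at h1 ⊢
    simpa using h1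
  refine eqOn_of_sq_eq L.countable_two_mul (n := 3) (a := 1) one_ne_zero
    (g := fun z ↦ -℘'[L] z / 2) ?_ ?_ (fun z hz ↦ hsq z (hmem hz)) ?_ ?_ ?_ ?_ z h2
  · intro z hz
    have hc (j : Fin 4) (hj : j ≠ 0) : ContinuousAt (L.sigmaRatio j) z :=
      continuousAt_coRatio (L.halfPeriod_notMem hj) (hmem hz)
    exact (((hc 1 (by decide)).mul (hc 2 (by decide))).mul (hc 3 (by decide))).continuousWithinAt
  · intro z hz
    exact ((L.analyticAt_derivWeierstrassP (hmem hz)).continuousAt.neg.div_const 2).continuousWithinAt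
  · intro z hz
    have : ℘'[L] z ≠ 0 := mt (L.derivWeierstrassP_eq_zero_iff (hmem hz)).mp hz
    simpa using this
  · exact (tendsto_mul_nhdsNE_zero two_ne_zero).eventually L.eventually_notMem_nhdsNE
  · have hl (j : Fin 4) (hj : j ≠ 0) : Tendsto (fun z ↦ z * L.sigmaRatio j z) (𝓝[≠] 0) (𝓝 1) :=
      tendsto_mul_coRatio (L.halfPeriod_notMem hj)
    have := ((hl 1 (by decide)).mul (hl 2 (by decide))).mul (hl 3 (by decide))
    rw [one_mul, one_mul] at this
    exact this.congr fun z ↦ by ring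
  · have := (L.tendsto_cube_mul_derivWeierstrassP.div_const 2).neg
    rw [show -(-2 / 2 : ℂ) = 1 by norm_num] at this
    exact this.congr fun z ↦ by ring

/-- The duplication formula for `℘`. -/
lemma weierstrassP_two_mul {v : ℂ} (hv : 2 * v ∉ L.lattice) :
    ℘[L] (2 * v) = -2 * ℘[L] v + (deriv ℘'[L] v / ℘'[L] v) ^ 2 / 4 := by
  have hmem {z : ℂ} (hz : 2 * z ∉ L.lattice) : z ∉ L.lattice :=
    fun h ↦ hz (by rw [two_mul]; exact add_mem h h)
  have hv1 := hmem hv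
  have hp : ℘'[L] v ≠ 0 := mt (L.derivWeierstrassP_eq_zero_iff hv1).mp hv
  have hopen : ∀ᶠ y in 𝓝 v, 2 * y ∉ L.lattice :=
    (continuous_const_mul (2 : ℂ)).continuousAt.eventually (L.isOpen_compl_lattice.mem_nhds hv)
  have hev : (fun v ↦ L.weierstrassZeta (2 * v)) =ᶠ[𝓝 v] fun v ↦ 2 * L.weierstrassZeta v +
      1 / 2 * ((6 * ℘[L] v ^ 2 - L.g₂ / 2) / ℘'[L] v) := by
    filter_upwards [hopen] with y hy
    rw [L.zeta_two_mul hy, L.deriv_derivWeierstrassP (hmem hy)]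
  have d1 : HasDerivAt (fun v ↦ L.weierstrassZeta (2 * v)) (-℘[L] (2 * v) * (2 * 1)) v :=
    (L.hasDerivAt_weierstrassZeta hv).comp v ((hasDerivAt_id v).const_mul 2)
  have dP := L.hasDerivAt_weierstrassP hv1
  have d2 := ((L.hasDerivAt_weierstrassZeta hv1).const_mul 2).add
    (((((dP.pow 2).const_mul 6).sub_const (L.g₂ / 2)).div
      (L.hasDerivAt_derivWeierstrassP hv1) hp).const_mul (1 / 2))
  have h3 := (d1.congr_of_eventuallyEq hev.symm).unique d2
  simp only [Nat.cast_ofNat, Nat.add_one_sub_one, pow_one, Pi.pow_apply] at h3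
  rw [← L.deriv_derivWeierstrassP hv1] at h3
  field_simp at h3 ⊢
  linear_combination -h3

/-- The duplication formula for `σ_j / σ`, where `j, k, l` are `1, 2, 3` in some order: the squares
of the two sides agree by the duplication formula for `℘`, and the sign is found at the origin. -/
lemma sigmaRatio_two_mul {j k l : Fin 4} (hj : j ≠ 0)
    (hcub : ∀ z ∉ L.lattice, ℘'[L] z ^ 2 =
      4 * (℘[L] z - L.e j) * (℘[L] z - L.e k) * (℘[L] z - L.e l))
    (hsum : L.e j + L.e k + L.e l = 0)
    (hg₂ : L.g₂ = -4 * (L.e j * L.e k + L.e k * L.e l + L.e l * L.e j))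
    {v : ℂ} (hv : 2 * v ∉ L.lattice) :
    L.sigmaRatio j (2 * v) * -℘'[L] v =
      (℘[L] v - L.e j) ^ 2 - (L.e j - L.e k) * (L.e j - L.e l) := by
  have hmem {z : ℂ} (hz : 2 * z ∉ L.lattice) : z ∉ L.lattice :=
    fun h ↦ hz (by rw [two_mul]; exact add_mem h h)
  have hel : L.e l = -L.e j - L.e k := by linear_combination hsum
  have hsq : ∀ v, 2 * v ∉ L.lattice → (L.sigmaRatio j (2 * v) * -℘'[L] v) ^ 2 =
      ((℘[L] v - L.e j) ^ 2 - (L.e j - L.e k) * (L.e j - L.e l)) ^ 2 := by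
    intro v hv
    have hv1 := hmem hv
    have hp : ℘'[L] v ≠ 0 := mt (L.derivWeierstrassP_eq_zero_iff hv1).mp hv
    rw [mul_pow, neg_sq, L.sigmaRatio_sq hj hv, L.weierstrassP_two_mul hv]
    have h1 := hcub v hv1
    have h2 := L.deriv_derivWeierstrassP hv1
    have h3 : (-2 * ℘[L] v + (deriv ℘'[L] v / ℘'[L] v) ^ 2 / 4 - L.e j) * ℘'[L] v ^ 2 =
        (-2 * ℘[L] v - L.e j) * ℘'[L] v ^ 2 + deriv ℘'[L] v ^ 2 / 4 := by
      field_simp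
      ring
    rw [h3, h1, h2, hg₂, hel]
    ring
  have hS : {z : ℂ | 4 * z ∈ L.lattice}.Countable :=
    L.countable_lattice.preimage (mul_right_injective₀ (by norm_num))
  have h42 {z : ℂ} (hz : 4 * z ∉ L.lattice) : 2 * z ∉ L.lattice := fun h ↦ hz (by
    rw [show 4 * z = 2 * z + 2 * z by ring]; exact add_mem h h)
  have hne {z : ℂ} (hz : 4 * z ∉ L.lattice) : L.sigmaRatio j (2 * z) * -℘'[L] z ≠ 0 := by
    have hz2 := h42 hz
    refine mul_ne_zero (coRatio_ne_zero (L.halfPeriod_notMem hj) hz2 fun h ↦ hz ?_)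
      (neg_ne_zero.mpr (mt (L.derivWeierstrassP_eq_zero_iff (hmem hz2)).mp hz2))
    have h4 := sub_mem (add_mem h h) (L.two_mul_halfPeriod_mem j)
    rwa [show 2 * z + L.halfPeriod j + (2 * z + L.halfPeriod j) - 2 * L.halfPeriod j = 4 * z by
      ring] at h4
  have hcs {z : ℂ} (hz : 2 * z ∉ L.lattice) :
      ContinuousAt (fun v ↦ L.sigmaRatio j (2 * v) * -℘'[L] v) z := by
    refine ContinuousAt.mul ?_ (L.analyticAt_derivWeierstrassP (hmem hz)).continuousAt.neg
    exact ContinuousAt.comp (f := fun z : ℂ ↦ 2 * z) (g := L.sigmaRatio j)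
      (continuousAt_coRatio (L.halfPeriod_notMem hj) hz) (by fun_prop)
  have hcp {z : ℂ} (hz : 2 * z ∉ L.lattice) : ContinuousAt (fun v ↦ (℘[L] v - L.e j) ^ 2 -
      (L.e j - L.e k) * (L.e j - L.e l)) z :=
    (((L.analyticAt_weierstrassP (hmem hz)).continuousAt.sub continuousAt_const).pow 2).sub
      continuousAt_const
  have hid : Tendsto (fun z : ℂ ↦ z ^ 4) (𝓝[≠] 0) (𝓝 0) := by
    have := (continuous_pow (M := ℂ) 4).tendsto 0
    rw [zero_pow (by norm_num)] at this
    exact this.mono_left nhdsWithin_le_nhds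
  have hid2 : Tendsto (fun z : ℂ ↦ z ^ 2) (𝓝[≠] 0) (𝓝 0) := by
    have := (continuous_pow (M := ℂ) 2).tendsto 0
    rw [zero_pow (by norm_num)] at this
    exact this.mono_left nhdsWithin_le_nhds
  have hmain := eqOn_of_sq_eq hS (n := 4) (a := 1) one_ne_zero
    (f := fun v ↦ (℘[L] v - L.e j) ^ 2 - (L.e j - L.e k) * (L.e j - L.e l))
    (g := fun v ↦ L.sigmaRatio j (2 * v) * -℘'[L] v)
    (fun z hz ↦ (hcp (h42 hz)).continuousWithinAt) (fun z hz ↦ (hcs (h42 hz)).continuousWithinAt)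
    (fun z hz ↦ (hsq z (h42 hz)).symm) (fun z hz ↦ hne hz)
    ((tendsto_mul_nhdsNE_zero (by norm_num)).eventually L.eventually_notMem_nhdsNE) (by
      have h1 := ((L.tendsto_sq_mul_weierstrassP.sub (hid2.mul_const (L.e j))).pow 2).sub
        (hid.mul_const ((L.e j - L.e k) * (L.e j - L.e l)))
      simp only [zero_mul, sub_zero, one_pow] at h1
      exact h1.congr fun z ↦ by ring) (by
      have h1 : Tendsto (fun z ↦ 2 * z * L.sigmaRatio j (2 * z)) (𝓝[≠] 0) (𝓝 1) :=
        (tendsto_mul_coRatio (L.halfPeriod_notMem hj)).comp (tendsto_mul_nhdsNE_zero two_ne_zero)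
      have h2 := (h1.mul L.tendsto_cube_mul_derivWeierstrassP).div_const (-2)
      rw [show (1 * -2 / -2 : ℂ) = 1 by norm_num] at h2
      exact h2.congr fun z ↦ by ring)
  -- At the points with `4v ∈ L` both sides are limits of the values nearby.
  exact (ContinuousAt.eq_of_eventually_eq_compl_countable hS (hcp hv) (hcs hv)
    (.of_forall fun y hy ↦ hmain y hy)).symm

end PeriodPair

namespace QuarticForm

open scoped PeriodPair

/-! ### The function `φ₀` and its differential equation -/

lemma eval_poly {K : Type} [Field K] (Q : QuarticForm K) (x : K) : Q.poly.eval x =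
    Q.A * x ^ 4 + 4 * Q.B * x ^ 3 + 6 * Q.C * x ^ 2 + 4 * Q.B' * x + Q.A' := by
  simp [poly]

section

variable {Q : QuarticForm ℂ} {s : ℂ} {L : PeriodPair} {w : ℂ}

lemma phi0_reflect (u : ℂ) : Q.phi0 s L w (-u + w) = Q.phi0 s L w u := by
  rw [phi0, phi0, show -u + w - w = -u by ring, show -u + w = -(u - w) by ring,
    PeriodPair.weierstrassZeta_neg, PeriodPair.weierstrassZeta_neg]
  ring

lemma phi_neg (u : ℂ) : Q.phi s L w (-u) = Q.phi s L w u := by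
  rw [phi, phi, ← phi0_reflect]
  congr 1
  ring

lemma phi0_add_mem {l u : ℂ} (hl : l ∈ L.lattice) (hu : u ∉ L.lattice) (huw : u - w ∉ L.lattice) :
    Q.phi0 s L w (u + l) = Q.phi0 s L w u := by
  obtain ⟨η, hη⟩ := L.exists_weierstrassZeta_add hl
  rw [phi0, phi0, show u + l - w = u - w + l by ring, hη _ hu, hη _ huw]
  ring

lemma phi_add_mem {l u : ℂ} (hl : l ∈ L.lattice) (h1 : u - w / 2 ∉ L.lattice)
    (h2 : u + w / 2 ∉ L.lattice) : Q.phi s L w (u + l) = Q.phi s L w u := by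
  rw [phi, phi, add_right_comm]
  exact phi0_add_mem hl h2 (by rwa [add_sub_assoc, show w / 2 - w = -(w / 2) by ring, ← sub_eq_add_neg])

lemma phi0_eq_phi (u : ℂ) : Q.phi0 s L w u = Q.phi s L w (u - w / 2) := by
  rw [phi, sub_add_cancel]

lemma hasDerivAt_phi0 {u : ℂ} (hu : u ∉ L.lattice) (huw : u - w ∉ L.lattice) :
    HasDerivAt (Q.phi0 s L w) (1 / s * (℘[L] u - ℘[L] (u - w))) u := by
  have h1 := (L.hasDerivAt_weierstrassZeta huw).comp_sub_const u w
  have h2 := L.hasDerivAt_weierstrassZeta hu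
  refine ((((h1.sub h2).add_const (L.weierstrassZeta w)).const_mul (1 / s)).const_add
    (-Q.B / Q.A)).congr_deriv ?_
  ring

lemma differentiableOn_phi0 : DifferentiableOn ℂ (Q.phi0 s L w)
    {u | u ∉ L.lattice ∧ u - w ∉ L.lattice} :=
  fun _ hu ↦ (hasDerivAt_phi0 hu.1 hu.2).differentiableAt.differentiableWithinAt

lemma isOpen_compl_poles : IsOpen {u : ℂ | u ∉ L.lattice ∧ u - w ∉ L.lattice} :=
  L.isOpen_compl_lattice.inter (L.isOpen_compl_lattice.preimage (by fun_prop :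
    Continuous fun u : ℂ ↦ u - w))

lemma analyticAt_phi0 {u : ℂ} (hu : u ∉ L.lattice) (huw : u - w ∉ L.lattice) :
    AnalyticAt ℂ (Q.phi0 s L w) u :=
  differentiableOn_phi0.analyticAt (isOpen_compl_poles.mem_nhds ⟨hu, huw⟩)

lemma meromorphicAt_phi0_sub (u₀ u : ℂ) :
    MeromorphicAt (fun u ↦ Q.phi0 s L w (u - u₀)) u := by
  have hσ : AnalyticOnNhd ℂ L.weierstrassSigma Set.univ :=
    L.differentiable_weierstrassSigma.differentiableOn.analyticOnNhd isOpen_univ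
  have hz (c : ℂ) : MeromorphicAt (fun u ↦ L.weierstrassZeta (u - c)) u := by
    have h1 : AnalyticAt ℂ (fun u ↦ L.weierstrassSigma (u - c)) u :=
      (hσ (u - c) trivial).comp (f := fun u ↦ u - c) (by fun_prop)
    have h2 : AnalyticAt ℂ (fun u ↦ deriv L.weierstrassSigma (u - c)) u :=
      (hσ (u - c) trivial).deriv.comp (f := fun u ↦ u - c) (by fun_prop)
    exact h2.meromorphicAt.div h1.meromorphicAt
  have e : (fun u ↦ Q.phi0 s L w (u - u₀)) = fun u ↦ -Q.B / Q.A + 1 / s *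
      (L.weierstrassZeta (u - (u₀ + w)) - L.weierstrassZeta (u - u₀) + L.weierstrassZeta w) := by
    ext u
    rw [phi0, sub_sub]
  rw [e]
  exact (MeromorphicAt.const _ _).add ((MeromorphicAt.const _ _).mul
    (((hz _).sub (hz _)).add (MeromorphicAt.const _ _)))

lemma tendsto_mul_weierstrassZeta :
    Tendsto (fun z ↦ z * L.weierstrassZeta z) (𝓝[≠] 0) (𝓝 1) := by
  have hc := (L.hasDerivAt_logDeriv_sigmaQuot (z := 0) (by simp)).continuousAt
  have h1 : Tendsto (fun z ↦ 1 + z * logDeriv L.sigmaQuot z) (𝓝 0)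
      (𝓝 (1 + 0 * logDeriv L.sigmaQuot 0)) :=
    (continuousAt_const.add (continuousAt_id.mul hc))
  rw [zero_mul, add_zero] at h1
  refine (h1.mono_left nhdsWithin_le_nhds).congr' ?_
  filter_upwards [self_mem_nhdsWithin, L.eventually_notMem_nhdsNE] with z hz hz'
  have : z ≠ 0 := hz
  rw [L.weierstrassZeta_eq_inv_add hz']
  field_simp

lemma tendsto_mul_phi0 (hw : w ∉ L.lattice) :
    Tendsto (fun u ↦ u * Q.phi0 s L w u) (𝓝[≠] 0) (𝓝 (-(1 / s))) := by
  have hc : ContinuousAt (fun u ↦ L.weierstrassZeta (u - w)) 0 :=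
    ((L.hasDerivAt_weierstrassZeta (z := 0 - w)
      (by simpa using L.neg_notMem hw)).comp_sub_const 0 w).continuousAt
  have h1 : Tendsto (fun u ↦ u * (-Q.B / Q.A + 1 / s * (L.weierstrassZeta (u - w) +
      L.weierstrassZeta w))) (𝓝 0) (𝓝 (0 * (-Q.B / Q.A + 1 / s * (L.weierstrassZeta (0 - w) +
      L.weierstrassZeta w)))) :=
    continuousAt_id.mul (continuousAt_const.add (continuousAt_const.mul
      (hc.add continuousAt_const)))
  rw [zero_mul] at h1
  have h2 := (h1.mono_left (nhdsWithin_le_nhds (s := {0}ᶜ))).sub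
    ((tendsto_mul_weierstrassZeta (L := L)).const_mul (1 / s))
  rw [zero_sub, mul_one] at h2
  refine h2.congr fun u ↦ ?_
  rw [phi0]
  ring

lemma tendsto_phi0_cobounded (hs : s ≠ 0) (hw : w ∉ L.lattice) :
    Tendsto (Q.phi0 s L w) (𝓝[≠] 0) (Bornology.cobounded ℂ) := by
  rw [← tendsto_norm_atTop_iff_cobounded]
  have h1 := (tendsto_mul_phi0 (Q := Q) (s := s) hw).norm
  have h2 := tendsto_norm_atTop_iff_cobounded.mpr (tendsto_inv₀_nhdsNE_zero (α := ℂ))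
  have h3 : 0 < ‖-(1 / s)‖ := norm_pos_iff.mpr (by simpa using hs)
  refine (h1.pos_mul_atTop h3 h2).congr' ?_
  filter_upwards [self_mem_nhdsWithin] with z hz
  have : z ≠ 0 := hz
  rw [← norm_mul]
  congr 1
  field_simp

lemma tendsto_deriv_phi0_div_sq (hs : s ≠ 0) (hw : w ∉ L.lattice) :
    Tendsto (fun u ↦ deriv (Q.phi0 s L w) u / Q.phi0 s L w u ^ 2) (𝓝[≠] 0) (𝓝 s) := by
  have hw' : (0 : ℂ) - w ∉ L.lattice := by simpa using L.neg_notMem hw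
  have hc : ContinuousAt (fun u ↦ ℘[L] (u - w)) 0 :=
    ((L.hasDerivAt_weierstrassP hw').comp_sub_const 0 w).continuousAt
  have h1 : Tendsto (fun u ↦ u ^ 2 * ℘[L] (u - w)) (𝓝 0) (𝓝 (0 ^ 2 * ℘[L] (0 - w))) :=
    (continuousAt_id.pow 2).mul hc
  rw [zero_pow two_ne_zero, zero_mul] at h1
  have h2 := ((L.tendsto_sq_mul_weierstrassP.sub (h1.mono_left nhdsWithin_le_nhds)).const_mul
    (1 / s)).div ((tendsto_mul_phi0 (Q := Q) (s := s) hw).pow 2) (by simpa using hs)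
  rw [show 1 / s * (1 - 0) / (-(1 / s)) ^ 2 = s by field_simp; ring] at h2
  refine h2.congr' ?_
  have hoff : ∀ᶠ u in 𝓝[≠] (0 : ℂ), u - w ∉ L.lattice :=
    ((by fun_prop : ContinuousAt (fun u ↦ u - w) 0).tendsto.eventually
      (L.isOpen_compl_lattice.mem_nhds hw')).filter_mono nhdsWithin_le_nhds
  filter_upwards [self_mem_nhdsWithin, L.eventually_notMem_nhdsNE, hoff] with u hu0 hu huw
  have hu0' : u ≠ 0 := hu0
  rw [(hasDerivAt_phi0 hu huw).deriv, Pi.div_apply, ← mul_div_mul_left (1 / s * (℘[L] u - ℘[L] (u - w)))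
    (Q.phi0 s L w u ^ 2) (pow_ne_zero 2 hu0')]
  congr 1
  · ring
  · ring

/-- `φ(u, w)` through `℘`, from the addition and duplication formulas for `ζ`. -/
lemma phi_eq {u : ℂ} (hw : w ∉ L.lattice) (hu : u ∉ L.lattice) (h1 : u - w / 2 ∉ L.lattice)
    (h2 : u + w / 2 ∉ L.lattice) : ℘[L] u - ℘[L] (w / 2) ≠ 0 ∧
    Q.phi s L w u = -Q.B / Q.A + 1 / s * (℘'[L] (w / 2) / (℘[L] u - ℘[L] (w / 2)) +
      1 / 2 * (deriv ℘'[L] (w / 2) / ℘'[L] (w / 2))) := by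
  have h2w : 2 * (w / 2) = w := by ring
  have hv : w / 2 ∉ L.lattice := fun h ↦ hw (by rw [← h2w, two_mul]; exact add_mem h h)
  have hne : ℘[L] u ≠ ℘[L] (w / 2) := by
    rw [Ne, L.weierstrassP_eq_iff hu hv, not_or]
    exact ⟨h2, h1⟩
  have hne' : ℘[L] u - ℘[L] (w / 2) ≠ 0 := sub_ne_zero.mpr hne
  refine ⟨hne', ?_⟩
  have h3 := L.derivWeierstrassP_eq_mul_zeta hv hu hne.symm
  have h4 := L.zeta_two_mul (v := w / 2) (by rwa [h2w])
  rw [h2w] at h4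
  have h5 : L.weierstrassZeta (w / 2 - u) = -L.weierstrassZeta (u - w / 2) := by
    rw [← PeriodPair.weierstrassZeta_neg, neg_sub]
  rw [h5, add_comm (w / 2)] at h3
  rw [phi, phi0, h4, show u + w / 2 - w = u - w / 2 by ring]
  have h6 : ℘'[L] (w / 2) / (℘[L] u - ℘[L] (w / 2)) = L.weierstrassZeta (u - w / 2) -
      L.weierstrassZeta (u + w / 2) + 2 * L.weierstrassZeta (w / 2) := by
    rw [div_eq_iff hne', h3]
    ring
  rw [h6]
  ring

lemma half_notMem (hw : w ∉ L.lattice) : w / 2 ∉ L.lattice :=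
  fun h ↦ hw (by rw [← add_halves w]; exact add_mem h h)

/-- The value of `φ(·, w)` at the half period `ω_k`, from the duplication formula for `ζ`. -/
lemma root_eq (hw : w ∉ L.lattice) (k : Fin 4) : ℘'[L] (w / 2 + L.halfPeriod k) ≠ 0 ∧
    Q.root s L w k = -Q.B / Q.A + 1 / (2 * s) *
      (deriv ℘'[L] (w / 2 + L.halfPeriod k) / ℘'[L] (w / 2 + L.halfPeriod k)) := by
  have h2 := L.two_mul_halfPeriod_mem k
  have h2v : 2 * (w / 2 + L.halfPeriod k) = w + 2 * L.halfPeriod k := by ring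
  have hv2 : 2 * (w / 2 + L.halfPeriod k) ∉ L.lattice := by
    rw [h2v]; exact (L.add_mem_iff_notMem h2).mpr hw
  have hv : w / 2 + L.halfPeriod k ∉ L.lattice :=
    fun h ↦ hv2 (by rw [two_mul]; exact add_mem h h)
  refine ⟨mt (L.derivWeierstrassP_eq_zero_iff hv).mp hv2, ?_⟩
  have h4 := L.zeta_two_mul hv2
  rw [root, phi, phi0]
  have h5 : L.weierstrassZeta (L.halfPeriod k + w / 2 - w) =
      -L.weierstrassZeta (w / 2 - L.halfPeriod k) := by
    rw [← PeriodPair.weierstrassZeta_neg]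
    congr 1
    ring
  have h6 : L.weierstrassZeta (w / 2 - L.halfPeriod k) + L.weierstrassZeta (w + 2 * L.halfPeriod k) =
      L.weierstrassZeta (w / 2 + L.halfPeriod k) + L.weierstrassZeta w := by
    obtain ⟨η, hη⟩ := L.exists_weierstrassZeta_add h2
    have hm : w / 2 - L.halfPeriod k ∉ L.lattice := by
      rw [← L.add_mem_iff_notMem h2]
      convert hv using 2
      ring
    have h7 := hη _ hm
    rw [show w / 2 - L.halfPeriod k + 2 * L.halfPeriod k = w / 2 + L.halfPeriod k by ring] at h7
    rw [hη w hw, h7]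
    ring
  rw [h5, add_comm (L.halfPeriod k)]
  rw [h2v] at h4
  have h8 : deriv ℘'[L] (w / 2 + L.halfPeriod k) / ℘'[L] (w / 2 + L.halfPeriod k) =
      2 * (L.weierstrassZeta w - L.weierstrassZeta (w / 2 - L.halfPeriod k) -
        L.weierstrassZeta (w / 2 + L.halfPeriod k)) := by
    linear_combination -2 * h4 + 2 * h6
  rw [h8]
  ring

lemma root_zero (Q : QuarticForm ℂ) (s : ℂ) (L : PeriodPair) (w : ℂ) :
    Q.root s L w 0 = Q.phi s L w 0 := by
  rw [root, PeriodPair.halfPeriod_zero]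

/-- The values of `φ(·, w)` are taken only at points that are opposite or equal modulo the
lattice. -/
lemma add_mem_or_sub_mem_of_phi_eq (hs : s ≠ 0) (hw : w ∉ L.lattice) {a b : ℂ}
    (ha1 : a - w / 2 ∉ L.lattice) (ha2 : a + w / 2 ∉ L.lattice)
    (hb1 : b - w / 2 ∉ L.lattice) (hb2 : b + w / 2 ∉ L.lattice)
    (h : Q.phi s L w a = Q.phi s L w b) : a + b ∈ L.lattice ∨ a - b ∈ L.lattice := by
  have hp : ℘'[L] (w / 2) ≠ 0 := by simpa using (root_eq (Q := Q) (s := s) hw 0).1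
  have hv := half_notMem hw
  -- At a lattice point the value is the one at the origin, which is not taken elsewhere.
  have hz {a : ℂ} (ha : a ∈ L.lattice) : Q.phi s L w a = -Q.B / Q.A + 1 / s * (1 / 2 *
      (deriv ℘'[L] (w / 2) / ℘'[L] (w / 2))) := by
    have h1 := (root_eq (Q := Q) (s := s) hw 0).2
    rw [root_zero, PeriodPair.halfPeriod_zero, add_zero] at h1
    rw [← zero_add a, phi_add_mem ha (by simpa using L.neg_notMem hv) (by simpa using hv), h1]
    ring
  have key {a b : ℂ} (ha : a ∈ L.lattice) (hb : b ∉ L.lattice) (hb1 : b - w / 2 ∉ L.lattice)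
      (hb2 : b + w / 2 ∉ L.lattice) : Q.phi s L w a ≠ Q.phi s L w b := by
    intro h
    obtain ⟨h1, h2⟩ := phi_eq (Q := Q) (s := s) hw hb hb1 hb2
    rw [hz ha, h2] at h
    have h3 : 1 / s * (℘'[L] (w / 2) / (℘[L] b - ℘[L] (w / 2))) = 0 := by linear_combination -h
    simp [hs, hp, h1] at h3
  by_cases ha : a ∈ L.lattice
  · by_cases hb : b ∈ L.lattice
    · exact Or.inl (add_mem ha hb)
    · exact absurd h (key ha hb hb1 hb2)
  by_cases hb : b ∈ L.lattice
  · exact absurd h.symm (key hb ha ha1 ha2)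
  obtain ⟨h1, h2⟩ := phi_eq (Q := Q) (s := s) hw ha ha1 ha2
  obtain ⟨h3, h4⟩ := phi_eq (Q := Q) (s := s) hw hb hb1 hb2
  rw [← L.weierstrassP_eq_iff ha hb]
  rw [h2, h4] at h
  have h5 : ℘'[L] (w / 2) / (℘[L] a - ℘[L] (w / 2)) = ℘'[L] (w / 2) / (℘[L] b - ℘[L] (w / 2)) := by
    have h6 : 1 / s ≠ 0 := by simpa using hs
    apply mul_left_cancel₀ h6
    linear_combination h
  rw [div_eq_div_iff h1 h3] at h5
  have := mul_left_cancel₀ hp h5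
  linear_combination -this

lemma halfPeriod_half_notMem (hw : w ∉ L.lattice) (k : Fin 4) :
    L.halfPeriod k - w / 2 ∉ L.lattice ∧ L.halfPeriod k + w / 2 ∉ L.lattice := by
  have h2 := L.two_mul_halfPeriod_mem k
  constructor
  · intro h
    have h3 := sub_mem h2 (add_mem h h)
    rw [show 2 * L.halfPeriod k - (L.halfPeriod k - w / 2 + (L.halfPeriod k - w / 2)) = w by ring]
      at h3
    exact hw h3
  · intro h
    have h3 := sub_mem (add_mem h h) h2
    rw [show L.halfPeriod k + w / 2 + (L.halfPeriod k + w / 2) - 2 * L.halfPeriod k = w by ring]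
      at h3
    exact hw h3

/-- The half periods `ω_k` are neither equal nor opposite modulo the lattice, so the values of
`φ(·, w)` there are different. -/
lemma root_injective (hs : s ≠ 0) (hw : w ∉ L.lattice) : Function.Injective (Q.root s L w) := by
  intro j k h
  have hj := halfPeriod_half_notMem hw j
  have hk := halfPeriod_half_notMem hw k
  rcases add_mem_or_sub_mem_of_phi_eq hs hw hj.1 hj.2 hk.1 hk.2 h with h | h
  · exact (L.halfPeriod_add_mem_iff j k).mp h
  · exact (L.halfPeriod_sub_mem_iff j k).mp h

lemma add_sub_mem_or_sub_mem_of_phi0_eq (hs : s ≠ 0) (hw : w ∉ L.lattice) {a b : ℂ} (ha : a ∉ L.lattice)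
    (haw : a - w ∉ L.lattice) (hb : b ∉ L.lattice) (hbw : b - w ∉ L.lattice)
    (h : Q.phi0 s L w a = Q.phi0 s L w b) : a + b - w ∈ L.lattice ∨ a - b ∈ L.lattice := by
  rw [phi0_eq_phi, phi0_eq_phi] at h
  have e (x : ℂ) : x - w / 2 - w / 2 = x - w := by ring
  have e' (x : ℂ) : x - w / 2 + w / 2 = x := by ring
  rcases add_mem_or_sub_mem_of_phi_eq hs hw (by rwa [e]) (by rwa [e']) (by rwa [e]) (by rwa [e']) h with h | h
  · left; convert h using 1; ring
  · right; convert h using 1; ring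

/-- The differential equation of `φ₀` where the formula through `℘` applies; this is a purely
algebraic consequence of the differential equations of `℘` at `u` and at `w`. -/
lemma deriv_phi0_sq_aux (hA : Q.A ≠ 0) (hs : s ^ 2 = Q.A) (hg₂ : L.g₂ = Q.g₂)
    (hw : Q.IsParameter s L w) {u : ℂ} (hu : u ∉ L.lattice) (hne : ℘[L] u ≠ ℘[L] w) :
    deriv (Q.phi0 s L w) u ^ 2 = Q.poly.eval (Q.phi0 s L w u) := by
  obtain ⟨hwL, hq, hq'⟩ := hw
  have hs0 : s ≠ 0 := by rintro rfl; exact hA (by rw [← hs]; ring)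
  have hform : ∀ y, y ∉ L.lattice → ℘[L] y ≠ ℘[L] w → Q.phi0 s L w y = -Q.B / Q.A + 1 / s *
      (1 / 2 * ((℘'[L] y + ℘'[L] w) / (℘[L] y - ℘[L] w))) := fun y hy hy' ↦ by
    rw [phi0, L.zeta_sub_sub_zeta_add_zeta hy hwL hy']
  have hev : Q.phi0 s L w =ᶠ[𝓝 u] fun y ↦ -Q.B / Q.A + 1 / s *
      (1 / 2 * ((℘'[L] y + ℘'[L] w) / (℘[L] y - ℘[L] w))) := by
    filter_upwards [L.isOpen_compl_lattice.mem_nhds hu,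
      (L.analyticAt_weierstrassP hu).continuousAt.eventually_ne hne] with y hy hy'
    exact hform y hy hy'
  have hd := sub_ne_zero.mpr hne
  have d1 := (((((L.hasDerivAt_derivWeierstrassP hu).add_const (℘'[L] w)).div
    ((L.hasDerivAt_weierstrassP hu).sub_const (℘[L] w)) hd).const_mul (1 / 2)).const_mul
    (1 / s)).const_add (-Q.B / Q.A)
  have d2 := (d1.congr_of_eventuallyEq hev).deriv
  rw [L.deriv_derivWeierstrassP hu] at d2
  rw [d2, hform u hu hne, eval_poly]
  have hPu := L.derivWeierstrassP_sq u hu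
  have hPw := L.derivWeierstrassP_sq w hwL
  have hC : Q.C = (Q.B ^ 2 - Q.A * ℘[L] w) / Q.A := by
    rw [hq, D]
    field_simp
    ring
  have hB' : Q.B' = (-℘'[L] w * (Q.A * s) + 3 * Q.A * Q.B * Q.C - 2 * Q.B ^ 3) / Q.A ^ 2 := by
    rw [hq', E]
    field_simp
    ring
  have hA' : Q.A' = (L.g₂ + 4 * Q.B * Q.B' - 3 * Q.C ^ 2) / Q.A := by
    rw [hg₂, g₂]
    field_simp
    ring
  set m := 1 / 2 * ((℘'[L] u + ℘'[L] w) / (℘[L] u - ℘[L] w)) with hm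
  have hmd : 2 * m * (℘[L] u - ℘[L] w) = ℘'[L] u + ℘'[L] w := by
    rw [hm]
    field_simp
  have hp' : ℘'[L] u = 2 * m * (℘[L] u - ℘[L] w) - ℘'[L] w := by linear_combination -hmd
  have hquad : 4 * (℘[L] u ^ 2 + ℘[L] u * ℘[L] w + ℘[L] w ^ 2) - L.g₂ =
      4 * m * (m * (℘[L] u - ℘[L] w) - ℘'[L] w) := by
    apply mul_left_cancel₀ hd
    rw [hp'] at hPu
    linear_combination -hPu + hPw
  have hm' : 1 / 2 * (((6 * ℘[L] u ^ 2 - L.g₂ / 2) * (℘[L] u - ℘[L] w) -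
      (℘'[L] u + ℘'[L] w) * ℘'[L] u) / (℘[L] u - ℘[L] w) ^ 2) = 2 * ℘[L] u + ℘[L] w - m ^ 2 := by
    rw [mul_div_assoc', div_eq_iff (pow_ne_zero 2 hd)]
    rw [← hmd, hp']
    linear_combination (℘[L] u - ℘[L] w) / 4 * hquad
  rw [hm']
  have hmq : (2 * ℘[L] u + ℘[L] w - m ^ 2) ^ 2 = m ^ 4 - 6 * ℘[L] w * m ^ 2 - 4 * ℘'[L] w * m -
      3 * ℘[L] w ^ 2 + L.g₂ := by
    linear_combination hquad
  rw [mul_pow, hmq, hA', hB', hC]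
  rw [← hs] at hA ⊢
  field_simp
  ring

/-- The points with `℘(u) = ℘(w)` are reached by continuity. -/
lemma deriv_phi0_sq (hA : Q.A ≠ 0) (hs : s ^ 2 = Q.A) (hg₂ : L.g₂ = Q.g₂)
    (hw : Q.IsParameter s L w) {u : ℂ} (hu : u ∉ L.lattice)
    (huw : u - w ∉ L.lattice) :
    deriv (Q.phi0 s L w) u ^ 2 = Q.poly.eval (Q.phi0 s L w u) := by
  have hS : {u : ℂ | u + w ∈ L.lattice}.Countable :=
    L.countable_lattice.preimage (add_left_injective w)
  have ha := analyticAt_phi0 (Q := Q) (s := s) hu huw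
  refine ContinuousAt.eq_of_eventually_eq_compl_countable hS
    (f := fun u ↦ deriv (Q.phi0 s L w) u ^ 2) (g := fun u ↦ Q.poly.eval (Q.phi0 s L w u))
    (ha.deriv.continuousAt.pow 2) (Q.poly.continuous.continuousAt.comp ha.continuousAt) ?_
  filter_upwards [isOpen_compl_poles.mem_nhds ⟨hu, huw⟩] with y hy hyw
  refine deriv_phi0_sq_aux hA hs hg₂ hw hy.1 ?_
  rw [Ne, L.weierstrassP_eq_iff hy.1 hw.1, not_or]
  exact ⟨hyw, hy.2⟩

end

end QuarticForm

/-! ### Uniqueness for first-order equations and the general solution -/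

/-- An analytic solution of a homogeneous linear equation `d' = h d` that vanishes at a point
vanishes near it, as the orders of vanishing of `d'` and `h d` cannot agree. -/
lemma AnalyticAt.eventually_eq_zero_of_deriv_eq_mul {d h : ℂ → ℂ} {z : ℂ} (hd : AnalyticAt ℂ d z)
    (hh : AnalyticAt ℂ h z) (h0 : d z = 0) (hdh : ∀ᶠ y in 𝓝 z, deriv d y = h y * d y) :
    ∀ᶠ y in 𝓝 z, d y = 0 := by
  rw [← analyticOrderAt_eq_top]
  by_contra hne
  have h1 := hd.analyticOrderAt_deriv_add_one
  simp only [h0, sub_zero] at h1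
  have h2 : analyticOrderAt (deriv d) z = analyticOrderAt h z + analyticOrderAt d z := by
    rw [← analyticOrderAt_mul hh hd]
    exact analyticOrderAt_congr hdh
  obtain ⟨n, hn⟩ := ENat.ne_top_iff_exists.mp hne
  change analyticOrderAt (deriv d) z + 1 = analyticOrderAt d z at h1
  rw [h2, ← hn] at h1
  cases h3 : analyticOrderAt h z with
  | top => rw [h3] at h1; simp at h1
  | coe m =>
    rw [h3] at h1
    norm_cast at h1
    omega

/-- A set in the codiscrete filter of an open set `U` contains a neighbourhood of each point of a
further such set. -/
lemma eventually_codiscreteWithin_eventually_nhds {U : Set ℂ} (hU : IsOpen U) {p : ℂ → Prop}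
    (h : ∀ᶠ u in codiscreteWithin U, p u) : ∀ᶠ u in codiscreteWithin U, ∀ᶠ v in 𝓝 u, p v := by
  rw [Filter.Eventually, mem_codiscreteWithin_iff_forall_mem_nhdsNE] at h ⊢
  intro x hx
  have h1 : ∀ᶠ u in 𝓝[≠] x, p u := by
    filter_upwards [h x hx, mem_nhdsWithin_of_mem_nhds (hU.mem_nhds hx)] with u hu hu'
    exact hu.resolve_right (not_not.mpr hu')
  filter_upwards [eventually_eventually_nhdsWithin.mpr h1, self_mem_nhdsWithin] with u hu hux
  left
  rwa [isOpen_compl_singleton.nhdsWithin_eq hux] at hu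

lemma eventually_nhdsNE_of_codiscreteWithin {U : Set ℂ} (hU : IsOpen U) {p : ℂ → Prop}
    (h : ∀ᶠ u in codiscreteWithin U, p u) {x : ℂ} (hx : x ∈ U) : ∀ᶠ u in 𝓝[≠] x, p u := by
  rw [Filter.Eventually, mem_codiscreteWithin_iff_forall_mem_nhdsNE] at h
  filter_upwards [h x hx, mem_nhdsWithin_of_mem_nhds (hU.mem_nhds hx)] with u hu hu'
  exact hu.resolve_right (not_not.mpr hu')

lemma eventually_codiscreteWithin_of_nhdsNE {U : Set ℂ} {p : ℂ → Prop}
    (h : ∀ x ∈ U, ∀ᶠ u in 𝓝[≠] x, p u) : ∀ᶠ u in codiscreteWithin U, p u := by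
  rw [Filter.Eventually, mem_codiscreteWithin_iff_forall_mem_nhdsNE]
  intro x hx
  filter_upwards [h x hx] with u hu using Or.inl hu

lemma exists_mem_of_eventually_codiscreteWithin {U : Set ℂ} (hU : IsOpen U) (hne : U.Nonempty)
    {p : ℂ → Prop} (h : ∀ᶠ u in codiscreteWithin U, p u) : ∃ u ∈ U, p u := by
  obtain ⟨x, hx⟩ := hne
  obtain ⟨u, hu, hu'⟩ := ((eventually_nhdsNE_of_codiscreteWithin hU h hx).and
    (mem_nhdsWithin_of_mem_nhds (hU.mem_nhds hx))).exists
  exact ⟨u, hu', hu⟩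

/-- The identity theorem: meromorphic functions on a connected open set that agree near a point
agree off a discrete set. -/
lemma MeromorphicOn.eventuallyEq_codiscreteWithin {U : Set ℂ} (hc : IsPreconnected U)
    {f g : ℂ → ℂ} (hf : MeromorphicOn f U) (hg : MeromorphicOn g U) {x : ℂ} (hx : x ∈ U)
    (h : f =ᶠ[𝓝 x] g) : f =ᶠ[codiscreteWithin U] g := by
  have hfg : MeromorphicOn (f - g) U := hf.sub hg
  refine eventually_codiscreteWithin_of_nhdsNE fun y hy ↦ ?_
  have htop : meromorphicOrderAt (f - g) y = ⊤ := by
    by_contra hne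
    refine hfg.meromorphicOrderAt_ne_top_of_isPreconnected hc hy hx hne ?_
    rw [meromorphicOrderAt_eq_top_iff]
    filter_upwards [h.filter_mono nhdsWithin_le_nhds] with z hz
    simp [hz]
  rw [meromorphicOrderAt_eq_top_iff] at htop
  filter_upwards [htop] with z hz
  exact sub_eq_zero.mp hz

lemma Set.Countable.not_eventually_mem {S : Set ℂ} (hS : S.Countable) (x : ℂ) :
    ¬ ∀ᶠ y in 𝓝 x, y ∈ S := by
  intro h
  obtain ⟨y, hy, hy'⟩ := ((mem_closure_iff_frequently.mp (hS.dense_compl ℂ x)).and_eventually h).exists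
  exact hy hy'

namespace QuarticForm

open scoped PeriodPair

/-- Analytic solutions of `x'² = R(x)` with the same value and the same non-zero derivative at a
point agree near that point. -/
lemma eventuallyEq_of_deriv_sq_eq (Q : QuarticForm ℂ) {x y : ℂ → ℂ} {z : ℂ} (hx : AnalyticAt ℂ x z)
    (hy : AnalyticAt ℂ y z) (hxe : ∀ᶠ u in 𝓝 z, deriv x u ^ 2 = Q.poly.eval (x u))
    (hye : ∀ᶠ u in 𝓝 z, deriv y u ^ 2 = Q.poly.eval (y u)) (h0 : x z = y z)
    (h1 : deriv x z = deriv y z) (h2 : deriv y z ≠ 0) : x =ᶠ[𝓝 z] y := by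
  have hsum : deriv x z + deriv y z ≠ 0 := by
    rw [h1, ← two_mul]; exact mul_ne_zero two_ne_zero h2
  set h : ℂ → ℂ := fun u ↦ (Q.A * (x u ^ 3 + x u ^ 2 * y u + x u * y u ^ 2 + y u ^ 3) +
    4 * Q.B * (x u ^ 2 + x u * y u + y u ^ 2) + 6 * Q.C * (x u + y u) + 4 * Q.B') /
      (deriv x u + deriv y u) with hh
  have hha : AnalyticAt ℂ h z := by
    have := hx.deriv
    have := hy.deriv
    exact AnalyticAt.div (by fun_prop) (by fun_prop) hsum
  have key := (hx.sub hy).eventually_eq_zero_of_deriv_eq_mul hha (by simp [h0]) ?_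
  · filter_upwards [key] with u hu
    exact sub_eq_zero.mp hu
  · have hne : ∀ᶠ u in 𝓝 z, deriv x u + deriv y u ≠ 0 :=
      (hx.deriv.continuousAt.add hy.deriv.continuousAt).eventually_ne hsum
    filter_upwards [hxe, hye, hne, hx.eventually_analyticAt, hy.eventually_analyticAt]
      with u h3 h4 h5 h6 h7
    rw [deriv_sub h6.differentiableAt h7.differentiableAt, hh, Pi.sub_apply, div_mul_eq_mul_div,
      eq_div_iff h5]
    rw [eval_poly] at h3 h4
    linear_combination h3 - h4

section

variable {Q : QuarticForm ℂ} {s : ℂ} {L : PeriodPair} {w : ℂ}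

lemma root_ne_zero_of_sq (hA : Q.A ≠ 0) (hs : s ^ 2 = Q.A) : s ≠ 0 := by
  rintro rfl
  exact hA (by rw [← hs]; ring)

/-- Every finite value is taken by `φ₀`, with both possible derivatives. -/
lemma exists_phi0_eq (hA : Q.A ≠ 0) (hs : s ^ 2 = Q.A) (hg₂ : L.g₂ = Q.g₂)
    (hw : Q.IsParameter s L w) (c d : ℂ) (hd : d ^ 2 = Q.poly.eval c) :
    ∃ u, u ∉ L.lattice ∧ u - w ∉ L.lattice ∧ Q.phi0 s L w u = c ∧ deriv (Q.phi0 s L w) u = d := by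
  have hs0 := root_ne_zero_of_sq hA hs
  have hp : ℘'[L] (w / 2) ≠ 0 := by simpa using (root_eq (Q := Q) (s := s) hw.1 0).1
  have hv := half_notMem hw.1
  have hex : ∃ u, u ∉ L.lattice ∧ u - w ∉ L.lattice ∧ Q.phi0 s L w u = c := by
    suffices h : ∃ u, u - w / 2 ∉ L.lattice ∧ u + w / 2 ∉ L.lattice ∧ Q.phi s L w u = c by
      obtain ⟨u, h1, h2, h3⟩ := h
      exact ⟨u + w / 2, h2, by rwa [show u + w / 2 - w = u - w / 2 by ring], h3⟩
    set c' := s * (c + Q.B / Q.A) - 1 / 2 * (deriv ℘'[L] (w / 2) / ℘'[L] (w / 2)) with hc'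
    by_cases h0 : c' = 0
    · refine ⟨0, by simpa using L.neg_notMem hv, by simpa using hv, ?_⟩
      have h1 := (root_eq (Q := Q) (s := s) hw.1 0).2
      rw [root_zero, PeriodPair.halfPeriod_zero, add_zero] at h1
      rw [h1]
      have h2 : deriv ℘'[L] (w / 2) / ℘'[L] (w / 2) = 2 * (s * (c + Q.B / Q.A)) := by
        linear_combination -2 * h0
      rw [h2]
      field_simp
      ring
    · obtain ⟨u, hu, hu'⟩ := L.exists_weierstrassP_eq (℘[L] (w / 2) + ℘'[L] (w / 2) / c')
      have hne : ℘[L] u ≠ ℘[L] (w / 2) := by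
        rw [hu']
        simpa using ⟨hp, h0⟩
      have h1 := mt (L.weierstrassP_eq_iff hu hv).mpr hne
      rw [not_or] at h1
      refine ⟨u, h1.2, h1.1, ?_⟩
      rw [(phi_eq hw.1 hu h1.2 h1.1).2, hu', add_sub_cancel_left, div_div_cancel₀ hp, hc']
      field_simp
      ring
  obtain ⟨u, hu, huw, huc⟩ := hex
  have h1 := deriv_phi0_sq hA hs hg₂ hw hu huw
  rw [huc, ← hd] at h1
  rcases sq_eq_sq_iff_eq_or_eq_neg.mp h1 with h | h
  · exact ⟨u, hu, huw, huc, h⟩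
  · have hn1 : -u + w ∉ L.lattice := by
      simpa [add_comm, sub_eq_add_neg] using L.neg_notMem huw
    have hn2 : -u + w - w ∉ L.lattice := by simpa using L.neg_notMem hu
    refine ⟨-u + w, hn1, hn2, by rw [phi0_reflect, huc], ?_⟩
    have h2 : HasDerivAt (fun y ↦ Q.phi0 s L w (-y + w))
        (deriv (Q.phi0 s L w) (-u + w) * (-1)) u :=
      HasDerivAt.comp (h := fun y ↦ -y + w) u
        (analyticAt_phi0 hn1 hn2).differentiableAt.hasDerivAt (((hasDerivAt_id u).neg).add_const w)
    simp only [phi0_reflect] at h2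
    have h3 := h2.deriv
    rw [h] at h3
    linear_combination h3

lemma countable_phi0_eq (hs : s ≠ 0) (hw : w ∉ L.lattice) (c : ℂ) :
    {u | u ∉ L.lattice ∧ u - w ∉ L.lattice ∧ Q.phi0 s L w u = c}.Countable := by
  rcases Set.eq_empty_or_nonempty {u | u ∉ L.lattice ∧ u - w ∉ L.lattice ∧ Q.phi0 s L w u = c}
    with h | ⟨a, ha⟩
  · rw [h]; exact Set.countable_empty
  obtain ⟨ha, haw, hac⟩ := ha
  have h1 : {u : ℂ | u + a - w ∈ L.lattice}.Countable := by
    refine L.countable_lattice.preimage (f := fun u : ℂ ↦ u + a - w) fun x y h ↦ ?_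
    simpa using h
  have h2 : {u : ℂ | u - a ∈ L.lattice}.Countable :=
    L.countable_lattice.preimage sub_left_injective
  refine (h1.union h2).mono ?_
  rintro u ⟨hu, huw, huc⟩
  exact add_sub_mem_or_sub_mem_of_phi0_eq hs hw hu huw ha haw (huc.trans hac.symm)

lemma eventually_analyticAt_phi0_sub (u₀ : ℂ) (U : Set ℂ) : ∀ᶠ u in codiscreteWithin U,
    u - u₀ ∉ L.lattice ∧ u - u₀ - w ∉ L.lattice := by
  refine eventually_codiscreteWithin_of_nhdsNE fun x _ ↦ ?_
  have key (c : ℂ) : ∀ᶠ u in 𝓝[≠] x, u - c ∉ L.lattice := by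
    have h1 := (L.compl_lattice_sdiff_singleton_mem_nhds (x - c))
    have h2 := (by fun_prop : ContinuousAt (fun u ↦ u - c) x).tendsto.eventually h1
    filter_upwards [h2.filter_mono nhdsWithin_le_nhds, self_mem_nhdsWithin] with u hu hux h
    exact hu ⟨h, fun h' ↦ hux (sub_left_injective h')⟩
  filter_upwards [key u₀, key (u₀ + w)] with u h1 h2
  exact ⟨h1, by rwa [sub_sub]⟩

lemma deriv_phi0_sub (u₀ u : ℂ) : deriv (fun u ↦ Q.phi0 s L w (u - u₀)) u =
    deriv (Q.phi0 s L w) (u - u₀) :=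
  deriv_comp_sub_const (f := Q.phi0 s L w) u₀ u

lemma not_eventually_phi0_eq (hs : s ≠ 0) (hw : w ∉ L.lattice) (u₀ c x : ℂ) :
    ¬ ∀ᶠ u in 𝓝 x, (u - u₀ ∉ L.lattice ∧ u - u₀ - w ∉ L.lattice) ∧ Q.phi0 s L w (u - u₀) = c := by
  intro h
  refine ((countable_phi0_eq (Q := Q) hs hw c).preimage
    (sub_left_injective (b := u₀))).not_eventually_mem x ?_
  filter_upwards [h] with u hu
  exact ⟨hu.1.1, hu.1.2, hu.2⟩

/-- The general solution. A non-constant solution `x` is regular with `x' ≠ 0` at some point; there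
a translate of `φ₀` has the same value and the same derivative, hence agrees with `x` near that
point, and by the identity theorem on all of `U`. -/
lemma isQuarticSolution_iff (hA : Q.A ≠ 0) (hs : s ^ 2 = Q.A) (hg₂ : L.g₂ = Q.g₂)
    (hw : Q.IsParameter s L w) {U : Set ℂ} (hU : IsOpen U) (hUc : IsConnected U) (x : ℂ → ℂ) :
    IsQuarticSolution Q.poly U x ↔
      ∃ u₀ : ℂ, x =ᶠ[codiscreteWithin U] fun u => Q.phi0 s L w (u - u₀) := by
  have hs0 := root_ne_zero_of_sq hA hs
  constructor
  · rintro ⟨hm, hnc, hode⟩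
    have hgood : ∀ᶠ u in codiscreteWithin U, AnalyticAt ℂ x u ∧
        ∀ᶠ v in 𝓝 u, AnalyticAt ℂ x v ∧ deriv x v ^ 2 = Q.poly.eval (x v) := by
      have h1 := MeromorphicOn.eventually_codiscreteWithin_analyticAt x hm
      filter_upwards [h1, eventually_codiscreteWithin_eventually_nhds hU (h1.and hode)]
        with u h3 h4 using ⟨h3, h4⟩
    -- There is a regular point at which the derivative does not vanish.
    obtain ⟨z, hzU, hza, hze, hz0⟩ : ∃ z ∈ U, AnalyticAt ℂ x z ∧
        (∀ᶠ v in 𝓝 z, AnalyticAt ℂ x v ∧ deriv x v ^ 2 = Q.poly.eval (x v)) ∧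
          deriv x z ≠ 0 := by
      by_contra! hcon
      obtain ⟨z, hzU, hz⟩ := exists_mem_of_eventually_codiscreteWithin hU hUc.nonempty
        (eventually_codiscreteWithin_eventually_nhds hU hgood)
      refine hnc ⟨x z, ?_⟩
      refine MeromorphicOn.eventuallyEq_codiscreteWithin hUc.isPreconnected hm
        (fun _ _ ↦ MeromorphicAt.const _ _) hzU ?_
      have h0 : ∀ᶠ y in 𝓝 z, deriv (fun y ↦ x y - x z) y = 0 * (x y - x z) := by
        filter_upwards [hz, hU.mem_nhds hzU] with y hy hyU
        rw [deriv_sub_const, zero_mul]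
        exact hcon y hyU hy.1 hy.2
      have h1 := AnalyticAt.eventually_eq_zero_of_deriv_eq_mul (d := fun y ↦ x y - x z)
        (h := fun _ ↦ 0) (hz.self_of_nhds.1.sub analyticAt_const) analyticAt_const (sub_self _) h0
      filter_upwards [h1] with y hy
      exact sub_eq_zero.mp hy
    obtain ⟨t, ht, htw, htx, htd⟩ := exists_phi0_eq hA hs hg₂ hw (x z) (deriv x z)
      hze.self_of_nhds.2
    refine ⟨z - t, MeromorphicOn.eventuallyEq_codiscreteWithin hUc.isPreconnected hm
      (fun u _ ↦ meromorphicAt_phi0_sub _ u) hzU ?_⟩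
    have hzt : z - (z - t) = t := by ring
    refine eventuallyEq_of_deriv_sq_eq Q hza ?_ (hze.mono fun v hv ↦ hv.2) ?_ ?_ ?_ ?_
    · exact (analyticAt_phi0 (u := z - (z - t)) (by rwa [hzt]) (by rwa [hzt])).comp
        (f := fun u ↦ u - (z - t)) (by fun_prop)
    · have h1 : ∀ᶠ v in 𝓝 z, v - (z - t) ∉ L.lattice ∧ v - (z - t) - w ∉ L.lattice :=
        (by fun_prop : ContinuousAt (fun v ↦ v - (z - t)) z).tendsto.eventually
          (isOpen_compl_poles.mem_nhds (by rw [hzt]; exact ⟨ht, htw⟩))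
      filter_upwards [h1] with v hv
      rw [deriv_phi0_sub]
      exact deriv_phi0_sq hA hs hg₂ hw hv.1 hv.2
    · rw [hzt, htx]
    · rw [deriv_phi0_sub, hzt, htd]
    · rwa [deriv_phi0_sub, hzt, htd]
  · rintro ⟨u₀, hx⟩
    have hpole := eventually_analyticAt_phi0_sub (L := L) (w := w) u₀ U
    refine ⟨fun y hy ↦ ?_, ?_, ?_⟩
    · exact (meromorphicAt_phi0_sub u₀ y).congr
        (Filter.EventuallyEq.symm (eventually_nhdsNE_of_codiscreteWithin hU hx hy))
    · rintro ⟨c, hc⟩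
      obtain ⟨z, _, hz⟩ := exists_mem_of_eventually_codiscreteWithin hU hUc.nonempty
        (eventually_codiscreteWithin_eventually_nhds hU ((hx.and hc).and hpole))
      refine not_eventually_phi0_eq (Q := Q) hs0 hw.1 u₀ c z ?_
      filter_upwards [hz] with u hu
      exact ⟨hu.2, hu.1.1.symm.trans hu.1.2⟩
    · filter_upwards [eventually_codiscreteWithin_eventually_nhds hU (hx.and hpole)] with u hu
      have h1 : x =ᶠ[𝓝 u] fun u => Q.phi0 s L w (u - u₀) := hu.mono fun v hv ↦ hv.1
      rw [h1.deriv_eq, h1.self_of_nhds, deriv_phi0_sub]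
      exact deriv_phi0_sq hA hs hg₂ hw hu.self_of_nhds.2.1 hu.self_of_nhds.2.2

/-! ### Even solutions -/

lemma isQuarticSolution_phi_add (hA : Q.A ≠ 0) (hs : s ^ 2 = Q.A) (hg₂ : L.g₂ = Q.g₂)
    (hw : Q.IsParameter s L w) (k : Fin 4) :
    IsQuarticSolution Q.poly Set.univ (fun u => Q.phi s L w (u + L.halfPeriod k)) := by
  rw [isQuarticSolution_iff hA hs hg₂ hw isOpen_univ isConnected_univ]
  refine ⟨-(L.halfPeriod k + w / 2), .of_forall fun u ↦ ?_⟩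
  simp only [phi]
  congr 1
  ring

lemma phi_neg_add_halfPeriod (k : Fin 4) {u : ℂ} (h1 : u + L.halfPeriod k - w / 2 ∉ L.lattice)
    (h2 : u + L.halfPeriod k + w / 2 ∉ L.lattice) :
    Q.phi s L w (-u + L.halfPeriod k) = Q.phi s L w (u + L.halfPeriod k) := by
  rw [← phi_neg, show -(-u + L.halfPeriod k) = u + L.halfPeriod k + -(2 * L.halfPeriod k) by ring]
  exact phi_add_mem (neg_mem (L.two_mul_halfPeriod_mem k)) h1 h2

/-- If `φ₀(u - u₀)` is even then, as `φ₀` is symmetric under `u ↦ w - u` and injective up to this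
symmetry and periods, `2 u₀ + w` is a period, so `-u₀ - w / 2` is one of the half periods `ω_k`
up to a period. -/
lemma exists_eq_phi_add_of_even (hA : Q.A ≠ 0) (hs : s ^ 2 = Q.A) (hg₂ : L.g₂ = Q.g₂)
    (hw : Q.IsParameter s L w) {x : ℂ → ℂ} (hx : IsQuarticSolution Q.poly Set.univ x)
    (heven : ∀ᶠ u in codiscrete ℂ, x (-u) = x u) :
    ∃ k : Fin 4, x =ᶠ[codiscrete ℂ] fun u => Q.phi s L w (u + L.halfPeriod k) := by
  have hs0 := root_ne_zero_of_sq hA hs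
  obtain ⟨u₀, hu₀⟩ := (isQuarticSolution_iff hA hs hg₂ hw isOpen_univ isConnected_univ x).mp hx
  have hpole := eventually_analyticAt_phi0_sub (L := L) (w := w) u₀ Set.univ
  have hpole' := eventually_analyticAt_phi0_sub (L := L) (w := w) (-u₀ - w) Set.univ
  have hneg : Tendsto (fun u : ℂ ↦ -u) (𝓝[≠] 1) (𝓝[≠] (-1)) := by
    refine tendsto_nhdsWithin_of_tendsto_nhds_of_eventually_within _
      ((continuous_neg.tendsto 1).mono_left nhdsWithin_le_nhds) ?_
    filter_upwards [self_mem_nhdsWithin] with u hu h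
    exact hu (neg_injective h)
  -- Near a point, evenness says that `φ₀` takes equal values at `u - u₀` and `u + u₀ + w`.
  have h1 : ∀ᶠ u in 𝓝[≠] (1 : ℂ), (u - u₀ ∉ L.lattice ∧ u - u₀ - w ∉ L.lattice) ∧
      (u - (-u₀ - w) ∉ L.lattice ∧ u - (-u₀ - w) - w ∉ L.lattice) ∧
      Q.phi0 s L w (u - u₀) = Q.phi0 s L w (u - (-u₀ - w)) := by
    have nh {p : ℂ → Prop} (h : ∀ᶠ u in codiscreteWithin Set.univ, p u) (y : ℂ) :
        ∀ᶠ u in 𝓝[≠] y, p u :=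
      eventually_nhdsNE_of_codiscreteWithin isOpen_univ h (Set.mem_univ y)
    filter_upwards [nh hpole 1, nh hpole' 1, nh heven 1, nh hu₀ 1,
      hneg.eventually (nh hu₀ (-1))] with u h2 h3 h4 h5 h6
    refine ⟨h2, h3, ?_⟩
    rw [← h5, ← h4, h6, ← phi0_reflect]
    congr 1
    ring
  have h2 : 2 * u₀ + w ∈ L.lattice := by
    by_contra hcon
    obtain ⟨U, hU, h1U⟩ := mem_nhdsWithin_iff_exists_mem_nhds_inter.mp h1
    refine (L.countable_two_mul.union (Set.countable_singleton (1 : ℂ))).not_eventually_mem 1 ?_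
    filter_upwards [hU] with u hu
    by_cases hu1 : u = 1
    · exact Or.inr hu1
    left
    obtain ⟨h3, h4, h5⟩ := h1U ⟨hu, hu1⟩
    rcases add_sub_mem_or_sub_mem_of_phi0_eq hs0 hw.1 h3.1 h3.2 h4.1 h4.2 h5 with h | h
    · change 2 * u ∈ L.lattice
      convert h using 1
      ring
    · exfalso
      refine hcon ?_
      have := neg_mem h
      convert this using 1
      ring
  obtain ⟨k, hk⟩ := L.exists_sub_halfPeriod_mem (h := -u₀ - w / 2) (by
    have := neg_mem h2
    convert this using 1
    ring)
  refine ⟨k, ?_⟩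
  filter_upwards [hu₀, hpole] with u h3 h4
  rw [h3, phi, show u + L.halfPeriod k + w / 2 = u - u₀ + -(-u₀ - w / 2 - L.halfPeriod k) by ring,
    phi0_add_mem (neg_mem hk) h4.1 h4.2]

/-- The values of the even solutions at the origin are roots of `R`, as the derivative of an even
function vanishes there. -/
lemma eval_root (hA : Q.A ≠ 0) (hs : s ^ 2 = Q.A) (hg₂ : L.g₂ = Q.g₂) (hw : Q.IsParameter s L w)
    (k : Fin 4) : Q.poly.eval (Q.root s L w k) = 0 := by
  obtain ⟨h1, h2⟩ := halfPeriod_half_notMem hw.1 k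
  have h1' : L.halfPeriod k + w / 2 - w ∉ L.lattice := by
    rwa [show L.halfPeriod k + w / 2 - w = L.halfPeriod k - w / 2 by ring]
  have hd := (hasDerivAt_phi0 (Q := Q) (s := s) h2 h1').deriv
  have hP : ℘[L] (L.halfPeriod k + w / 2) = ℘[L] (L.halfPeriod k + w / 2 - w) := by
    rw [L.weierstrassP_eq_iff h2 h1']
    left
    convert L.two_mul_halfPeriod_mem k using 1
    ring
  rw [hP, sub_self, mul_zero] at hd
  have h3 := deriv_phi0_sq hA hs hg₂ hw h2 h1'
  rw [hd] at h3
  rw [root, phi, ← h3]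
  ring

lemma natDegree_poly (hA : Q.A ≠ 0) : Q.poly.natDegree = 4 ∧ Q.poly.leadingCoeff = Q.A := by
  have h : Q.poly.natDegree = 4 := by
    unfold poly
    compute_degree!
  refine ⟨h, ?_⟩
  rw [leadingCoeff, h]
  simp only [poly, coeff_add, coeff_C_mul, coeff_X_pow, coeff_X, coeff_C]
  norm_num

/-- The four values `a_k` are different roots of a polynomial of degree four. -/
lemma poly_eq_prod (hA : Q.A ≠ 0) (hs : s ^ 2 = Q.A) (hg₂ : L.g₂ = Q.g₂)
    (hw : Q.IsParameter s L w) :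
    Q.poly = Polynomial.C Q.A * ∏ k : Fin 4, (X - Polynomial.C (Q.root s L w k)) := by
  have hs0 := root_ne_zero_of_sq hA hs
  obtain ⟨hdeg, hlead⟩ := natDegree_poly hA
  have h0 : Q.poly ≠ 0 := by
    intro h
    rw [h] at hdeg
    simp at hdeg
  have hle : (Finset.univ.val.map (Q.root s L w)) ≤ Q.poly.roots := by
    rw [Multiset.le_iff_subset ((Multiset.nodup_map_iff_of_injective (root_injective hs0 hw.1)).mpr
      Finset.univ.nodup)]
    intro r hr
    obtain ⟨k, _, rfl⟩ := Multiset.mem_map.mp hr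
    exact (mem_roots h0).mpr (eval_root hA hs hg₂ hw k)
  have hcard : Multiset.card Q.poly.roots ≤ 4 := hdeg ▸ Q.poly.card_roots'
  have heq : (Finset.univ.val.map (Q.root s L w)) = Q.poly.roots :=
    Multiset.eq_of_le_of_card_le hle (by simpa using hcard)
  have h1 := C_leadingCoeff_mul_prod_multiset_X_sub_C (p := Q.poly) (by rw [hdeg, ← heq]; simp)
  rw [← h1, hlead, ← heq, Multiset.map_map]
  rfl

/-! ### Change of the parameter and explicit formulas -/

lemma IsParameter.add_mem (hw : Q.IsParameter s L w) {l : ℂ} (hl : l ∈ L.lattice) :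
    Q.IsParameter s L (w + l) :=
  ⟨(L.add_mem_iff_notMem hl).mpr hw.1, by rw [L.weierstrassP_add_mem hl]; exact hw.2.1,
    by rw [L.derivWeierstrassP_add_mem hl]; exact hw.2.2⟩

lemma phi_parameter_add (hw : w ∉ L.lattice) {l u : ℂ} (hl : l ∈ L.lattice)
    (h1 : u + l / 2 - w / 2 ∉ L.lattice) :
    Q.phi s L (w + l) u = Q.phi s L w (u + l / 2) := by
  obtain ⟨η, hη⟩ := L.exists_weierstrassZeta_add hl
  have h3 : L.weierstrassZeta (u + l / 2 - w / 2) =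
      L.weierstrassZeta (u + (w + l) / 2 - (w + l)) + η := by
    rw [← hη]
    · congr 1
      ring
    · rw [← L.add_mem_iff_notMem hl]
      convert h1 using 2
      ring
  rw [phi, phi, phi0, phi0, show u + l / 2 + w / 2 - w = u + l / 2 - w / 2 by ring, h3, hη w hw,
    show u + (w + l) / 2 = u + l / 2 + w / 2 by ring]
  ring

/-- `φ(u + ω_k, w)` through `℘(u)`: the shift by `ω_k` replaces `w / 2` by `w / 2 + ω_k`. -/
lemma phi_add_halfPeriod_eq (hw : w ∉ L.lattice) (k : Fin 4) {u : ℂ} (hu : u ∉ L.lattice)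
    (h1 : u + L.halfPeriod k - w / 2 ∉ L.lattice) (h2 : u + L.halfPeriod k + w / 2 ∉ L.lattice) :
    ℘[L] u - ℘[L] (w / 2 + L.halfPeriod k) ≠ 0 ∧
    Q.phi s L w (u + L.halfPeriod k) = Q.root s L w k + 1 / s *
      (℘'[L] (w / 2 + L.halfPeriod k) / (℘[L] u - ℘[L] (w / 2 + L.halfPeriod k))) := by
  have hl := L.two_mul_halfPeriod_mem k
  have e : 2 * L.halfPeriod k / 2 = L.halfPeriod k := by ring
  have e2 : (w + 2 * L.halfPeriod k) / 2 = w / 2 + L.halfPeriod k := by ring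
  have h3 := phi_parameter_add (Q := Q) (s := s) hw hl (u := u) (by rwa [e])
  rw [e] at h3
  have hm : u - (w / 2 + L.halfPeriod k) ∉ L.lattice := by
    rw [← L.add_mem_iff_notMem hl]
    convert h1 using 2
    ring
  obtain ⟨h4, h5⟩ := phi_eq (Q := Q) (s := s) (w := w + 2 * L.halfPeriod k)
    ((L.add_mem_iff_notMem hl).mpr hw) hu (by rwa [e2]) (by
      rw [e2]; convert h2 using 2; ring)
  rw [e2] at h4 h5
  refine ⟨h4, ?_⟩
  rw [← h3, h5, (root_eq hw k).2]
  ring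

/-- With `v = w / 2 + ω_k`, the numbers `δ_{kj} s_j ℘'(v)` are polynomials in `℘(v)`. -/
lemma shiftSign_mul_sigmaRatio_mul (hw : w ∉ L.lattice) (k : Fin 4) {i j l : Fin 4} (hi : i ≠ 0)
    (hcub : ∀ z ∉ L.lattice, ℘'[L] z ^ 2 =
      4 * (℘[L] z - L.e i) * (℘[L] z - L.e j) * (℘[L] z - L.e l))
    (hsum : L.e i + L.e j + L.e l = 0)
    (hg₂ : L.g₂ = -4 * (L.e i * L.e j + L.e j * L.e l + L.e l * L.e i)) :
    PeriodPair.shiftSign k i * L.sigmaRatio i w * ℘'[L] (w / 2 + L.halfPeriod k) =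
      -((℘[L] (w / 2 + L.halfPeriod k) - L.e i) ^ 2 - (L.e i - L.e j) * (L.e i - L.e l)) := by
  have h2v : 2 * (w / 2 + L.halfPeriod k) = w + 2 * L.halfPeriod k := by ring
  have hv2 : 2 * (w / 2 + L.halfPeriod k) ∉ L.lattice := by
    rw [h2v]; exact (L.add_mem_iff_notMem (L.two_mul_halfPeriod_mem k)).mpr hw
  have h1 := L.sigmaRatio_two_mul hi hcub hsum hg₂ hv2
  rw [h2v, L.sigmaRatio_add_two_mul_halfPeriod hi] at h1
  linear_combination -h1

/-- The three products `δ_{kj} s_j ℘'(v)` for `j = 1, 2, 3`. -/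
lemma shiftSign_mul_sigmaRatio_mul_all (hw : w ∉ L.lattice) (k : Fin 4) :
    let p := ℘[L] (w / 2 + L.halfPeriod k)
    let p' := ℘'[L] (w / 2 + L.halfPeriod k)
    PeriodPair.shiftSign k 1 * L.sigmaRatio 1 w * p' =
      -((p - L.e 1) ^ 2 - (L.e 1 - L.e 2) * (L.e 1 - L.e 3)) ∧
    PeriodPair.shiftSign k 2 * L.sigmaRatio 2 w * p' =
      -((p - L.e 2) ^ 2 - (L.e 2 - L.e 3) * (L.e 2 - L.e 1)) ∧
    PeriodPair.shiftSign k 3 * L.sigmaRatio 3 w * p' =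
      -((p - L.e 3) ^ 2 - (L.e 3 - L.e 1) * (L.e 3 - L.e 2)) := by
  obtain ⟨hs, hg, _⟩ := L.e_symm
  refine ⟨shiftSign_mul_sigmaRatio_mul hw k (by decide) (fun z hz ↦ L.e_sq_mul hz) hs hg,
    shiftSign_mul_sigmaRatio_mul hw k (by decide) (fun z hz ↦ ?_) (by linear_combination hs)
      (by linear_combination hg),
    shiftSign_mul_sigmaRatio_mul hw k (by decide) (fun z hz ↦ ?_) (by linear_combination hs)
      (by linear_combination hg)⟩
  · rw [L.e_sq_mul hz]; ring
  · rw [L.e_sq_mul hz]; ring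

lemma halfPeriod_add_half_notMem (hw : w ∉ L.lattice) (k : Fin 4) :
    w / 2 + L.halfPeriod k ∉ L.lattice := by
  rw [add_comm]
  exact (halfPeriod_half_notMem hw k).2

/-- In terms of `v = w / 2 + ω_k`, the sum of the three products `δ_{kj} s_j ℘'(v)` is
`-℘''(v) / 2`. -/
lemma root_eq_h0 (hw : w ∉ L.lattice) (k : Fin 4) :
    Q.root s L w k = -Q.B / Q.A - L.h0 k w / s := by
  obtain ⟨hp, hr⟩ := root_eq (Q := Q) (s := s) hw k
  obtain ⟨h1, h2, h3⟩ := shiftSign_mul_sigmaRatio_mul_all hw k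
  obtain ⟨hs, hg, _⟩ := L.e_symm
  have hc : L.e 3 = -L.e 1 - L.e 2 := by linear_combination hs
  have hkey : L.h0 k w * ℘'[L] (w / 2 + L.halfPeriod k) =
      -deriv ℘'[L] (w / 2 + L.halfPeriod k) / 2 := by
    rw [L.deriv_derivWeierstrassP (halfPeriod_add_half_notMem hw k), PeriodPair.h0, hg]
    rw [hc] at h1 h2 h3 ⊢
    linear_combination h1 + h2 + h3
  have hd : deriv ℘'[L] (w / 2 + L.halfPeriod k) / ℘'[L] (w / 2 + L.halfPeriod k) =
      -2 * L.h0 k w := by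
    rw [div_eq_iff hp]
    linear_combination 2 * hkey
  rw [hr, hd]
  ring

/-- In terms of `v = w / 2 + ω_k`, the expression `(h₁ ℘(u) + h₂) ℘'(v)` is a multiple of
`℘(u) - ℘(v)`. -/
lemma phi_add_halfPeriod_eq_h (hw : w ∉ L.lattice) (k : Fin 4) {u : ℂ} (hu : u ∉ L.lattice)
    (hu1 : u + L.halfPeriod k - w / 2 ∉ L.lattice)
    (hu2 : u + L.halfPeriod k + w / 2 ∉ L.lattice) :
    L.h1 k w * ℘[L] u + L.h2 k w ≠ 0 ∧
    Q.phi s L w (u + L.halfPeriod k) = -Q.B / Q.A - L.h0 k w / s -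
      2 / s * ((L.e 2 - L.e 3) * (L.e 3 - L.e 1) * (L.e 1 - L.e 2) /
        (L.h1 k w * ℘[L] u + L.h2 k w)) := by
  obtain ⟨hp, -⟩ := root_eq (Q := Q) (s := s) hw k
  obtain ⟨h1, h2, h3⟩ := shiftSign_mul_sigmaRatio_mul_all hw k
  obtain ⟨hne, hphi⟩ := phi_add_halfPeriod_eq (Q := Q) (s := s) hw k hu hu1 hu2
  obtain ⟨hs, hg, _⟩ := L.e_symm
  have hc : L.e 3 = -L.e 1 - L.e 2 := by linear_combination hs
  have hkey : (L.h1 k w * ℘[L] u + L.h2 k w) * ℘'[L] (w / 2 + L.halfPeriod k) =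
      -2 * ((L.e 2 - L.e 3) * (L.e 3 - L.e 1) * (L.e 1 - L.e 2)) *
        (℘[L] u - ℘[L] (w / 2 + L.halfPeriod k)) := by
    rw [PeriodPair.h1, PeriodPair.h2]
    linear_combination ((L.e 2 - L.e 3) * ℘[L] u + (L.e 2 ^ 2 - L.e 3 ^ 2)) * h1 +
      ((L.e 3 - L.e 1) * ℘[L] u + (L.e 3 ^ 2 - L.e 1 ^ 2)) * h2 +
      ((L.e 1 - L.e 2) * ℘[L] u + (L.e 1 ^ 2 - L.e 2 ^ 2)) * h3 +
      (-2 * (L.e 1 - L.e 2) * (L.e 2 - L.e 3) * (L.e 3 - L.e 1)) * hs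
  have hdisc : (L.e 2 - L.e 3) * (L.e 3 - L.e 1) * (L.e 1 - L.e 2) ≠ 0 :=
    mul_ne_zero (mul_ne_zero (L.e_sub_e_ne_zero (by decide) (by decide) (by decide))
      (L.e_sub_e_ne_zero (by decide) (by decide) (by decide)))
      (L.e_sub_e_ne_zero (by decide) (by decide) (by decide))
  have hne2 : L.h1 k w * ℘[L] u + L.h2 k w ≠ 0 := by
    intro h
    rw [h, zero_mul] at hkey
    simp only [neg_mul, zero_eq_neg, mul_eq_zero, OfNat.ofNat_ne_zero, false_or] at hkey
    rcases hkey with h | h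
    · exact hdisc (by simpa using h)
    · exact hne h
  refine ⟨hne2, ?_⟩
  rw [hphi, root_eq_h0 hw k]
  have hq : ℘'[L] (w / 2 + L.halfPeriod k) / (℘[L] u - ℘[L] (w / 2 + L.halfPeriod k)) =
      -2 * ((L.e 2 - L.e 3) * (L.e 3 - L.e 1) * (L.e 1 - L.e 2) /
        (L.h1 k w * ℘[L] u + L.h2 k w)) := by
    rw [mul_div_assoc', div_eq_div_iff hne hne2]
    linear_combination hkey
  rw [hq]
  ring

/-! ### The parameter `w` -/

/-- `D / A` satisfies `4 t³ - g₂ t - g₃ = (E / (A √A))²`, so that `℘(w) = D / A` implies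
`℘'(w) = ± E / (A √A)`. -/
lemma cubic_eq_sq (hA : Q.A ≠ 0) (hs : s ^ 2 = Q.A) : 4 * (Q.D / Q.A) ^ 3 - Q.g₂ * (Q.D / Q.A) -
    Q.g₃ = (-Q.E / (Q.A * s)) ^ 2 := by
  rw [div_pow (-Q.E), mul_pow, hs, D, E, g₂, g₃]
  field_simp
  ring

/-- The sign of `℘'(w)` is adjusted by passing to `-w`. -/
lemma exists_isParameter_aux (hA : Q.A ≠ 0) (hs : s ^ 2 = Q.A) (hg₂ : L.g₂ = Q.g₂)
    (hg₃ : L.g₃ = Q.g₃) (hw : w ∉ L.lattice) (h : ℘[L] w = Q.D / Q.A) :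
    Q.IsParameter s L w ∨ Q.IsParameter s L (-w) := by
  have h1 := L.derivWeierstrassP_sq w hw
  rw [h, hg₂, hg₃, cubic_eq_sq hA hs] at h1
  rcases sq_eq_sq_iff_eq_or_eq_neg.mp h1 with h2 | h2
  · exact Or.inl ⟨hw, h, h2⟩
  · refine Or.inr ⟨L.neg_notMem hw, by rw [L.weierstrassP_neg, h], ?_⟩
    rw [L.derivWeierstrassP_neg, h2, neg_neg]

lemma exists_isParameter (hA : Q.A ≠ 0) (hs : s ^ 2 = Q.A) (hg₂ : L.g₂ = Q.g₂)
    (hg₃ : L.g₃ = Q.g₃) : ∃ w, Q.IsParameter s L w := by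
  obtain ⟨w, hw, h⟩ := L.exists_weierstrassP_eq (Q.D / Q.A)
  rcases exists_isParameter_aux hA hs hg₂ hg₃ hw h with h | h
  · exact ⟨_, h⟩
  · exact ⟨_, h⟩

/-- The invariants of a quartic without repeated factors are those of a cubic without repeated
roots: the differences of the roots of the cubic are products of differences of roots of `R`. -/
lemma discriminant_ne_zero (hA : Q.A ≠ 0) (hsq : Squarefree Q.poly) :
    Q.g₂ ^ 3 - 27 * Q.g₃ ^ 2 ≠ 0 := by
  obtain ⟨hdeg, hlead⟩ := natDegree_poly hA
  have hnd : Q.poly.roots.Nodup :=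
    nodup_roots (PerfectField.separable_iff_squarefree.mpr hsq)
  have hcard : Multiset.card Q.poly.roots = 4 := by
    rw [← hdeg]
    exact (IsAlgClosed.splits Q.poly).natDegree_eq_card_roots.symm
  have hprod := C_leadingCoeff_mul_prod_multiset_X_sub_C (p := Q.poly) (by rw [hcard, hdeg])
  obtain ⟨l, hl⟩ := Quot.exists_rep Q.poly.roots
  change (l : Multiset ℂ) = _ at hl
  rw [← hl] at hnd hcard hprod
  match l, hcard with
  | [a, b, c, d], _ =>
  rw [Multiset.coe_nodup] at hnd
  simp only [List.nodup_cons, List.mem_cons, List.not_mem_nil, or_false, not_or, List.nodup_nil,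
    and_true, not_false_eq_true] at hnd
  obtain ⟨⟨hab, hac, had⟩, ⟨hbc, hbd⟩, hcd⟩ := hnd
  simp only [Multiset.map_coe, List.map_cons, List.map_nil, Multiset.prod_coe, List.prod_cons,
    List.prod_nil, mul_one, hlead] at hprod
  have hev (x : ℂ) := congrArg (fun p ↦ p.eval x) hprod
  simp only [eval_poly, eval_mul, eval_C, eval_sub, eval_X] at hev
  have e0 := hev 0
  have e1 := hev 1
  have e2 := hev (-1)
  have e3 := hev 2
  have hA' : Q.A' = Q.A * (a * b * c * d) := by linear_combination -e0
  have hC : Q.C = Q.A * (a * b + a * c + a * d + b * c + b * d + c * d) / 6 := by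
    linear_combination (-e1 - e2) / 12 + e0 / 6
  have hB : Q.B = -Q.A * (a + b + c + d) / 4 := by
    linear_combination (-e3 + 2 * e1) / 24 - hC / 2 + hA' / 24
  have hB' : Q.B' = -Q.A * (a * b * c + a * b * d + a * c * d + b * c * d) / 4 := by
    linear_combination (e2 - e1) / 8 - hB
  have hdisc : Q.g₂ ^ 3 - 27 * Q.g₃ ^ 2 = Q.A ^ 6 / 256 * ((a - b) * (a - c) * (a - d) *
      (b - c) * (b - d) * (c - d)) ^ 2 := by
    rw [g₂, g₃, hA', hB, hB', hC]
    ring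
  rw [hdisc]
  simp [hA, sub_eq_zero, hab, hac, had, hbc, hbd, hcd]

end

end QuarticForm

/-! ### Lattices with given invariants -/

section

open UpperHalfPlane ModularForm ModularFormClass EisensteinSeries MatrixGroups OnePoint Asymptotics

lemma tendsto_E_atImInfty {k : ℕ} (hk : 3 ≤ k) (hk2 : Even k) :
    Tendsto (E hk) atImInfty (𝓝 1) := by
  have hv : valueAtInfty (E hk) = 1 := by
    rw [← E_qExpansion_coeff_zero hk hk2]
    exact (UpperHalfPlane.qExpansion_coeff_zero one_pos
      (ModularFormClass.analyticAt_cuspFunction_zero (E hk) one_pos one_mem_strictPeriods_SL)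
      (SlashInvariantFormClass.periodic_comp_ofComplex (E hk) one_mem_strictPeriods_SL)).symm
  obtain ⟨c, hc, h⟩ := exp_decay_sub_atImInfty' (E hk)
  rw [hv] at h
  have h1 : Tendsto (fun τ : ℍ ↦ Real.exp (-c * τ.im)) atImInfty (𝓝 0) := by
    refine Real.tendsto_exp_atBot.comp ?_
    exact (tendsto_comap (f := UpperHalfPlane.im) (x := atTop)).const_mul_atTop_of_neg (by linarith)
  have h2 := h.trans_tendsto h1
  simpa using h2.add_const (1 : ℂ)

/-- If `a E₄³ - b E₆²` had no zero then, as it tends to `a - b ≠ 0` at the cusp, the quotient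
`Δ / (a E₄³ - b E₆²)` would be a modular form of weight `0` that vanishes at the cusp, hence zero. -/
lemma exists_mul_E₄_cube_eq {a b : ℂ} (hab : a ≠ b) :
    ∃ τ : ℍ, a * E₄ τ ^ 3 = b * E₆ τ ^ 2 := by
  by_contra! hne
  let f : ModularForm 𝒮ℒ 12 :=
    a • ModularForm.mcast (by decide) (E₄.pow 3) - b • ModularForm.mcast (by decide) (E₆.pow 2)
  have hf (τ : ℍ) : f τ = a * E₄ τ ^ 3 - b * E₆ τ ^ 2 := by
    have h1 : (E₄.pow 3) τ = E₄ τ ^ 3 := congrFun (ModularForm.coe_pow E₄ 3) τ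
    have h2 : (E₆.pow 2) τ = E₆ τ ^ 2 := congrFun (ModularForm.coe_pow E₆ 2) τ
    simp [f, coe_mcast, h1, h2]
  have hf0 (τ : ℍ) : f τ ≠ 0 := by
    rw [hf]
    exact sub_ne_zero.mpr (hne τ)
  have hlim : Tendsto f atImInfty (𝓝 (a - b)) := by
    have h1 := ((tendsto_E_atImInfty (by norm_num : 3 ≤ 4) ⟨2, rfl⟩).pow 3).const_mul a
    have h2 := ((tendsto_E_atImInfty (by norm_num : 3 ≤ 6) ⟨3, rfl⟩).pow 2).const_mul b
    have h3 := h1.sub h2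
    simp only [one_pow, mul_one] at h3
    exact h3.congr fun τ ↦ (hf τ).symm
  have hΔ : Tendsto (fun τ ↦ discriminant τ / f τ) atImInfty (𝓝 0) := by
    have := discriminant_isZeroAtImInfty.div hlim (sub_ne_zero.mpr hab)
    rwa [zero_div] at this
  have hslash (γ : SL(2, ℤ)) : (fun z ↦ discriminant z / f z) ∣[(0 : ℤ)] γ =
      fun z ↦ discriminant z / f z := by
    have hγ : (γ : GL (Fin 2) ℝ) ∈ 𝒮ℒ := ⟨γ, rfl⟩
    change (⇑CuspForm.discriminant / ⇑f) ∣[(12 : ℤ) - 12] γ = ⇑CuspForm.discriminant / ⇑f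
    simp_rw [div_slash_SL2, SL_slash, SlashInvariantForm.slash_action_eqn _ _ hγ]
  let q : ModularForm 𝒮ℒ 0 :=
    { toFun z := discriminant z / f z
      slash_action_eq' := fun _ ⟨γ, hγ⟩ ↦ hγ ▸ hslash γ
      holo' := CuspForm.discriminant.holo'.div f.holo' hf0
      bdd_at_cusps' {c} hc := by
        rw [Subgroup.IsArithmetic.isCusp_iff_isCusp_SL2Z] at hc
        rw [isBoundedAt_iff_forall_SL2Z hc]
        intro γ _
        rw [hslash γ]
        exact hΔ.isBigO_one ℝ }
  obtain ⟨c, hc⟩ := levelOne_weight_zero_const q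
  have hq (τ : ℍ) : discriminant τ / f τ = c := congrFun hc τ
  have hc0 : c = 0 := by
    have h1 : Tendsto (fun _ : ℍ ↦ c) atImInfty (𝓝 0) := hΔ.congr hq
    exact tendsto_const_nhds_iff.mp h1
  have := hq UpperHalfPlane.I
  rw [hc0, div_eq_zero_iff] at this
  exact this.elim (ModularForm.discriminant_ne_zero _) (hf0 _)

end

namespace PeriodPair

lemma G_eq_tsum_prod (L : PeriodPair) (n : ℕ) :
    L.G n = ∑' x : ℤ × ℤ, ((x.1 * L.ω₁ + x.2 * L.ω₂) ^ n)⁻¹ := by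
  rw [G, ← L.latticeEquivProd.symm.toEquiv.tsum_eq]
  refine tsum_congr fun x ↦ ?_
  rw [← L.latticeEquiv_symm_apply]
  rfl

/-- The pair of periods `c ω₁, c ω₂`. -/
def scale (L : PeriodPair) {c : ℂ} (hc : c ≠ 0) : PeriodPair where
  ω₁ := c * L.ω₁
  ω₂ := c * L.ω₂
  indep := by
    rw [LinearIndependent.pair_iff]
    intro x y h
    refine LinearIndependent.pair_iff.mp L.indep x y (mul_left_cancel₀ hc ?_)
    simp only [Complex.real_smul] at h ⊢
    linear_combination h

lemma G_scale (L : PeriodPair) {c : ℂ} (hc : c ≠ 0) (n : ℕ) :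
    (L.scale hc).G n = (c ^ n)⁻¹ * L.G n := by
  rw [G_eq_tsum_prod, G_eq_tsum_prod, ← tsum_mul_left]
  refine tsum_congr fun x ↦ ?_
  rw [← mul_inv, ← mul_pow, scale]
  congr 2
  ring

lemma mem_lattice_scale {L : PeriodPair} {c : ℂ} (hc : c ≠ 0) {z : ℂ} :
    c * z ∈ (L.scale hc).lattice ↔ z ∈ L.lattice := by
  rw [mem_lattice, mem_lattice]
  refine exists₂_congr fun m n ↦ ?_
  rw [← mul_right_inj' hc (c := z), scale]
  simp only [mul_add, mul_left_comm c]

lemma g₂_scale (L : PeriodPair) {c : ℂ} (hc : c ≠ 0) : (L.scale hc).g₂ = (c ^ 4)⁻¹ * L.g₂ := by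
  rw [g₂, g₂, G_scale]
  ring

lemma g₃_scale (L : PeriodPair) {c : ℂ} (hc : c ≠ 0) : (L.scale hc).g₃ = (c ^ 6)⁻¹ * L.g₃ := by
  rw [g₃, g₃, G_scale]
  ring

/-- The pair of periods `τ, 1`. -/
def ofUpperHalfPlane (τ : UpperHalfPlane) : PeriodPair where
  ω₁ := τ
  ω₂ := 1
  indep := by
    rw [LinearIndependent.pair_iff]
    intro x y h
    simp only [Complex.real_smul, mul_one] at h
    have him := congrArg Complex.im h
    have hre := congrArg Complex.re h
    simp [τ.im_ne_zero] at him
    simp [him] at hre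
    exact ⟨him, hre⟩

open EisensteinSeries ModularForm in
lemma G_ofUpperHalfPlane (τ : UpperHalfPlane) {k : ℕ} (hk : 3 ≤ k) :
    (ofUpperHalfPlane τ).G k = riemannZeta k * (2 * E hk τ) := by
  have h1 : 2 * E hk τ = eisensteinSeries (N := 1) 0 k τ := by
    change 2 * ((1 / 2 : ℂ) • eisensteinSeries (N := 1) 0 k τ) = _
    rw [smul_eq_mul]
    ring
  rw [h1, ← tsum_eisSummand_eq_riemannZeta_mul_eisensteinSeries hk, G_eq_tsum_prod,
    ← (finTwoArrowEquiv ℤ).symm.tsum_eq]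
  refine tsum_congr fun x ↦ ?_
  simp [ofUpperHalfPlane, eisSummand]

open ModularForm in
lemma g₂_ofUpperHalfPlane (τ : UpperHalfPlane) :
    (ofUpperHalfPlane τ).g₂ = 4 / 3 * Real.pi ^ 4 * E₄ τ := by
  rw [g₂, G_ofUpperHalfPlane τ (by norm_num : 3 ≤ 4)]
  have h := riemannZeta_two_mul_nat (k := 2) two_ne_zero
  norm_num [show _root_.bernoulli 4 = -1 / 30 by decide +kernel, Nat.factorial] at h
  norm_num [h]
  ring

open ModularForm in
lemma g₃_ofUpperHalfPlane (τ : UpperHalfPlane) :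
    (ofUpperHalfPlane τ).g₃ = 8 / 27 * Real.pi ^ 6 * E₆ τ := by
  rw [g₃, G_ofUpperHalfPlane τ (by norm_num : 3 ≤ 6)]
  have h := riemannZeta_two_mul_nat (k := 3) three_ne_zero
  norm_num [show _root_.bernoulli 6 = 1 / 42 by decide +kernel, Nat.factorial] at h
  norm_num [h]
  ring

lemma g₂_cube_sub_ne_zero (L : PeriodPair) : L.g₂ ^ 3 - 27 * L.g₃ ^ 2 ≠ 0 := by
  rw [L.discriminant_eq]
  exact mul_ne_zero (by norm_num) (pow_ne_zero _ (mul_ne_zero (mul_ne_zero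
    (L.e_sub_e_ne_zero (by decide) (by decide) (by decide))
    (L.e_sub_e_ne_zero (by decide) (by decide) (by decide)))
    (L.e_sub_e_ne_zero (by decide) (by decide) (by decide))))

/-- Every pair of numbers with non-zero discriminant is the pair of invariants of a lattice: the
ratio `g₂³ : g₃²` is realized by a lattice `ℤ τ + ℤ`, which is then scaled. -/
theorem exists_g₂_eq_and_g₃_eq {a b : ℂ} (hab : a ^ 3 - 27 * b ^ 2 ≠ 0) :
    ∃ L : PeriodPair, L.g₂ = a ∧ L.g₃ = b := by
  obtain ⟨τ, hτ⟩ := exists_mul_E₄_cube_eq (a := 27 * b ^ 2) (b := a ^ 3)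
    fun h ↦ hab (by rw [h, sub_self])
  set L := ofUpperHalfPlane τ with hL
  have hdisc := L.g₂_cube_sub_ne_zero
  have hx : L.g₂ = _ := g₂_ofUpperHalfPlane τ
  have hy : L.g₃ = _ := g₃_ofUpperHalfPlane τ
  have hrel : b ^ 2 * L.g₂ ^ 3 = a ^ 3 * L.g₃ ^ 2 := by
    rw [hx, hy]
    linear_combination (64 / 729 * (Real.pi : ℂ) ^ 12) * hτ
  clear_value L
  clear hx hy hτ
  suffices h : ∃ c : ℂ, c ≠ 0 ∧ L.g₂ = c ^ 4 * a ∧ L.g₃ = c ^ 6 * b by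
    obtain ⟨c, hc, h2, h3⟩ := h
    refine ⟨L.scale hc, ?_, ?_⟩
    · rw [g₂_scale, h2, inv_mul_cancel_left₀ (pow_ne_zero _ hc)]
    · rw [g₃_scale, h3, inv_mul_cancel_left₀ (pow_ne_zero _ hc)]
  by_cases ha : a = 0
  · subst ha
    have hb : b ≠ 0 := by
      rintro rfl
      simp at hab
    have h2 : L.g₂ = 0 := by simpa [hb] using hrel
    have h3 : L.g₃ ≠ 0 := by
      intro h3
      rw [h2, h3] at hdisc
      simp at hdisc
    obtain ⟨c, hc⟩ := IsAlgClosed.exists_pow_nat_eq (L.g₃ / b) (n := 6) (by norm_num)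
    refine ⟨c, ?_, by rw [h2, mul_zero], by rw [hc, div_mul_cancel₀ _ hb]⟩
    rintro rfl
    rw [eq_comm, zero_pow (by norm_num), div_eq_zero_iff] at hc
    exact hc.elim h3 hb
  by_cases hb : b = 0
  · subst hb
    have h3 : L.g₃ = 0 := by simpa [ha] using hrel.symm
    have h2 : L.g₂ ≠ 0 := by
      intro h2
      rw [h2, h3] at hdisc
      simp at hdisc
    obtain ⟨c, hc⟩ := IsAlgClosed.exists_pow_nat_eq (L.g₂ / a) (n := 4) (by norm_num)
    refine ⟨c, ?_, by rw [hc, div_mul_cancel₀ _ ha], by rw [h3, mul_zero]⟩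
    rintro rfl
    rw [eq_comm, zero_pow (by norm_num), div_eq_zero_iff] at hc
    exact hc.elim h2 ha
  have h2 : L.g₂ ≠ 0 := by
    intro h2
    have h3 : L.g₃ = 0 := by simpa [ha, h2] using hrel.symm
    rw [h2, h3] at hdisc
    simp at hdisc
  have h3 : L.g₃ ≠ 0 := by
    intro h3
    exact h2 (by simpa [hb, h3] using hrel)
  obtain ⟨c, hc⟩ := IsAlgClosed.exists_pow_nat_eq (L.g₃ * a / (b * L.g₂)) (n := 2) (by norm_num)
  have hc4 : L.g₂ = c ^ 4 * a := by
    rw [show c ^ 4 = (c ^ 2) ^ 2 by ring, hc]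
    field_simp
    linear_combination hrel
  refine ⟨c, ?_, hc4, ?_⟩
  · rintro rfl
    exact h2 (by rw [hc4]; ring)
  · rw [show c ^ 6 * b = c ^ 4 * a * c ^ 2 * b / a by field_simp, ← hc4, hc]
    field_simp

end PeriodPair

/-! ### The lattice is determined by its invariants -/

namespace PeriodPair

open scoped PeriodPair ComplexConjugate

variable {L M : PeriodPair}

lemma tsum_lattice_congr (h : M.lattice = L.lattice) (f : ℂ → ℂ) :
    ∑' l : M.lattice, f l = ∑' l : L.lattice, f l := by
  rw [h]

lemma G_congr (h : M.lattice = L.lattice) : M.G = L.G := by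
  funext n
  exact tsum_lattice_congr h fun l ↦ (l ^ n)⁻¹

lemma g₂_congr (h : M.lattice = L.lattice) : M.g₂ = L.g₂ := by
  rw [g₂, g₂, G_congr h]

lemma g₃_congr (h : M.lattice = L.lattice) : M.g₃ = L.g₃ := by
  rw [g₃, g₃, G_congr h]

/-- `℘` has a pole at each lattice point. -/
lemma not_eventuallyEq_weierstrassP {l : ℂ} (hl : l ∈ L.lattice) {f : ℂ → ℂ}
    (hf : ContinuousAt f l) : ¬ ℘[L] =ᶠ[𝓝[≠] l] f := by
  intro h
  have h1 : Tendsto (fun z : ℂ ↦ z ^ 2 * f (z + l)) (𝓝[≠] 0) (𝓝 0) := by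
    have h2 : ContinuousAt (fun z : ℂ ↦ z ^ 2 * f (z + l)) 0 := by
      have : ContinuousAt (fun z : ℂ ↦ f (z + l)) 0 :=
        ContinuousAt.comp (f := fun z : ℂ ↦ z + l) (g := f) (by rwa [zero_add]) (by fun_prop)
      exact (continuousAt_id.pow 2).mul this
    have h3 := h2.tendsto
    simp only [ne_eq, OfNat.ofNat_ne_zero, not_false_eq_true, zero_pow, zero_mul] at h3
    exact h3.mono_left nhdsWithin_le_nhds
  have hadd : Tendsto (fun z : ℂ ↦ z + l) (𝓝[≠] 0) (𝓝[≠] l) := by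
    refine tendsto_nhdsWithin_of_tendsto_nhds_of_eventually_within _ ?_ ?_
    · have : Tendsto (fun z : ℂ ↦ z + l) (𝓝 0) (𝓝 (0 + l)) :=
        (by fun_prop : ContinuousAt (fun z : ℂ ↦ z + l) 0)
      rw [zero_add] at this
      exact this.mono_left nhdsWithin_le_nhds
    · filter_upwards [self_mem_nhdsWithin] with z hz h
      exact hz (by simpa using h)
  have h4 := L.tendsto_sq_mul_weierstrassP.congr' (f₂ := fun z : ℂ ↦ z ^ 2 * f (z + l)) (by
    filter_upwards [hadd.eventually h] with z hz
    rw [← hz, L.weierstrassP_add_mem hl])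
  exact one_ne_zero (tendsto_nhds_unique h4 h1)

/-- The cubic `4 x³ - g₂ x - g₃`, as a degenerate quartic form. -/
def cubicForm (L : PeriodPair) : QuarticForm ℂ := ⟨0, 1, 0, -L.g₂ / 4, -L.g₃⟩

lemma eval_cubicForm (L : PeriodPair) (x : ℂ) :
    L.cubicForm.poly.eval x = 4 * x ^ 3 - L.g₂ * x - L.g₃ := by
  rw [QuarticForm.eval_poly, cubicForm]
  ring

/-- Two lattices with the same invariants have `℘`-functions which satisfy the same differential
equation, hence agree up to a translation; comparison of the poles shows that the translation is
trivial. -/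
lemma lattice_le_of_invariants_eq (h2 : L.g₂ = M.g₂) (h3 : L.g₃ = M.g₃) :
    L.lattice ≤ M.lattice := by
  have hcub : M.cubicForm = L.cubicForm := by rw [cubicForm, cubicForm, h2, h3]
  obtain ⟨a, ha, ha0⟩ : ∃ a, a ∉ L.lattice ∧ ℘'[L] a ≠ 0 := by
    have h4 : L.ω₁ / 4 * 2 ∉ L.lattice := by
      rw [show L.ω₁ / 4 * 2 = L.ω₁ / 2 by ring]
      exact L.ω₁_div_two_notMem_lattice
    have h5 : L.ω₁ / 4 ∉ L.lattice := fun h ↦ h4 (by rw [mul_two]; exact add_mem h h)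
    exact ⟨_, h5, (L.derivWeierstrassP_eq_zero_iff h5).not.mpr (by rwa [mul_comm])⟩
  obtain ⟨b, hb, hb0, hb1⟩ : ∃ b, b ∉ M.lattice ∧ ℘[M] b = ℘[L] a ∧ ℘'[M] b = ℘'[L] a := by
    obtain ⟨b, hb, hb0⟩ := M.exists_weierstrassP_eq (℘[L] a)
    have h4 : ℘'[M] b ^ 2 = ℘'[L] a ^ 2 := by
      rw [M.derivWeierstrassP_sq b hb, L.derivWeierstrassP_sq a ha, hb0, h2, h3]
    rcases sq_eq_sq_iff_eq_or_eq_neg.mp h4 with h | h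
    · exact ⟨b, hb, hb0, h⟩
    · exact ⟨-b, M.neg_notMem hb, by rw [M.weierstrassP_neg, hb0],
        by rw [M.derivWeierstrassP_neg, h, neg_neg]⟩
  have hab : a - (a - b) = b := by ring
  have hderiv {u : ℂ} (hu : u - (a - b) ∉ M.lattice) :
      HasDerivAt (fun u ↦ ℘[M] (u - (a - b))) (℘'[M] (u - (a - b))) u :=
    (M.hasDerivAt_weierstrassP hu).comp_sub_const u (a - b)
  have hloc : ℘[L] =ᶠ[𝓝 a] fun u ↦ ℘[M] (u - (a - b)) := by
    refine QuarticForm.eventuallyEq_of_deriv_sq_eq L.cubicForm (L.analyticAt_weierstrassP ha) ?_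
      ?_ ?_ ?_ ?_ ?_
    · exact (M.analyticAt_weierstrassP (z := a - (a - b)) (by rwa [hab])).comp
        (f := fun u ↦ u - (a - b)) (by fun_prop)
    · filter_upwards [L.isOpen_compl_lattice.mem_nhds ha] with u hu
      rw [(L.hasDerivAt_weierstrassP hu).deriv, L.derivWeierstrassP_sq u hu, eval_cubicForm]
    · have h4 : ∀ᶠ u in 𝓝 a, u - (a - b) ∉ M.lattice :=
        (by fun_prop : ContinuousAt (fun u ↦ u - (a - b)) a).tendsto.eventually
          (M.isOpen_compl_lattice.mem_nhds (by rwa [hab]))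
      filter_upwards [h4] with u hu
      rw [(hderiv hu).deriv, M.derivWeierstrassP_sq _ hu, ← hcub, eval_cubicForm]
    · rw [hab, hb0]
    · rw [(L.hasDerivAt_weierstrassP ha).deriv, (hderiv (by rwa [hab])).deriv, hab, hb1]
    · rw [(hderiv (by rwa [hab])).deriv, hab, hb1]
      exact ha0
  have hglob := MeromorphicOn.eventuallyEq_codiscreteWithin isPreconnected_univ
    (f := ℘[L]) (g := fun u ↦ ℘[M] (u - (a - b))) (fun u _ ↦ L.meromorphic_weierstrassP u)
    (fun u _ ↦ (M.meromorphic_weierstrassP (u - (a - b))).comp_analyticAt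
      (f := ℘[M]) (g := fun u ↦ u - (a - b)) (by fun_prop)) (Set.mem_univ a) hloc
  have key {l : ℂ} (hl : l ∈ L.lattice) : l - (a - b) ∈ M.lattice := by
    by_contra hcon
    exact not_eventuallyEq_weierstrassP hl (hderiv hcon).continuousAt
      (eventually_nhdsNE_of_codiscreteWithin isOpen_univ hglob (Set.mem_univ l))
  intro l hl
  have := sub_mem (key hl) (key (zero_mem _))
  rwa [sub_sub_sub_cancel_right, sub_zero] at this

theorem lattice_eq_of_invariants_eq (h2 : L.g₂ = M.g₂) (h3 : L.g₃ = M.g₃) :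
    L.lattice = M.lattice :=
  le_antisymm (lattice_le_of_invariants_eq h2 h3) (lattice_le_of_invariants_eq h2.symm h3.symm)

/-! ### Complex conjugation -/

/-- The pair of complex conjugate periods. -/
def conjPair (L : PeriodPair) : PeriodPair where
  ω₁ := conj L.ω₁
  ω₂ := conj L.ω₂
  indep := by
    rw [LinearIndependent.pair_iff]
    intro x y h
    refine LinearIndependent.pair_iff.mp L.indep x y ((starRingEnd ℂ).injective ?_)
    simpa using h

lemma G_conjPair (L : PeriodPair) (n : ℕ) : L.conjPair.G n = conj (L.G n) := by
  rw [G_eq_tsum_prod, G_eq_tsum_prod, Complex.conj_tsum]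
  refine tsum_congr fun x ↦ ?_
  simp [conjPair]

/-- A lattice with real invariants is invariant under complex conjugation. -/
lemma conj_mem_lattice (h2 : conj L.g₂ = L.g₂) (h3 : conj L.g₃ = L.g₃) {z : ℂ}
    (hz : z ∈ L.lattice) : conj z ∈ L.lattice := by
  have h4 : L.conjPair.lattice = L.lattice := by
    refine lattice_eq_of_invariants_eq ?_ ?_
    · rw [← h2, g₂, g₂, G_conjPair, map_mul, map_ofNat]
    · rw [← h3, g₃, g₃, G_conjPair, map_mul, map_ofNat]
  rw [← h4]
  obtain ⟨m, n, rfl⟩ := mem_lattice.mp hz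
  exact mem_lattice.mpr ⟨m, n, by simp [conjPair]⟩

variable (hconj : ∀ z ∈ L.lattice, conj z ∈ L.lattice)
include hconj

lemma conj_notMem {z : ℂ} (hz : z ∉ L.lattice) : conj z ∉ L.lattice :=
  fun h ↦ hz (by simpa using hconj _ h)

lemma tsum_conj_lattice (f : ℂ → ℂ) : ∑' l : L.lattice, f (conj (l : ℂ)) = ∑' l : L.lattice, f l := by
  let e : L.lattice ≃ L.lattice :=
    { toFun l := ⟨conj (l : ℂ), hconj _ l.2⟩
      invFun l := ⟨conj (l : ℂ), hconj _ l.2⟩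
      left_inv l := by simp
      right_inv l := by simp }
  exact e.tsum_eq fun l : L.lattice ↦ f l

lemma weierstrassP_conj (z : ℂ) : ℘[L] (conj z) = conj (℘[L] z) := by
  rw [weierstrassP, weierstrassP, Complex.conj_tsum,
    ← tsum_conj_lattice hconj fun l ↦ 1 / (conj z - l) ^ 2 - 1 / l ^ 2]
  refine tsum_congr fun l ↦ ?_
  simp

lemma derivWeierstrassP_conj (z : ℂ) : ℘'[L] (conj z) = conj (℘'[L] z) := by
  rw [derivWeierstrassP, derivWeierstrassP, map_neg, Complex.conj_tsum,
    ← tsum_conj_lattice hconj fun l ↦ 2 / (conj z - l) ^ 3]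
  congr 1
  refine tsum_congr fun l ↦ ?_
  simp [map_ofNat]

/-- The difference of the two sides is an odd function with derivative zero. -/
lemma weierstrassZeta_conj (z : ℂ) : L.weierstrassZeta (conj z) = conj (L.weierstrassZeta z) := by
  by_cases hz : z ∈ L.lattice
  · rw [L.weierstrassZeta_of_mem hz, L.weierstrassZeta_of_mem (hconj _ hz), map_zero]
  set f : ℂ → ℂ := fun u ↦ conj (L.weierstrassZeta (conj u)) - L.weierstrassZeta u with hf
  have hd : ∀ u ∉ L.lattice, HasDerivAt f 0 u := by
    intro u hu
    have h1 := (L.hasDerivAt_weierstrassZeta (conj_notMem hconj hu)).conj_conj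
    rw [Complex.conj_conj] at h1
    have h2 := h1.sub (L.hasDerivAt_weierstrassZeta hu)
    rw [map_neg, weierstrassP_conj hconj, Complex.conj_conj, sub_self] at h2
    exact h2
  have hconst := L.isOpen_compl_lattice.exists_is_const_of_deriv_eq_zero
    L.isPreconnected_compl_lattice (f := f)
    (fun u hu ↦ (hd u hu).differentiableAt.differentiableWithinAt) (fun u hu ↦ (hd u hu).deriv)
  obtain ⟨c, hc⟩ := hconst
  have h1 := hc z hz
  have h2 := hc (-z) (L.neg_notMem hz)
  simp only [hf, map_neg, weierstrassZeta_neg] at h1 h2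
  have h3 : conj (L.weierstrassZeta (conj z)) = L.weierstrassZeta z := by
    linear_combination (h1 - h2) / 2
  rw [← h3, Complex.conj_conj]

end PeriodPair

/-! ### Lattices invariant under conjugation -/

namespace PeriodPair

open scoped PeriodPair ComplexConjugate

/-- The rectangular pair of periods `2 ω, 2 ω' i`. -/
def rectPair {ω ω' : ℝ} (hω : 0 < ω) (hω' : 0 < ω') : PeriodPair where
  ω₁ := 2 * ω
  ω₂ := 2 * ω' * Complex.I
  indep := by
    rw [LinearIndependent.pair_iff]
    intro x y h
    have hre := congrArg Complex.re h
    have him := congrArg Complex.im h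
    simp at hre him
    exact ⟨hre.resolve_right hω.ne', him.resolve_right hω'.ne'⟩

/-- The rhombic pair of periods `ω - ω' i, ω + ω' i`. -/
def rhombPair {ω ω' : ℝ} (hω : 0 < ω) (hω' : 0 < ω') : PeriodPair where
  ω₁ := ω - ω' * Complex.I
  ω₂ := ω + ω' * Complex.I
  indep := by
    rw [LinearIndependent.pair_iff]
    intro x y h
    have hre := congrArg Complex.re h
    have him := congrArg Complex.im h
    simp at hre him
    have h1 : x + y = 0 := by
      have : (x + y) * ω = 0 := by linear_combination hre
      exact (mul_eq_zero.mp this).resolve_right hω.ne'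
    have h2 : y - x = 0 := by
      have : (y - x) * ω' = 0 := by linear_combination him
      exact (mul_eq_zero.mp this).resolve_right hω'.ne'
    constructor <;> linarith

variable {ω ω' : ℝ} (hω : 0 < ω) (hω' : 0 < ω')

lemma mem_rectPair {z : ℂ} : z ∈ (rectPair hω hω').lattice ↔
    ∃ m n : ℤ, z.re = 2 * m * ω ∧ z.im = 2 * n * ω' := by
  rw [mem_lattice]
  refine exists₂_congr fun m n ↦ ?_
  have h1 : (m * (rectPair hω hω').ω₁ + n * (rectPair hω hω').ω₂).re = 2 * m * ω := by
    simp [rectPair]; ring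
  have h2 : (m * (rectPair hω hω').ω₁ + n * (rectPair hω hω').ω₂).im = 2 * n * ω' := by
    simp [rectPair]; ring
  rw [eq_comm, Complex.ext_iff, h1, h2]

lemma mem_rhombPair {z : ℂ} : z ∈ (rhombPair hω hω').lattice ↔
    ∃ m n : ℤ, Even (m + n) ∧ z.re = m * ω ∧ z.im = n * ω' := by
  rw [mem_lattice]
  constructor
  · rintro ⟨m, n, rfl⟩
    refine ⟨m + n, n - m, ⟨n, by ring⟩, ?_, ?_⟩
    · simp [rhombPair]; ring
    · simp [rhombPair]; ring
  · rintro ⟨m, n, ⟨k, hk⟩, hre, him⟩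
    refine ⟨m - k, k, ?_⟩
    have hn : (n : ℝ) = 2 * k - m := by
      have : (m : ℝ) + n = k + k := by exact_mod_cast hk
      linarith
    rw [Complex.ext_iff, hre, him, hn]
    constructor
    · simp [rhombPair]; ring
    · simp [rhombPair]; ring

lemma ofReal_mem_rectPair {x : ℝ} :
    (x : ℂ) ∈ (rectPair hω hω').lattice ↔ ∃ n : ℤ, x = 2 * n * ω := by
  rw [mem_rectPair]
  exact ⟨fun ⟨m, _, h, _⟩ ↦ ⟨m, h⟩, fun ⟨m, h⟩ ↦ ⟨m, 0, h, by simp⟩⟩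

lemma ofReal_mul_I_mem_rectPair {x : ℝ} :
    (x * Complex.I : ℂ) ∈ (rectPair hω hω').lattice ↔ ∃ n : ℤ, x = 2 * n * ω' := by
  rw [mem_rectPair]
  exact ⟨fun ⟨_, n, _, h⟩ ↦ ⟨n, by simpa using h⟩, fun ⟨n, h⟩ ↦ ⟨0, n, by simp, by simpa using h⟩⟩

lemma ofReal_mem_rhombPair {x : ℝ} :
    (x : ℂ) ∈ (rhombPair hω hω').lattice ↔ ∃ n : ℤ, x = 2 * n * ω := by
  rw [mem_rhombPair]
  constructor
  · rintro ⟨m, n, ⟨k, hk⟩, h1, h2⟩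
    have hn : n = 0 := by simpa [hω'.ne'] using h2
    refine ⟨k, ?_⟩
    rw [hn, add_zero] at hk
    rw [Complex.ofReal_re, hk] at h1
    push_cast at h1
    linear_combination h1
  · rintro ⟨n, rfl⟩
    exact ⟨2 * n, 0, by simp, by simp, by simp⟩

lemma ofReal_mul_I_mem_rhombPair {x : ℝ} :
    (x * Complex.I : ℂ) ∈ (rhombPair hω hω').lattice ↔ ∃ n : ℤ, x = 2 * n * ω' := by
  rw [mem_rhombPair]
  constructor
  · rintro ⟨m, n, ⟨k, hk⟩, h1, h2⟩
    have hm : m = 0 := by simpa [hω.ne'] using h1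
    refine ⟨k, ?_⟩
    rw [hm, zero_add] at hk
    rw [hk] at h2
    push_cast at h2
    simp at h2
    linear_combination h2
  · rintro ⟨n, rfl⟩
    exact ⟨0, 2 * n, by simp, by simp, by simp⟩

lemma conj_mem_rectPair {z : ℂ} (hz : z ∈ (rectPair hω hω').lattice) :
    conj z ∈ (rectPair hω hω').lattice := by
  rw [mem_rectPair] at hz ⊢
  obtain ⟨m, n, h1, h2⟩ := hz
  exact ⟨m, -n, by simpa using h1, by simp [h2]⟩

lemma conj_mem_rhombPair {z : ℂ} (hz : z ∈ (rhombPair hω hω').lattice) :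
    conj z ∈ (rhombPair hω hω').lattice := by
  rw [mem_rhombPair] at hz ⊢
  obtain ⟨m, n, h0, h1, h2⟩ := hz
  exact ⟨m, -n, by rwa [← sub_eq_add_neg, Int.even_sub, ← Int.even_add], by simpa using h1,
    by simp [h2]⟩

/-- The points of a lattice on a real line through the origin that contains one of its non-zero
points. -/
lemma exists_ofReal_mul_mem_iff (L : PeriodPair) {d : ℂ} (hd : d ≠ 0)
    (h : ∃ x : ℝ, x ≠ 0 ∧ (x : ℂ) * d ∈ L.lattice) :
    ∃ p : ℝ, 0 < p ∧ ∀ x : ℝ, (x : ℂ) * d ∈ L.lattice ↔ ∃ n : ℤ, x = 2 * n * p := by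
  let S : AddSubgroup ℝ :=
    { carrier := {x | (x : ℂ) * d ∈ L.lattice}
      add_mem' {a b} ha hb := by
        simpa [add_mul] using add_mem ha hb
      zero_mem' := by simp
      neg_mem' {a} ha := by
        have : (a : ℂ) * d ∈ L.lattice := ha
        simpa using neg_mem this }
  have hS (x : ℝ) : x ∈ S ↔ (x : ℂ) * d ∈ L.lattice := Iff.rfl
  rcases S.dense_or_cyclic with h1 | ⟨a, h1⟩
  · exfalso
    have hcl : IsClosed (S : Set ℝ) :=
      L.isClosed_lattice.preimage (f := fun x : ℝ ↦ (x : ℂ) * d) (by fun_prop)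
    have hall : (S : Set ℝ) = Set.univ := by rw [← hcl.closure_eq, h1.closure_eq]
    have hcount : (S : Set ℝ).Countable := by
      refine L.countable_lattice.preimage (f := fun x : ℝ ↦ (x : ℂ) * d) fun x y hxy ↦ ?_
      simpa [hd] using hxy
    rw [hall] at hcount
    exact Set.not_countable_univ hcount
  · have hmem (x : ℝ) : (x : ℂ) * d ∈ L.lattice ↔ ∃ n : ℤ, x = n * a := by
      rw [← hS, h1, AddSubgroup.mem_closure_singleton]
      simp [eq_comm]
    have ha : a ≠ 0 := by
      rintro rfl
      obtain ⟨x, hx, hx'⟩ := h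
      obtain ⟨n, hn⟩ := (hmem x).mp hx'
      exact hx (by simpa using hn)
    refine ⟨|a| / 2, by positivity, fun x ↦ ?_⟩
    rw [hmem]
    rcases abs_choice a with h2 | h2 <;> rw [h2]
    · exact exists_congr fun n ↦ by rw [show 2 * (n : ℝ) * (a / 2) = n * a by ring]
    · constructor
      · rintro ⟨n, hn⟩
        exact ⟨-n, by rw [hn]; push_cast; ring⟩
      · rintro ⟨n, hn⟩
        exact ⟨-n, by rw [hn]; push_cast; ring⟩

/-- A lattice invariant under conjugation is rectangular or rhombic. -/
lemma exists_lattice_eq_rectPair_or_rhombPair (L : PeriodPair)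
    (hconj : ∀ z ∈ L.lattice, conj z ∈ L.lattice) :
    ∃ (ω ω' : ℝ) (hω : 0 < ω) (hω' : 0 < ω'),
      (rectPair hω hω').lattice = L.lattice ∨ (rhombPair hω hω').lattice = L.lattice := by
  have hre {z : ℂ} (hz : z ∈ L.lattice) : ((2 * z.re : ℝ) : ℂ) * 1 ∈ L.lattice := by
    rw [mul_one, ← Complex.add_conj]
    exact add_mem hz (hconj z hz)
  have him {z : ℂ} (hz : z ∈ L.lattice) : ((2 * z.im : ℝ) : ℂ) * Complex.I ∈ L.lattice := by
    rw [← Complex.sub_conj]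
    exact sub_mem hz (hconj z hz)
  -- Not all periods are imaginary, and not all are real.
  have hex1 : ∃ x : ℝ, x ≠ 0 ∧ (x : ℂ) * 1 ∈ L.lattice := by
    by_contra! hcon
    have h1 : L.ω₁.re = 0 := by
      by_contra h; exact hcon _ (by simpa using h) (hre L.ω₁_mem_lattice)
    have h2 : L.ω₂.re = 0 := by
      by_contra h; exact hcon _ (by simpa using h) (hre L.ω₂_mem_lattice)
    have h3 := LinearIndependent.pair_iff.mp L.indep L.ω₂.im (-L.ω₁.im) (by
      apply Complex.ext <;> simp [h1, h2]; ring)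
    have h4 := LinearIndependent.pair_iff.mp L.indep 1 0 (by
      apply Complex.ext
      · simp [h1]
      · simpa using h3.2)
    exact one_ne_zero h4.1
  have hex2 : ∃ x : ℝ, x ≠ 0 ∧ (x : ℂ) * Complex.I ∈ L.lattice := by
    by_contra! hcon
    have h1 : L.ω₁.im = 0 := by
      by_contra h; exact hcon _ (by simpa using h) (him L.ω₁_mem_lattice)
    have h2 : L.ω₂.im = 0 := by
      by_contra h; exact hcon _ (by simpa using h) (him L.ω₂_mem_lattice)
    have h3 := LinearIndependent.pair_iff.mp L.indep L.ω₂.re (-L.ω₁.re) (by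
      apply Complex.ext <;> simp [h1, h2]; ring)
    have h4 := LinearIndependent.pair_iff.mp L.indep 1 0 (by
      apply Complex.ext
      · simpa using h3.2
      · simp [h1])
    exact one_ne_zero h4.1
  obtain ⟨ω, hω, hωL⟩ := L.exists_ofReal_mul_mem_iff one_ne_zero hex1
  obtain ⟨ω', hω', hωL'⟩ := L.exists_ofReal_mul_mem_iff Complex.I_ne_zero hex2
  refine ⟨ω, ω', hω, hω', ?_⟩
  have h1 (m : ℤ) : 2 * m * (ω : ℂ) ∈ L.lattice := by
    have := (hωL (2 * m * ω)).mpr ⟨m, rfl⟩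
    simpa using this
  have h2 (n : ℤ) : 2 * n * (ω' : ℂ) * Complex.I ∈ L.lattice := by
    have := (hωL' (2 * n * ω')).mpr ⟨n, rfl⟩
    simpa using this
  have hdec (z : ℂ) (hz : z ∈ L.lattice) : ∃ m n : ℤ, z.re = m * ω ∧ z.im = n * ω' := by
    obtain ⟨m, hm⟩ := (hωL _).mp (hre hz)
    obtain ⟨n, hn⟩ := (hωL' _).mp (him hz)
    exact ⟨m, n, by linarith, by linarith⟩
  have hpar (z : ℂ) (hz : z ∈ L.lattice) (m n : ℤ) (hm : z.re = m * ω) (hn : z.im = n * ω') :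
      Even m ↔ Even n := by
    constructor
    · rintro ⟨k, rfl⟩
      have h3 : ((n * ω' : ℝ) : ℂ) * Complex.I ∈ L.lattice := by
        have := sub_mem hz (h1 k)
        convert this using 1
        apply Complex.ext <;> simp [hm, hn]; ring
      obtain ⟨j, hj⟩ := (hωL' _).mp h3
      have h4 := mul_right_cancel₀ hω'.ne' hj
      exact ⟨j, by rw [← two_mul]; exact_mod_cast h4⟩
    · rintro ⟨k, rfl⟩
      have h3 : ((m * ω : ℝ) : ℂ) * 1 ∈ L.lattice := by
        have := sub_mem hz (h2 k)
        convert this using 1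
        apply Complex.ext <;> simp [hm, hn]; ring
      obtain ⟨j, hj⟩ := (hωL _).mp h3
      have h4 := mul_right_cancel₀ hω.ne' hj
      exact ⟨j, by rw [← two_mul]; exact_mod_cast h4⟩
  by_cases hodd : ∃ z ∈ L.lattice, ∃ m n : ℤ, z.re = m * ω ∧ z.im = n * ω' ∧ ¬ Even m
  · right
    obtain ⟨z, hz, m, n, hm, hn, hmo⟩ := hodd
    have hno : ¬ Even n := (hpar z hz m n hm hn).not.mp hmo
    obtain ⟨j, rfl⟩ := Int.not_even_iff_odd.mp hmo
    obtain ⟨k, rfl⟩ := Int.not_even_iff_odd.mp hno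
    have hc : (ω : ℂ) + ω' * Complex.I ∈ L.lattice := by
      have := sub_mem (sub_mem hz (h1 j)) (h2 k)
      convert this using 1
      apply Complex.ext <;> simp [hm, hn] <;> ring
    ext y
    rw [mem_rhombPair]
    constructor
    · rintro ⟨a, b, ⟨c, hab⟩, ha, hb⟩
      obtain rfl : a = c + c - b := by linarith
      have := add_mem (h1 (c - b)) (zsmul_mem hc b)
      convert this using 1
      apply Complex.ext
      · simp [ha]
        ring
      · simp [hb]
    · intro hy
      obtain ⟨a, b, ha, hb⟩ := hdec y hy
      exact ⟨a, b, Int.even_add.mpr (hpar y hy a b ha hb), ha, hb⟩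
  · left
    push Not at hodd
    ext y
    rw [mem_rectPair]
    constructor
    · rintro ⟨a, b, ha, hb⟩
      have := add_mem (h1 a) (h2 b)
      convert this using 1
      apply Complex.ext <;> simp [ha, hb]
    · intro hy
      obtain ⟨a, b, ha, hb⟩ := hdec y hy
      have hea := hodd y hy a b ha hb
      obtain ⟨b', rfl⟩ := (hpar y hy a b ha hb).mp hea
      obtain ⟨a', rfl⟩ := hea
      exact ⟨a', b', by rw [ha]; push_cast; ring, by rw [hb]; push_cast; ring⟩

/-- The least positive zero of `℘'` on the real axis is half the least positive real period. -/
lemma isLeastRealZero_of_mem_iff {L : PeriodPair} (hω : 0 < ω)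
    (h : ∀ x : ℝ, (x : ℂ) ∈ L.lattice ↔ ∃ n : ℤ, x = 2 * n * ω) : IsLeastRealZero L ω := by
  have hmem : (ω : ℂ) ∉ L.lattice := by
    rw [h]
    rintro ⟨n, hn⟩
    have h1 : (1 : ℝ) = 2 * n := mul_right_cancel₀ hω.ne' (by rw [one_mul]; exact hn)
    have h2 : (1 : ℤ) = 2 * n := by exact_mod_cast h1
    omega
  refine ⟨⟨hω, hmem, ?_⟩, ?_⟩
  · rw [L.derivWeierstrassP_eq_zero_iff hmem]
    have := (h (2 * ω)).mpr ⟨1, by simp⟩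
    simpa using this
  · rintro u ⟨hu, hu1, hu2⟩
    rw [L.derivWeierstrassP_eq_zero_iff hu1] at hu2
    obtain ⟨n, hn⟩ := (h (2 * u)).mp (by simpa using hu2)
    have h1 : u = n * ω := by linarith
    have h2 : 0 < n := by
      have : (0 : ℝ) < n := pos_of_mul_pos_left (h1 ▸ hu) hω.le
      exact_mod_cast this
    have h3 : (1 : ℝ) ≤ n := by exact_mod_cast h2
    rw [h1]
    nlinarith

/-- Changing the sign of `g₃` turns the lattice by a right angle. -/
lemma ofReal_mem_lattice_of_neg_g₃ {L M : PeriodPair} (h2 : M.g₂ = L.g₂) (h3 : M.g₃ = -L.g₃)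
    (x : ℝ) : (x : ℂ) ∈ M.lattice ↔ (x : ℂ) * Complex.I ∈ L.lattice := by
  have h : M.lattice = (L.scale Complex.I_ne_zero).lattice := by
    refine lattice_eq_of_invariants_eq ?_ ?_
    · rw [h2, g₂_scale]
      simp
    · rw [h3, g₃_scale, show (Complex.I ^ 6 : ℂ) = (Complex.I ^ 2) ^ 3 by ring, Complex.I_sq]
      norm_num
  have h4 : (x : ℂ) = Complex.I * -(x * Complex.I) := by
    linear_combination (x : ℂ) * Complex.I_sq
  conv_lhs => rw [h, h4]
  rw [mem_lattice_scale, neg_mem_iff]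

end PeriodPair

/-! ### Lines on which `℘` is real -/

/-- By Darboux's theorem a derivative without zeros has a constant sign, which is seen from two
values of the function. -/
lemma forall_deriv_neg_of_ne_zero {f f' : ℝ → ℝ} {s : Set ℝ} (hs : Convex ℝ s)
    (hf : ContinuousOn f s) (hd : ∀ t ∈ interior s, HasDerivAt f (f' t) t)
    (hne : ∀ t ∈ interior s, f' t ≠ 0) {x y : ℝ} (hx : x ∈ s) (hy : y ∈ s) (hxy : x < y)
    (hlt : f y < f x) : ∀ t ∈ interior s, f' t < 0 := by
  rcases hasDerivWithinAt_forall_lt_or_forall_gt_of_forall_ne hs.interior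
    (fun t ht ↦ (hd t ht).hasDerivWithinAt) hne with h | h
  · exact h
  · have h1 := strictMonoOn_of_deriv_pos hs hf fun t ht ↦ by rw [(hd t ht).deriv]; exact h t ht
    exact absurd hlt (h1 hx hy hxy).not_gt

namespace PeriodPair

open scoped PeriodPair ComplexConjugate

/-- The line `b + ℝ d` is horizontal or vertical (`d = 1` or `d = i`) and its reflection in the
real or the imaginary axis, respectively, is its translate by a period. For a lattice invariant
under conjugation `℘` is real on such a line. -/
def IsRealLine (L : PeriodPair) (b d : ℂ) : Prop :=
  (d = 1 ∧ conj b - b ∈ L.lattice) ∨ (d = Complex.I ∧ conj b + b ∈ L.lattice)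

namespace IsRealLine

variable {L : PeriodPair} {b d : ℂ}

lemma ne_zero (h : L.IsRealLine b d) : d ≠ 0 := by
  rcases h with ⟨rfl, -⟩ | ⟨rfl, -⟩
  exacts [one_ne_zero, Complex.I_ne_zero]

lemma conj_eq (hconj : ∀ z ∈ L.lattice, conj z ∈ L.lattice) (h : L.IsRealLine b d) (t : ℝ) :
    conj (℘[L] (b + t * d)) = ℘[L] (b + t * d) ∧
      conj (d ^ 3 * ℘'[L] (b + t * d)) = d ^ 3 * ℘'[L] (b + t * d) := by
  rw [map_mul, ← weierstrassP_conj hconj, ← derivWeierstrassP_conj hconj]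
  rcases h with ⟨rfl, h⟩ | ⟨rfl, h⟩
  · rw [show conj (b + t * 1) = b + t * 1 + (conj b - b) by simp; ring, L.weierstrassP_add_mem h,
      L.derivWeierstrassP_add_mem h]
    simp
  · rw [show conj (b + t * Complex.I) = -(b + t * Complex.I) + (conj b + b) by simp; ring,
      L.weierstrassP_add_mem h, L.derivWeierstrassP_add_mem h, L.weierstrassP_neg,
      L.derivWeierstrassP_neg]
    simp [Complex.I_pow_three]

lemma conj_sq (h : L.IsRealLine b d) : conj (d ^ 2) = d ^ 2 := by
  rcases h with ⟨rfl, -⟩ | ⟨rfl, -⟩ <;> simp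

lemma sq_mul_eq_re (hconj : ∀ z ∈ L.lattice, conj z ∈ L.lattice) (h : L.IsRealLine b d) (t : ℝ) :
    d ^ 2 * ℘[L] (b + t * d) = ((d ^ 2 * ℘[L] (b + t * d)).re : ℂ) := by
  rw [eq_comm, ← Complex.conj_eq_iff_re, map_mul, h.conj_sq, (h.conj_eq hconj t).1]

lemma cube_mul_eq_re (hconj : ∀ z ∈ L.lattice, conj z ∈ L.lattice) (h : L.IsRealLine b d) (t : ℝ) :
    d ^ 3 * ℘'[L] (b + t * d) = ((d ^ 3 * ℘'[L] (b + t * d)).re : ℂ) := by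
  rw [eq_comm, ← Complex.conj_eq_iff_re, (h.conj_eq hconj t).2]

lemma hasDerivAt {t : ℝ} (ht : b + t * d ∉ L.lattice) :
    HasDerivAt (fun t : ℝ ↦ (d ^ 2 * ℘[L] (b + t * d)).re) (d ^ 3 * ℘'[L] (b + t * d)).re t := by
  have h1 : HasDerivAt (fun z : ℂ ↦ d ^ 2 * ℘[L] (b + z * d)) (d ^ 3 * ℘'[L] (b + t * d)) t := by
    have h2 : HasDerivAt (fun z : ℂ ↦ b + z * d) d (t : ℂ) := by
      simpa using ((hasDerivAt_id (t : ℂ)).mul_const d).const_add b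
    have h3 := ((L.hasDerivAt_weierstrassP ht).comp (t : ℂ) h2).const_mul (d ^ 2)
    rwa [show d ^ 2 * (℘'[L] (b + t * d) * d) = d ^ 3 * ℘'[L] (b + t * d) by ring] at h3
  exact h1.real_of_complex

lemma deriv_ne_zero (hconj : ∀ z ∈ L.lattice, conj z ∈ L.lattice) (h : L.IsRealLine b d) {t : ℝ}
    (ht : b + t * d ∉ L.lattice) (ht2 : 2 * (b + t * d) ∉ L.lattice) :
    (d ^ 3 * ℘'[L] (b + t * d)).re ≠ 0 := by
  intro h0
  have h1 := h.cube_mul_eq_re hconj t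
  rw [h0, Complex.ofReal_zero, mul_eq_zero] at h1
  exact h1.elim (pow_ne_zero _ h.ne_zero) ((L.derivWeierstrassP_eq_zero_iff ht).not.mpr ht2)

end IsRealLine

section

variable {L : PeriodPair} (hconj : ∀ z ∈ L.lattice, conj z ∈ L.lattice) {b d : ℂ} {p : ℝ}
include hconj

/-- On a segment between half periods, `d² ℘(b + t d)` is strictly monotonic. -/
lemma line_deriv_pos (h : L.IsRealLine b d) (hp : 0 < p) (hmem : ∀ t : ℝ, b + t * d ∉ L.lattice)
    (hmem2 : ∀ t ∈ Set.Ioo 0 p, 2 * (b + t * d) ∉ L.lattice)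
    (hlt : (d ^ 2 * ℘[L] b).re < (d ^ 2 * ℘[L] (b + p * d)).re) :
    ∀ t ∈ Set.Ioo 0 p, 0 < (d ^ 3 * ℘'[L] (b + t * d)).re := by
  have hd (t : ℝ) := IsRealLine.hasDerivAt (hmem t)
  have h1 := forall_deriv_neg_of_ne_zero (convex_Icc 0 p)
    (f := fun t : ℝ ↦ -(d ^ 2 * ℘[L] (b + t * d)).re)
    (f' := fun t : ℝ ↦ -(d ^ 3 * ℘'[L] (b + t * d)).re)
    (fun t _ ↦ (hd t).neg.continuousAt.continuousWithinAt) (fun t _ ↦ (hd t).neg)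
    (fun t ht ↦ neg_ne_zero.mpr (h.deriv_ne_zero hconj (hmem t)
      (hmem2 t (by simpa using ht)))) (Set.left_mem_Icc.mpr hp.le) (Set.right_mem_Icc.mpr hp.le) hp
    (by
      rw [Complex.ofReal_zero, zero_mul, add_zero]
      exact neg_lt_neg hlt)
  intro t ht
  have := h1 t (by simpa using ht)
  linarith

lemma line_exists_eq (h : L.IsRealLine b d) (hp : 0 < p) (hmem : ∀ t : ℝ, b + t * d ∉ L.lattice)
    {c : ℝ} (hc1 : (d ^ 2 * ℘[L] b).re ≤ c) (hc2 : c ≤ (d ^ 2 * ℘[L] (b + p * d)).re) :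
    ∃ t ∈ Set.Icc 0 p, d ^ 2 * ℘[L] (b + t * d) = c := by
  have hd (t : ℝ) := IsRealLine.hasDerivAt (hmem t)
  obtain ⟨t, ht, h1⟩ := intermediate_value_Icc hp.le
    (f := fun t : ℝ ↦ (d ^ 2 * ℘[L] (b + t * d)).re)
    (fun t _ ↦ (hd t).continuousAt.continuousWithinAt) ⟨by simpa using hc1, hc2⟩
  exact ⟨t, ht, by rw [h.sq_mul_eq_re hconj]; exact congrArg _ h1⟩

omit hconj in
lemma tendsto_sq_mul_weierstrassP_line (hd : d ≠ 0) :
    Tendsto (fun t : ℝ ↦ (t : ℂ) ^ 2 * ℘[L] (t * d)) (𝓝[>] 0) (𝓝 (1 / d ^ 2)) := by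
  have h1 : Tendsto (fun t : ℝ ↦ (t : ℂ) * d) (𝓝[>] 0) (𝓝[≠] 0) := by
    refine tendsto_nhdsWithin_of_tendsto_nhds_of_eventually_within _ ?_ ?_
    · have : Tendsto (fun t : ℝ ↦ (t : ℂ) * d) (𝓝 0) (𝓝 ((0 : ℝ) * d)) :=
        (by fun_prop : ContinuousAt (fun t : ℝ ↦ (t : ℂ) * d) 0)
      rw [Complex.ofReal_zero, zero_mul] at this
      exact this.mono_left nhdsWithin_le_nhds
    · filter_upwards [self_mem_nhdsWithin] with t ht
      have : (t : ℂ) ≠ 0 := Complex.ofReal_ne_zero.mpr (ne_of_gt ht)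
      simp [this, hd]
  have h2 := (L.tendsto_sq_mul_weierstrassP.comp h1).div_const (d ^ 2)
  refine h2.congr fun t ↦ ?_
  simp only [Function.comp_apply]
  field_simp

omit hconj in
/-- On the real and the imaginary axis, `d² ℘(t d)` behaves like `t⁻²` near the origin. -/
lemma tendsto_axis (hd : d = 1 ∨ d = Complex.I) :
    Tendsto (fun t : ℝ ↦ (d ^ 2 * ℘[L] (t * d)).re) (𝓝[>] 0) atTop := by
  have hd0 : d ≠ 0 := by
    rcases hd with rfl | rfl
    exacts [one_ne_zero, Complex.I_ne_zero]
  have h1 := (tendsto_sq_mul_weierstrassP_line (L := L) hd0).const_mul (d ^ 2)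
  rw [mul_one_div_cancel (pow_ne_zero _ hd0)] at h1
  have h2 : Tendsto (fun t : ℝ ↦ (d ^ 2 * ((t : ℂ) ^ 2 * ℘[L] (t * d))).re) (𝓝[>] 0) (𝓝 1) :=
    (Complex.continuous_re.tendsto 1).comp h1
  have h3 : Tendsto (fun t : ℝ ↦ (t ^ 2)⁻¹) (𝓝[>] 0) atTop := by
    have := (tendsto_pow_atTop two_ne_zero).comp (tendsto_inv_nhdsGT_zero (𝕜 := ℝ))
    exact this.congr fun t ↦ by simp
  refine (h2.pos_mul_atTop one_pos h3).congr' ?_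
  filter_upwards [self_mem_nhdsWithin] with t ht
  have ht0 : t ≠ 0 := ne_of_gt ht
  have h4 : d ^ 2 * ((t : ℂ) ^ 2 * ℘[L] (t * d)) = ((t ^ 2 : ℝ) : ℂ) * (d ^ 2 * ℘[L] (t * d)) := by
    push_cast
    ring
  rw [h4, Complex.re_ofReal_mul]
  field_simp

omit hconj in
lemma axis_notMem (hp : 0 < p) (hL : ∀ x : ℝ, x * d ∈ L.lattice ↔ ∃ n : ℤ, x = 2 * n * p) {t : ℝ}
    (ht : t ∈ Set.Ioo 0 (2 * p)) : (t : ℂ) * d ∉ L.lattice := by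
  rw [hL]
  rintro ⟨n, rfl⟩
  have h1 : (0 : ℝ) < n := by
    have := ht.1
    by_contra! hn
    nlinarith
  have h2 : (n : ℝ) < 1 := by
    have := ht.2
    by_contra! hn
    nlinarith
  have h3 : 0 < n := by exact_mod_cast h1
  have h4 : n < 1 := by exact_mod_cast h2
  omega

omit hconj in
lemma isRealLine_axis (hd : d = 1 ∨ d = Complex.I) : L.IsRealLine 0 d := by
  rcases hd with rfl | rfl
  exacts [Or.inl ⟨rfl, by simp⟩, Or.inr ⟨rfl, by simp⟩]

/-- Every value beyond that at the half period is taken on the axis. -/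
lemma axis_exists_eq (hd : d = 1 ∨ d = Complex.I) (hp : 0 < p)
    (hL : ∀ x : ℝ, x * d ∈ L.lattice ↔ ∃ n : ℤ, x = 2 * n * p) {c : ℝ}
    (hc : (d ^ 2 * ℘[L] (p * d)).re ≤ c) : ∃ t ∈ Set.Ioc 0 p, d ^ 2 * ℘[L] (t * d) = c := by
  obtain ⟨t₀, ht₀, ht₀0, ht₀p⟩ := (((tendsto_axis (L := L) hd).eventually_ge_atTop c).and
    (Ioo_mem_nhdsGT hp)).exists
  have hder (t : ℝ) (ht : t ∈ Set.Icc t₀ p) := IsRealLine.hasDerivAt (L := L) (b := 0) (d := d)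
    (t := t) (by rw [zero_add]; exact axis_notMem hp hL ⟨by linarith [ht.1], by linarith [ht.2]⟩)
  simp only [zero_add] at hder
  obtain ⟨t, ht, h1⟩ := intermediate_value_Icc' ht₀p.le
    (f := fun t : ℝ ↦ (d ^ 2 * ℘[L] (t * d)).re)
    (fun t ht ↦ (hder t ht).continuousAt.continuousWithinAt) ⟨hc, ht₀⟩
  refine ⟨t, ⟨ht₀0.trans_le ht.1, ht.2⟩, ?_⟩
  have h2 := (isRealLine_axis (L := L) hd).sq_mul_eq_re hconj t
  rw [zero_add] at h2
  rw [h2]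
  exact congrArg _ h1

/-- The function tends to `+∞` at the origin and has no critical point before the half period. -/
lemma axis_deriv_neg (hd : d = 1 ∨ d = Complex.I) (hp : 0 < p)
    (hL : ∀ x : ℝ, x * d ∈ L.lattice ↔ ∃ n : ℤ, x = 2 * n * p) :
    ∀ t ∈ Set.Ioo 0 p, (d ^ 3 * ℘'[L] (t * d)).re < 0 := by
  obtain ⟨t₀, ht₀, ht₀0, ht₀p⟩ := (((tendsto_axis (L := L) hd).eventually_gt_atTop
    (d ^ 2 * ℘[L] (p * d)).re).and (Ioo_mem_nhdsGT hp)).exists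
  have hmem (t : ℝ) (ht : t ∈ Set.Ioc 0 p) : 0 + (t : ℂ) * d ∉ L.lattice := by
    rw [zero_add]; exact axis_notMem hp hL ⟨by linarith [ht.1], by linarith [ht.2]⟩
  have hder (t : ℝ) (ht : t ∈ Set.Ioc 0 p) := IsRealLine.hasDerivAt (hmem t ht)
  have hne (t : ℝ) (ht : t ∈ Set.Ioo 0 p) := (isRealLine_axis (L := L) hd).deriv_ne_zero hconj
    (hmem t ⟨ht.1, ht.2.le⟩) (by
      have := axis_notMem hp hL (t := 2 * t) ⟨by linarith [ht.1], by linarith [ht.2]⟩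
      rwa [zero_add, ← mul_assoc, show (2 : ℂ) * t = ((2 * t : ℝ) : ℂ) by push_cast; rfl])
  simp only [zero_add] at hder hne
  have h1 := forall_deriv_neg_of_ne_zero (convex_Ioc 0 p)
    (f := fun t : ℝ ↦ (d ^ 2 * ℘[L] (t * d)).re) (f' := fun t : ℝ ↦ (d ^ 3 * ℘'[L] (t * d)).re)
    (fun t ht ↦ (hder t ht).continuousAt.continuousWithinAt)
    (fun t ht ↦ hder t (interior_subset ht)) (fun t ht ↦ hne t (by simpa using ht))
    ⟨ht₀0, ht₀p.le⟩ ⟨hp, le_rfl⟩ ht₀p ht₀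
  simpa using h1

end

end PeriodPair

/-! ### The values at the half periods for rectangular and rhombic lattices -/

namespace PeriodPair

open scoped PeriodPair ComplexConjugate

lemma not_eq_two_mul_int_mul {p : ℝ} (hp : p ≠ 0) {n : ℤ} : ¬ p = 2 * n * p := by
  intro h
  have h1 : (1 : ℝ) = 2 * n := mul_right_cancel₀ hp (by rw [one_mul]; exact h)
  have h2 : (1 : ℤ) = 2 * n := by exact_mod_cast h1
  omega

section Rect

variable {ω ω' : ℝ} (hω : 0 < ω) (hω' : 0 < ω')

lemma halfPeriod_rectPair : (rectPair hω hω').halfPeriod 1 = ω ∧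
    (rectPair hω hω').halfPeriod 2 = ω + ω' * Complex.I ∧
    (rectPair hω hω').halfPeriod 3 = ω' * Complex.I := by
  rw [halfPeriod_one, halfPeriod_two, halfPeriod_three]
  refine ⟨?_, ?_, ?_⟩ <;> simp only [rectPair] <;> ring

lemma rectPair_axis {d : ℂ} {p : ℝ} (h : (d = 1 ∧ p = ω) ∨ (d = Complex.I ∧ p = ω')) :
    (d = 1 ∨ d = Complex.I) ∧ 0 < p ∧
      ∀ x : ℝ, x * d ∈ (rectPair hω hω').lattice ↔ ∃ n : ℤ, x = 2 * n * p := by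
  rcases h with ⟨rfl, rfl⟩ | ⟨rfl, rfl⟩
  · exact ⟨Or.inl rfl, hω, fun x ↦ by rw [mul_one]; exact ofReal_mem_rectPair hω hω'⟩
  · exact ⟨Or.inr rfl, hω', fun x ↦ ofReal_mul_I_mem_rectPair hω hω'⟩

lemma conj_mem_lattice_rectPair : ∀ z ∈ (rectPair hω hω').lattice,
    conj z ∈ (rectPair hω hω').lattice := fun _ ↦ conj_mem_rectPair hω hω'

/-- The sides of the half period rectangle that do not contain the origin. -/
lemma rectPair_side {b d : ℂ} {p : ℝ} (h : (b = ω' * Complex.I ∧ d = 1 ∧ p = ω) ∨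
    (b = ω ∧ d = Complex.I ∧ p = ω')) :
    (rectPair hω hω').IsRealLine b d ∧ 0 < p ∧
      (∀ t : ℝ, b + t * d ∉ (rectPair hω hω').lattice) ∧
      (∀ t ∈ Set.Ioo 0 p, 2 * (b + t * d) ∉ (rectPair hω hω').lattice) ∧
      b + p * d = ω + ω' * Complex.I := by
  have h2 {p : ℝ} (hp : 0 < p) {t : ℝ} (ht : t ∈ Set.Ioo 0 p) (n : ℤ) : ¬ 2 * t = 2 * n * p := by
    intro hn
    have h1 : (0 : ℝ) < n := by
      have := ht.1
      by_contra! hn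
      nlinarith
    have h2 : (n : ℝ) < 1 := by
      have := ht.2
      by_contra! hn
      nlinarith
    have h3 : 0 < n := by exact_mod_cast h1
    have h4 : n < 1 := by exact_mod_cast h2
    omega
  rcases h with ⟨rfl, rfl, rfl⟩ | ⟨rfl, rfl, rfl⟩
  · refine ⟨Or.inl ⟨rfl, ?_⟩, hω, fun t ↦ ?_, fun t ht ↦ ?_, by ring⟩
    · rw [mem_rectPair]
      exact ⟨0, -1, by simp, by simp; ring⟩
    · rw [mem_rectPair]
      rintro ⟨m, n, -, hn⟩
      exact not_eq_two_mul_int_mul hω'.ne' (n := n) (by simpa using hn)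
    · rw [mem_rectPair]
      rintro ⟨m, n, hm, -⟩
      exact h2 hω ht m (by simpa using hm)
  · refine ⟨Or.inr ⟨rfl, ?_⟩, hω', fun t ↦ ?_, fun t ht ↦ ?_, by ring⟩
    · rw [mem_rectPair]
      exact ⟨1, 0, by simp; ring, by simp⟩
    · rw [mem_rectPair]
      rintro ⟨m, n, hn, -⟩
      exact not_eq_two_mul_int_mul hω.ne' (n := m) (by simpa using hn)
    · rw [mem_rectPair]
      rintro ⟨m, n, -, hm⟩
      exact h2 hω' ht n (by simpa using hm)

/-- `℘` decreases from `e₁` to `e₂` and on to `e₃` along the sides of the half period rectangle: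
values beyond `e₁` and `e₃` are taken on the axes, so not at the remaining vertex. -/
lemma e_rectPair : ∃ e₁ e₂ e₃ : ℝ, (rectPair hω hω').e 1 = e₁ ∧ (rectPair hω hω').e 2 = e₂ ∧
    (rectPair hω hω').e 3 = e₃ ∧ e₂ < e₁ ∧ e₃ < e₂ := by
  set P := rectPair hω hω' with hP
  obtain ⟨h1, h2, h3⟩ := halfPeriod_rectPair hω hω'
  have hconj := conj_mem_lattice_rectPair hω hω'
  rw [← hP] at h1 h2 h3 hconj
  obtain ⟨hd1, -, hL1⟩ := rectPair_axis hω hω' (Or.inl ⟨rfl, rfl⟩)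
  obtain ⟨hd3, -, hL3⟩ := rectPair_axis hω hω' (Or.inr ⟨rfl, rfl⟩)
  have hr1 := (isRealLine_axis (L := P) hd1).conj_eq hconj ω
  have hr3 := (isRealLine_axis (L := P) hd3).conj_eq hconj ω'
  have hside := rectPair_side hω hω' (Or.inl ⟨rfl, rfl, rfl⟩)
  have hr2 := hside.1.conj_eq hconj ω
  rw [hside.2.2.2.2] at hr2
  have e1 : P.e 1 = ((P.e 1).re : ℂ) := by
    rw [eq_comm, ← Complex.conj_eq_iff_re, e, h1]
    simpa using hr1.1
  have e2 : P.e 2 = ((P.e 2).re : ℂ) := by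
    rw [eq_comm, ← Complex.conj_eq_iff_re, e, h2]
    exact hr2.1
  have e3 : P.e 3 = ((P.e 3).re : ℂ) := by
    rw [eq_comm, ← Complex.conj_eq_iff_re, e, h3]
    simpa using hr3.1
  have hn1 : (ω : ℂ) + ω' * Complex.I ∉ P.lattice := h2 ▸ P.halfPeriod_notMem (by decide)
  refine ⟨_, _, _, e1, e2, e3, ?_, ?_⟩
  · have hne : (P.e 1).re ≠ (P.e 2).re := by
      intro h
      exact P.e_sub_e_ne_zero (j := 1) (k := 2) (by decide) (by decide) (by decide)
        (by rw [e1, e2, h, sub_self])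
    refine lt_of_not_ge fun hle ↦ ?_
    obtain ⟨t, ht, h4⟩ := axis_exists_eq hconj hd1 hω hL1 (c := (P.e 2).re)
      (by rw [one_pow, one_mul, mul_one, ← h1]; exact hle)
    rw [← e2, e, h2, one_pow, one_mul, mul_one] at h4
    have ht' : (t : ℂ) ∉ P.lattice := by
      simpa using axis_notMem hω hL1 (t := t) ⟨ht.1, by linarith [ht.2]⟩
    rcases (P.weierstrassP_eq_iff ht' hn1).mp h4 with h5 | h5
    · obtain ⟨m, n, -, h6⟩ := (mem_rectPair hω hω').mp h5
      exact not_eq_two_mul_int_mul hω'.ne' (n := n) (by simpa using h6)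
    · obtain ⟨m, n, -, h6⟩ := (mem_rectPair hω hω').mp h5
      exact not_eq_two_mul_int_mul hω'.ne' (n := -n) (by
        simp at h6; push_cast; linarith)
  · have hne : (P.e 3).re ≠ (P.e 2).re := by
      intro h
      exact P.e_sub_e_ne_zero (j := 3) (k := 2) (by decide) (by decide) (by decide)
        (by rw [e3, e2, h, sub_self])
    refine lt_of_not_ge fun hle ↦ ?_
    obtain ⟨t, ht, h4⟩ := axis_exists_eq hconj hd3 hω' hL3 (c := -(P.e 2).re)
      (by rw [Complex.I_sq, ← h3]; simpa [e] using hle)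
    rw [Complex.ofReal_neg, ← e2, e, h2, Complex.I_sq, neg_one_mul, neg_inj] at h4
    have ht' := axis_notMem hω' hL3 (t := t) ⟨ht.1, by linarith [ht.2]⟩
    rcases (P.weierstrassP_eq_iff ht' hn1).mp h4 with h5 | h5
    · obtain ⟨m, n, h6, -⟩ := (mem_rectPair hω hω').mp h5
      exact not_eq_two_mul_int_mul hω.ne' (n := m) (by simpa using h6)
    · obtain ⟨m, n, h6, -⟩ := (mem_rectPair hω hω').mp h5
      exact not_eq_two_mul_int_mul hω.ne' (n := -m) (by
        simp at h6; push_cast; linarith)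

end Rect

section Rhomb

variable {ω ω' : ℝ} (hω : 0 < ω) (hω' : 0 < ω')

lemma halfPeriod_rhombPair : (rhombPair hω hω').halfPeriod 1 = (ω - ω' * Complex.I) / 2 ∧
    (rhombPair hω hω').halfPeriod 2 = ω ∧
    (rhombPair hω hω').halfPeriod 3 = (ω + ω' * Complex.I) / 2 := by
  rw [halfPeriod_one, halfPeriod_two, halfPeriod_three]
  refine ⟨?_, ?_, ?_⟩
  · simp only [rhombPair]
  · simp only [rhombPair]
    ring
  · simp only [rhombPair]

lemma rhombPair_axis {d : ℂ} {p : ℝ} (h : (d = 1 ∧ p = ω) ∨ (d = Complex.I ∧ p = ω')) :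
    (d = 1 ∨ d = Complex.I) ∧ 0 < p ∧
      ∀ x : ℝ, x * d ∈ (rhombPair hω hω').lattice ↔ ∃ n : ℤ, x = 2 * n * p := by
  rcases h with ⟨rfl, rfl⟩ | ⟨rfl, rfl⟩
  · exact ⟨Or.inl rfl, hω, fun x ↦ by rw [mul_one]; exact ofReal_mem_rhombPair hω hω'⟩
  · exact ⟨Or.inr rfl, hω', fun x ↦ ofReal_mul_I_mem_rhombPair hω hω'⟩

lemma conj_mem_lattice_rhombPair : ∀ z ∈ (rhombPair hω hω').lattice,
    conj z ∈ (rhombPair hω hω').lattice := fun _ ↦ conj_mem_rhombPair hω hω'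

/-- Both axes meet the half period `ω ≡ ω' i`. -/
lemma weierstrassP_axis_rhombPair {d : ℂ} {p : ℝ}
    (h : (d = 1 ∧ p = ω) ∨ (d = Complex.I ∧ p = ω')) :
    ℘[rhombPair hω hω'] (p * d) = (rhombPair hω hω').e 2 := by
  rw [e, (halfPeriod_rhombPair hω hω').2.1]
  rcases h with ⟨rfl, rfl⟩ | ⟨rfl, rfl⟩
  · rw [mul_one]
  · have h1 : (ω : ℂ) - p * Complex.I ∈ (rhombPair hω hω').lattice :=
      (rhombPair hω hω').ω₁_mem_lattice
    rw [← weierstrassP_add_mem _ h1]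
    congr 1
    ring

lemma conj_e_rhombPair : conj ((rhombPair hω hω').e 1) = (rhombPair hω hω').e 3 ∧
    conj ((rhombPair hω hω').e 2) = (rhombPair hω hω').e 2 := by
  obtain ⟨h1, h2, h3⟩ := halfPeriod_rhombPair hω hω'
  have hconj := conj_mem_lattice_rhombPair hω hω'
  rw [e, e, e, ← weierstrassP_conj hconj, ← weierstrassP_conj hconj, h1, h2, h3]
  simp [map_ofNat]

/-- The imaginary part of `℘` has no zero on the open diagonal from the origin to `ω + ω' i`, and
it is negative near the origin, as that of `z⁻²`. -/
lemma e_rhombPair_im_neg : ((rhombPair hω hω').e 3).im < 0 := by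
  set P := rhombPair hω hω' with hP
  have hconj := conj_mem_lattice_rhombPair hω hω'
  rw [← hP] at hconj
  set v : ℂ := ω + ω' * Complex.I with hv
  have hv0 : v ≠ 0 := by
    intro h
    have := congrArg Complex.re h
    simp [hv, hω.ne'] at this
  have hnot {t : ℝ} (ht : t ∈ Set.Ioo 0 1) (n : ℤ) : t ≠ n := by
    rintro rfl
    have h1 : 0 < n := by exact_mod_cast ht.1
    have h2 : n < 1 := by exact_mod_cast ht.2
    omega
  have hmem {t : ℝ} (ht : t ∈ Set.Ioo 0 1) : (t : ℂ) * v ∉ P.lattice := by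
    rw [mem_rhombPair]
    rintro ⟨m, n, -, hm, -⟩
    refine hnot ht m (mul_right_cancel₀ hω.ne' ?_)
    simpa [hv] using hm
  have hne {t : ℝ} (ht : t ∈ Set.Ioo 0 1) : (℘[P] (t * v)).im ≠ 0 := by
    intro h
    have h1 : ℘[P] (t * v) = ℘[P] (conj (t * v)) := by
      rw [weierstrassP_conj hconj]
      exact (Complex.conj_eq_iff_im.mpr h).symm
    rcases (P.weierstrassP_eq_iff (hmem ht) (conj_notMem hconj (hmem ht))).mp h1 with h2 | h2
    · rw [Complex.add_conj] at h2
      obtain ⟨n, hn⟩ := (ofReal_mem_rhombPair hω hω').mp h2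
      refine hnot ht n (mul_right_cancel₀ hω.ne' ?_)
      simp [hv] at hn
      linarith
    · rw [Complex.sub_conj] at h2
      obtain ⟨n, hn⟩ := (ofReal_mul_I_mem_rhombPair hω hω').mp h2
      refine hnot ht n (mul_right_cancel₀ hω'.ne' ?_)
      simp [hv] at hn
      linarith
  have hlim : Tendsto (fun t : ℝ ↦ ((t : ℂ) ^ 2 * ℘[P] (t * v)).im) (𝓝[>] 0)
      (𝓝 (1 / v ^ 2).im) :=
    (Complex.continuous_im.tendsto _).comp (tendsto_sq_mul_weierstrassP_line hv0)
  have hneg : (1 / v ^ 2).im < 0 := by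
    have h1 : 0 < Complex.normSq (v ^ 2) := Complex.normSq_pos.mpr (pow_ne_zero _ hv0)
    rw [one_div, Complex.inv_im, neg_div, neg_lt_zero]
    refine div_pos ?_ h1
    have h2 : (v ^ 2).im = 2 * (ω * ω') := by
      simp [hv, sq]
      ring
    rw [h2]
    positivity
  obtain ⟨t₀, ht₀, ht₀1⟩ := ((hlim.eventually_lt_const hneg).and
    (Ioo_mem_nhdsGT (zero_lt_one (α := ℝ)))).exists
  have ht₀2 : (℘[P] (t₀ * v)).im < 0 := by
    rw [← Complex.ofReal_pow, Complex.im_ofReal_mul] at ht₀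
    have : 0 < t₀ ^ 2 := pow_pos ht₀1.1 2
    by_contra! h
    exact absurd ht₀ (not_lt.mpr (mul_nonneg this.le h))
  have hcont : ContinuousOn (fun t : ℝ ↦ (℘[P] (t * v)).im) (Set.Ioo 0 1) := by
    intro t ht
    have h1 : ContinuousAt (fun t : ℝ ↦ ℘[P] (t * v)) t :=
      ContinuousAt.comp (f := fun t : ℝ ↦ (t : ℂ) * v)
        (P.hasDerivAt_weierstrassP (hmem ht)).continuousAt (by fun_prop)
    exact (Complex.continuous_im.continuousAt.comp h1).continuousWithinAt
  have hhalf : P.e 3 = ℘[P] (((1 / 2 : ℝ) : ℂ) * v) := by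
    rw [e, (halfPeriod_rhombPair hω hω').2.2]
    congr 1
    push_cast
    ring
  rw [hhalf]
  by_contra! hpos
  obtain ⟨t, ht, h0⟩ := isPreconnected_Ioo.intermediate_value (s := Set.Ioo (0 : ℝ) 1) ht₀1
    (b := 1 / 2) (by norm_num) hcont ⟨ht₀2.le, hpos⟩
  exact hne ht h0

end Rhomb

/-! ### The sign of the discriminant -/

section

variable {ω ω' : ℝ} (hω : 0 < ω) (hω' : 0 < ω')

/-- The numbers `e_j` are real, so the product of their differences has a positive square. -/
lemma discriminant_rectPair {a b : ℝ} (h2 : (rectPair hω hω').g₂ = a)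
    (h3 : (rectPair hω hω').g₃ = b) : 0 < a ^ 3 - 27 * b ^ 2 := by
  obtain ⟨e₁, e₂, e₃, h1', h2', h3', h12, h23⟩ := e_rectPair hω hω'
  have h := (rectPair hω hω').discriminant_eq
  rw [h2, h3, h1', h2', h3'] at h
  have h4 : a ^ 3 - 27 * b ^ 2 = 16 * ((e₁ - e₂) * (e₂ - e₃) * (e₃ - e₁)) ^ 2 := by
    exact_mod_cast h
  rw [h4]
  have : (e₁ - e₂) * (e₂ - e₃) * (e₃ - e₁) ≠ 0 :=
    mul_ne_zero (mul_ne_zero (by linarith) (by linarith)) (by linarith)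
  positivity

/-- Here `e₂` is real and `e₁, e₃` are conjugate, so the product of their differences is purely
imaginary. -/
lemma discriminant_rhombPair {a b : ℝ} (h2 : (rhombPair hω hω').g₂ = a)
    (h3 : (rhombPair hω hω').g₃ = b) : a ^ 3 - 27 * b ^ 2 < 0 := by
  obtain ⟨hc1, hc2⟩ := conj_e_rhombPair hω hω'
  have him := e_rhombPair_im_neg hω hω'
  have h := (rhombPair hω hω').discriminant_eq
  obtain ⟨e₂, he₂⟩ := Complex.conj_eq_iff_real.mp hc2
  have h1 : (rhombPair hω hω').e 1 = conj ((rhombPair hω hω').e 3) := by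
    rw [← hc1, Complex.conj_conj]
  rw [h2, h3, h1, he₂] at h
  set z := (rhombPair hω hω').e 3
  have h4 : (conj z - e₂) * (e₂ - z) * (z - conj z) =
      ((-Complex.normSq (z - e₂) * (2 * z.im) : ℝ) : ℂ) * Complex.I := by
    have h5 := Complex.mul_conj (z - e₂)
    rw [map_sub, Complex.conj_ofReal] at h5
    rw [Complex.sub_conj]
    push_cast at h5 ⊢
    linear_combination (-(2 * z.im * Complex.I)) * h5
  rw [h4, mul_pow, Complex.I_sq] at h
  have h5 : a ^ 3 - 27 * b ^ 2 = 16 * ((-Complex.normSq (z - e₂) * (2 * z.im)) ^ 2 * -1) := by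
    exact_mod_cast h
  have hz : z - e₂ ≠ 0 := by
    intro h
    have := congrArg Complex.im h
    simp at this
    exact him.ne this
  have h6 : Complex.normSq (z - e₂) ≠ 0 := (Complex.normSq_pos.mpr hz).ne'
  have h7 : -Complex.normSq (z - e₂) * (2 * z.im) ≠ 0 :=
    mul_ne_zero (neg_ne_zero.mpr h6) (mul_ne_zero two_ne_zero him.ne)
  have : 0 < (-Complex.normSq (z - e₂) * (2 * z.im)) ^ 2 := by positivity
  linarith

end

end PeriodPair

namespace PeriodPair

open scoped PeriodPair ComplexConjugate

/-- Conjugation permutes the functions `σ_j / σ` in the same way as the numbers `e_j`: the squares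
agree, and the sign is found at the origin. -/
lemma conj_sigmaRatio {L : PeriodPair} (hconj : ∀ z ∈ L.lattice, conj z ∈ L.lattice)
    {j k : Fin 4} (hj : j ≠ 0) (hk : k ≠ 0) (hjk : conj (L.e j) = L.e k) {z : ℂ}
    (hz : z ∉ L.lattice) : conj (L.sigmaRatio j (conj z)) = L.sigmaRatio k z := by
  have hsq : ∀ z ∉ L.lattice, conj (L.sigmaRatio j (conj z)) ^ 2 = L.sigmaRatio k z ^ 2 := by
    intro z hz
    rw [← map_pow, L.sigmaRatio_sq hj (conj_notMem hconj hz), L.sigmaRatio_sq hk hz, map_sub, hjk,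
      weierstrassP_conj hconj, Complex.conj_conj]
  have hlim (j : Fin 4) (hj : j ≠ 0) : Tendsto (fun z ↦ z * L.sigmaRatio j z) (𝓝[≠] 0) (𝓝 1) :=
    tendsto_mul_coRatio (L.halfPeriod_notMem hj)
  set S : Set ℂ := {z | z ∈ L.lattice ∨ L.sigmaRatio k z = 0} with hS
  have hsub : S ⊆ {z | 2 * z ∈ L.lattice} := by
    rintro z (hz | hz)
    · change 2 * z ∈ L.lattice
      rw [two_mul]; exact add_mem hz hz
    · by_cases hzL : z ∈ L.lattice
      · change 2 * z ∈ L.lattice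
        rw [two_mul]; exact add_mem hzL hzL
      have h1 := L.sigmaRatio_sq hk hzL
      rw [hz, zero_pow two_ne_zero, eq_comm, sub_eq_zero] at h1
      have h2 := L.two_mul_halfPeriod_mem k
      change 2 * z ∈ L.lattice
      rcases (L.weierstrassP_eq_iff hzL (L.halfPeriod_notMem hk)).mp h1 with h | h
      · have := sub_mem (add_mem h h) h2
        convert this using 1; ring
      · have := add_mem (add_mem h h) h2
        convert this using 1; ring
  by_cases hzS : z ∈ S
  · have h0 := hzS.resolve_left hz
    have := hsq z hz
    rw [h0, zero_pow two_ne_zero] at this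
    rw [h0]
    exact pow_eq_zero_iff two_ne_zero |>.mp this
  have hSL {z : ℂ} (hz : z ∉ S) : z ∉ L.lattice := fun h ↦ hz (Or.inl h)
  have hc (j : Fin 4) (hj : j ≠ 0) {z : ℂ} (hz : z ∉ L.lattice) :
      ContinuousAt (L.sigmaRatio j) z := continuousAt_coRatio (L.halfPeriod_notMem hj) hz
  refine eqOn_of_sq_eq (L.countable_two_mul.mono hsub) (n := 1) (a := 1) one_ne_zero
    (f := fun z ↦ conj (L.sigmaRatio j (conj z))) ?_ (fun z hz ↦ (hc k hk (hSL hz)).continuousWithinAt)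
    (fun z hz ↦ hsq z (hSL hz)) (fun z hz h ↦ hz (Or.inr h)) ?_ ?_ ?_ z hzS
  · intro z hz
    have h1 : ContinuousAt (fun z ↦ L.sigmaRatio j (conj z)) z :=
      ContinuousAt.comp (f := fun z : ℂ ↦ conj z) (hc j hj (conj_notMem hconj (hSL hz)))
        Complex.continuous_conj.continuousAt
    exact (Complex.continuous_conj.continuousAt.comp h1).continuousWithinAt
  · have := (tendsto_mul_nhdsNE_zero two_ne_zero).eventually L.eventually_notMem_nhdsNE
    filter_upwards [this] with z hz h
    exact hz (hsub h)
  · have h1 : Tendsto (fun z : ℂ ↦ conj z) (𝓝[≠] 0) (𝓝[≠] 0) := by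
      refine tendsto_nhdsWithin_of_tendsto_nhds_of_eventually_within _ ?_ ?_
      · have := Complex.continuous_conj.tendsto 0
        rw [map_zero] at this
        exact this.mono_left nhdsWithin_le_nhds
      · filter_upwards [self_mem_nhdsWithin] with z hz
        simpa using hz
    have h2 := (Complex.continuous_conj.tendsto 1).comp ((hlim j hj).comp h1)
    rw [map_one] at h2
    exact h2.congr fun z ↦ by simp
  · exact (hlim k hk).congr fun z ↦ by ring

end PeriodPair

/-! ### Real quartics -/

lemma Complex.im_eq_zero_of_sq_eq {z : ℂ} {r : ℝ} (h : z ^ 2 = r) (hr : 0 ≤ r) : z.im = 0 := by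
  have hre := congrArg Complex.re h
  have him := congrArg Complex.im h
  simp only [sq, Complex.mul_re, Complex.mul_im, Complex.ofReal_re, Complex.ofReal_im] at hre him
  rcases mul_eq_zero.mp (show z.re * z.im = 0 by linarith) with h0 | h0
  · rw [h0] at hre
    nlinarith [sq_nonneg z.im]
  · exact h0

lemma Complex.re_eq_zero_of_sq_eq {z : ℂ} {r : ℝ} (h : z ^ 2 = r) (hr : r ≤ 0) : z.re = 0 := by
  have h1 := Complex.im_eq_zero_of_sq_eq (z := Complex.I * z) (r := -r)
    (by rw [mul_pow, Complex.I_sq, h]; push_cast; ring) (by linarith)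
  simpa using h1

namespace QuarticForm

open scoped PeriodPair ComplexConjugate

variable {Q : QuarticForm ℝ} {d w : ℂ} {P : PeriodPair}

lemma toComplex_D_div : Q.toComplex.D / Q.toComplex.A = ((Q.D / Q.A : ℝ) : ℂ) := by
  simp [toComplex, D]

lemma toComplex_E : Q.toComplex.E = (Q.E : ℂ) := by
  simp [toComplex, E]

lemma toComplex_g₂ : Q.toComplex.g₂ = (Q.g₂ : ℂ) := by
  simp [toComplex, g₂]

lemma toComplex_g₃ : Q.toComplex.g₃ = (Q.g₃ : ℂ) := by
  simp [toComplex, g₃]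

lemma cubic_eq_sq_div (hA : Q.A ≠ 0) : 4 * (Q.D / Q.A) ^ 3 - Q.g₂ * (Q.D / Q.A) - Q.g₃ =
    Q.E ^ 2 / Q.A ^ 3 := by
  rw [D, E, g₂, g₃]
  field_simp
  ring

/-- `√A = √|A| d` and `A = |A| d²`, where `d = 1` or `d = i` according to the sign of `A`. -/
lemma rootA_eq (hd : (0 < Q.A ∧ d = 1) ∨ (Q.A < 0 ∧ d = Complex.I)) :
    Q.rootA = Real.sqrt |Q.A| * d ∧ (Q.A : ℂ) = (|Q.A| : ℝ) * d ^ 2 := by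
  rcases hd with ⟨h, rfl⟩ | ⟨h, rfl⟩
  · rw [rootA, if_pos h, abs_of_pos h]
    simp
  · rw [rootA, if_neg h.not_gt, abs_of_neg h]
    refine ⟨mul_comm _ _, ?_⟩
    simp

lemma rootA_sq (hd : (0 < Q.A ∧ d = 1) ∨ (Q.A < 0 ∧ d = Complex.I)) :
    Q.rootA ^ 2 = Q.toComplex.A := by
  change _ = (Q.A : ℂ)
  rw [(rootA_eq hd).1, (rootA_eq hd).2, mul_pow, ← Complex.ofReal_pow, Real.sq_sqrt (abs_nonneg _)]

lemma ne_zero_of_sign (hd : (0 < Q.A ∧ d = 1) ∨ (Q.A < 0 ∧ d = Complex.I)) :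
    Q.A ≠ 0 ∧ Q.toComplex.A ≠ 0 ∧ d ≠ 0 := by
  have h : Q.A ≠ 0 := by
    rcases hd with ⟨h, -⟩ | ⟨h, -⟩
    exacts [h.ne', h.ne]
  refine ⟨h, Complex.ofReal_ne_zero.mpr h, ?_⟩
  rcases hd with ⟨-, rfl⟩ | ⟨-, rfl⟩
  exacts [one_ne_zero, Complex.I_ne_zero]

/-- `E` is a negative multiple of `d³ ℘'(w)`. -/
lemma exists_E_eq (hd : (0 < Q.A ∧ d = 1) ∨ (Q.A < 0 ∧ d = Complex.I)) :
    ∃ κ : ℝ, 0 < κ ∧ ∀ w, Q.toComplex.IsParameter Q.rootA P w →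
      Q.E = -κ * (d ^ 3 * ℘'[P] w).re := by
  obtain ⟨hA, hA', hd0⟩ := ne_zero_of_sign hd
  refine ⟨|Q.A| * Real.sqrt |Q.A|, by positivity, fun w hw ↦ ?_⟩
  have h1 := hw.2.2
  have hs0 := root_ne_zero_of_sq hA' (rootA_sq hd)
  rw [toComplex_E, eq_div_iff (mul_ne_zero hA' hs0)] at h1
  change _ * ((Q.A : ℂ) * _) = _ at h1
  rw [(rootA_eq hd).1, (rootA_eq hd).2] at h1
  have h2 : (Q.E : ℂ) = ((-(|Q.A| * Real.sqrt |Q.A|) : ℝ) : ℂ) * (d ^ 3 * ℘'[P] w) := by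
    push_cast
    linear_combination h1
  have h3 := congrArg Complex.re h2
  rwa [Complex.ofReal_re, Complex.re_ofReal_mul] at h3

/-- The reflection `ε ↦ 1 - ε` changes the sign of `℘'(b + 2 ε p d)`. -/
lemma derivWeierstrassP_reflect {b : ℂ} {p : ℝ} (hb : 2 * (b + p * d) ∈ P.lattice) (ε : ℝ) :
    ℘'[P] (b + ((2 * (1 - ε) * p : ℝ) : ℂ) * d) = -℘'[P] (b + ((2 * ε * p : ℝ) : ℂ) * d) := by
  rw [← P.derivWeierstrassP_neg,
    ← P.derivWeierstrassP_add_mem hb (-(b + ((2 * ε * p : ℝ) : ℂ) * d))]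
  congr 1
  push_cast
  ring

/-- A function that is odd about `1 / 2` and positive on the left is negative on the right. -/
lemma sign_iff_of_reflect {r : ℝ → ℝ} (hpos : ∀ ε, 0 < ε → ε < 1 / 2 → 0 < r ε)
    (hr : ∀ ε, r (1 - ε) = -r ε) {ε : ℝ} (h0 : 0 < ε) (h1 : ε < 1) :
    (ε < 1 / 2 ↔ 0 < r ε) ∧ (1 / 2 < ε ↔ r ε < 0) := by
  have hhalf : r (1 / 2) = 0 := by
    have := hr (1 / 2)
    norm_num at this
    linarith
  rcases lt_trichotomy ε (1 / 2) with h | rfl | h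
  · have := hpos ε h0 h
    exact ⟨⟨fun _ ↦ this, fun _ ↦ h⟩, ⟨fun h' ↦ by linarith, fun h' ↦ by linarith⟩⟩
  · rw [hhalf]
    simp
  · have h2 := hpos (1 - ε) (by linarith) (by linarith)
    rw [hr] at h2
    exact ⟨⟨fun h' ↦ by linarith, fun h' ↦ by linarith⟩, ⟨fun _ ↦ by linarith, fun _ ↦ h⟩⟩

/-- The sign of `E` for `w` on an axis. -/
lemma sign_E_axis (hconj : ∀ z ∈ P.lattice, conj z ∈ P.lattice)
    (hd : (0 < Q.A ∧ d = 1) ∨ (Q.A < 0 ∧ d = Complex.I)) {p : ℝ} (hp : 0 < p)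
    (hL : ∀ x : ℝ, x * d ∈ P.lattice ↔ ∃ n : ℤ, x = 2 * n * p) {ε : ℝ} (h0 : 0 < ε) (h1 : ε < 1)
    (hw : Q.toComplex.IsParameter Q.rootA P (((2 * ε * p : ℝ) : ℂ) * d)) :
    (ε < 1 / 2 ↔ 0 < Q.E) ∧ (1 / 2 < ε ↔ Q.E < 0) := by
  have hd1 : d = 1 ∨ d = Complex.I := hd.imp And.right And.right
  obtain ⟨κ, hκ, hE⟩ := exists_E_eq (P := P) hd
  rw [hE _ hw]
  have h2p : 2 * (0 + (p : ℂ) * d) ∈ P.lattice := by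
    have := (hL (2 * p)).mpr ⟨1, by simp⟩
    convert this using 1
    push_cast
    ring
  refine sign_iff_of_reflect (r := fun ε ↦ -κ * (d ^ 3 * ℘'[P] (((2 * ε * p : ℝ) : ℂ) * d)).re)
    (fun ε h0 h1 ↦ ?_) (fun ε ↦ ?_) h0 h1
  · have := PeriodPair.axis_deriv_neg hconj hd1 hp hL (2 * ε * p) ⟨by positivity, by nlinarith⟩
    nlinarith
  · have := derivWeierstrassP_reflect h2p ε
    rw [zero_add, zero_add] at this
    change -κ * (d ^ 3 * ℘'[P] (((2 * (1 - ε) * p : ℝ) : ℂ) * d)).re = _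
    rw [this, mul_neg, Complex.neg_re]
    ring

/-- The sign of `E` for `w` on a line through the half periods other than the origin. -/
lemma sign_E_side (hd : (0 < Q.A ∧ d = 1) ∨ (Q.A < 0 ∧ d = Complex.I)) {b : ℂ} {p : ℝ} (hp : 0 < p)
    (hb : b ∉ P.lattice) (hb2 : 2 * b ∈ P.lattice) (hbp : 2 * (b + p * d) ∈ P.lattice)
    (hpos : ∀ t ∈ Set.Ioo 0 p, 0 < (d ^ 3 * ℘'[P] (b + t * d)).re)
    {ε : ℝ} (h0 : 0 ≤ ε) (h1 : ε < 1)
    (hw : Q.toComplex.IsParameter Q.rootA P (b + ((2 * ε * p : ℝ) : ℂ) * d)) :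
    (0 < ε ∧ ε < 1 / 2 ↔ Q.E < 0) ∧ (1 / 2 < ε ↔ 0 < Q.E) := by
  obtain ⟨κ, hκ, hE⟩ := exists_E_eq (P := P) hd
  rw [hE _ hw]
  rcases h0.eq_or_lt with rfl | h0
  · have : ℘'[P] b = 0 := (P.derivWeierstrassP_eq_zero_iff hb).mpr hb2
    simp [this]
  have h2 := sign_iff_of_reflect (r := fun ε ↦ κ * (d ^ 3 * ℘'[P] (b + ((2 * ε * p : ℝ) : ℂ) * d)).re)
    (fun ε h0 h1 ↦ ?_) (fun ε ↦ ?_) h0 h1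
  · rw [neg_mul, neg_lt_zero, neg_pos]
    exact ⟨⟨fun h ↦ h2.1.mp h.2, fun h ↦ ⟨h0, h2.1.mpr h⟩⟩, h2.2⟩
  · exact mul_pos hκ (hpos (2 * ε * p) ⟨by positivity, by nlinarith⟩)
  · rw [derivWeierstrassP_reflect hbp, mul_neg, Complex.neg_re]
    ring

/-- If `℘` takes the value `D / A` on the segment from `b` to `b + p d`, then a parameter lies on
the segment from `b` to `b + 2 p d`. -/
lemma exists_parameter_line (hd : (0 < Q.A ∧ d = 1) ∨ (Q.A < 0 ∧ d = Complex.I))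
    (hg₂ : P.g₂ = Q.g₂) (hg₃ : P.g₃ = Q.g₃) {b : ℂ} {p : ℝ} (hp : 0 < p)
    (hb2 : 2 * b ∈ P.lattice) (hbp : 2 * (b + p * d) ∈ P.lattice) {t : ℝ} (ht : t ∈ Set.Icc 0 p)
    (hmem : b + t * d ∉ P.lattice) (h : d ^ 2 * ℘[P] (b + t * d) = d ^ 2 * (Q.D / Q.A : ℝ)) :
    ∃ ε : ℝ, 0 ≤ ε ∧ ε < 1 ∧
      Q.toComplex.IsParameter Q.rootA P (b + ((2 * ε * p : ℝ) : ℂ) * d) := by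
  obtain ⟨hA, hA', hd0⟩ := ne_zero_of_sign hd
  have h1 := mul_left_cancel₀ (pow_ne_zero 2 hd0) h
  rw [← toComplex_D_div] at h1
  rcases exists_isParameter_aux hA' (rootA_sq hd) (hg₂.trans toComplex_g₂.symm)
    (hg₃.trans toComplex_g₃.symm) hmem h1 with h2 | h2
  · refine ⟨t / (2 * p), div_nonneg ht.1 (by linarith), ?_, ?_⟩
    · rw [div_lt_one (by linarith)]
      linarith [ht.2]
    · rwa [show 2 * (t / (2 * p)) * p = t by field_simp]
  · rcases ht.1.eq_or_lt with h0 | h0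
    · refine ⟨0, le_rfl, one_pos, ?_⟩
      have := h2.add_mem hb2
      rw [← h0] at this
      convert this using 1
      push_cast
      ring
    · refine ⟨1 - t / (2 * p), ?_, ?_, ?_⟩
      · rw [sub_nonneg, div_le_one (by linarith)]
        linarith [ht.2]
      · rw [sub_lt_self_iff]
        positivity
      · have := h2.add_mem hbp
        have hp' : (p : ℂ) ≠ 0 := Complex.ofReal_ne_zero.mpr hp.ne'
        convert this using 1
        push_cast
        field_simp
        ring

/-- `(s_j / √A)² = (D / A - e_j) / A`. -/
lemma sigmaRatio_div_sq (hd : (0 < Q.A ∧ d = 1) ∨ (Q.A < 0 ∧ d = Complex.I))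
    (hw : Q.toComplex.IsParameter Q.rootA P w) {j : Fin 4} (hj : j ≠ 0) {e : ℝ} (he : P.e j = e) :
    (P.sigmaRatio j w / Q.rootA) ^ 2 = (((Q.D / Q.A - e) / Q.A : ℝ) : ℂ) := by
  rw [div_pow, P.sigmaRatio_sq hj hw.1, hw.2.1, toComplex_D_div, rootA_sq hd, he]
  change _ / (Q.A : ℂ) = _
  push_cast
  rfl

/-- Conjugation of the functions `φ(·, w)` replaces `w` by its reflection. -/
lemma conj_phi (hconj : ∀ z ∈ P.lattice, conj z ∈ P.lattice)
    (hd : (0 < Q.A ∧ d = 1) ∨ (Q.A < 0 ∧ d = Complex.I)) (u : ℂ) :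
    conj (Q.toComplex.phi Q.rootA P w u) =
      Q.toComplex.phi Q.rootA P (d ^ 2 * conj w) (conj u) := by
  have hcoef : conj (-Q.toComplex.B / Q.toComplex.A) = -Q.toComplex.B / Q.toComplex.A := by
    simp [toComplex]
  have h2 : conj (w / 2) = conj w / 2 := by rw [map_div₀, map_ofNat]
  rw [phi, phi, phi0, phi0, map_add, hcoef, map_mul, map_add, map_sub,
    ← PeriodPair.weierstrassZeta_conj hconj, ← PeriodPair.weierstrassZeta_conj hconj,
    ← PeriodPair.weierstrassZeta_conj hconj, map_sub, map_add, h2, map_div₀, map_one,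
    (rootA_eq hd).1, map_mul, Complex.conj_ofReal]
  rcases hd with ⟨-, rfl⟩ | ⟨-, rfl⟩
  · simp
  · have e1 : conj u + Complex.I ^ 2 * conj w / 2 = conj u + conj w / 2 - conj w := by
      rw [Complex.I_sq]; ring
    have e2 : conj u + conj w / 2 - conj w - Complex.I ^ 2 * conj w = conj u + conj w / 2 := by
      rw [Complex.I_sq]; ring
    rw [e1, e2, Complex.I_sq, neg_one_mul, PeriodPair.weierstrassZeta_neg]
    simp
    ring

/-- If the reflection `d² conj w` of `w` is `w + l` with a period `l`, then conjugation takes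
`φ(u + ω_k, w)` to `φ(u + v, w + l) = φ(u + v + l / 2, w)`, where `v` is the conjugate of `ω_k`. -/
lemma conjugateValued (hconj : ∀ z ∈ P.lattice, conj z ∈ P.lattice)
    (hd : (0 < Q.A ∧ d = 1) ∨ (Q.A < 0 ∧ d = Complex.I)) (hw : w ∉ P.lattice) {l : ℂ}
    (hl : l ∈ P.lattice) (hwl : d ^ 2 * conj w = w + l) {k m : Fin 4}
    (hkm : conj (P.halfPeriod k) + l / 2 - P.halfPeriod m ∈ P.lattice) :
    Q.toComplex.ConjugateValued Q.rootA P w k m := by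
  intro u h1 h2
  have hc1 := PeriodPair.conj_notMem hconj h1
  have hc2 := PeriodPair.conj_notMem hconj h2
  have h3 : conj (w / 2) = conj w / 2 := by rw [map_div₀, map_ofNat]
  rw [map_sub, map_add, Complex.conj_ofReal, h3] at hc1
  rw [map_add, map_add, Complex.conj_ofReal, h3] at hc2
  -- Both conditions below hold whichever of `w + l` and `-(w + l)` is the conjugate of `w`.
  obtain ⟨p1, p2⟩ : u + conj (P.halfPeriod k) + l / 2 - w / 2 ∉ P.lattice ∧
      u + conj (P.halfPeriod k) + l / 2 + w / 2 ∉ P.lattice := by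
    rcases hd with ⟨-, rfl⟩ | ⟨-, rfl⟩
    · rw [one_pow, one_mul] at hwl
      rw [hwl] at hc1 hc2
      constructor
      · rw [← P.add_mem_iff_notMem hl] at hc1
        convert hc1 using 2
        ring
      · convert hc2 using 2
        ring
    · rw [Complex.I_sq, neg_one_mul] at hwl
      rw [← neg_neg (conj w), hwl] at hc1 hc2
      constructor
      · rw [← P.add_mem_iff_notMem hl] at hc2
        convert hc2 using 2
        ring
      · convert hc1 using 2
        ring
  rw [conj_phi hconj hd, map_add, Complex.conj_ofReal, hwl, phi_parameter_add hw hl p1,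
    ← phi_add_mem (neg_mem hkm) p1 p2]
  congr 1
  ring

lemma conj_root {k m : Fin 4} (hw : w ∉ P.lattice)
    (h : Q.toComplex.ConjugateValued Q.rootA P w k m) :
    conj (Q.toComplex.root Q.rootA P w k) = Q.toComplex.root Q.rootA P w m := by
  have h1 := halfPeriod_half_notMem hw k
  have h2 := h 0 (by simpa using h1.1) (by simpa using h1.2)
  simpa [root] using h2

lemma realValued {k : Fin 4} (h : Q.toComplex.ConjugateValued Q.rootA P w k k) :
    Q.toComplex.RealValued Q.rootA P w k :=
  fun u h1 h2 ↦ Complex.conj_eq_iff_im.mp (h u h1 h2)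

lemma root_im_eq_zero {k : Fin 4} (hw : w ∉ P.lattice)
    (h : Q.toComplex.ConjugateValued Q.rootA P w k k) :
    (Q.toComplex.root Q.rootA P w k).im = 0 :=
  Complex.conj_eq_iff_im.mp (conj_root hw h)

lemma root_im_ne_zero {k m : Fin 4} (hA : Q.toComplex.A ≠ 0) (hs : Q.rootA ^ 2 = Q.toComplex.A)
    (hw : w ∉ P.lattice) (hkm : k ≠ m) (h : Q.toComplex.ConjugateValued Q.rootA P w k m) :
    (Q.toComplex.root Q.rootA P w k).im ≠ 0 := fun h0 ↦
  hkm (root_injective (root_ne_zero_of_sq hA hs) hw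
    ((Complex.conj_eq_iff_im.mpr h0).symm.trans (conj_root hw h)))

/-- If two conjugate functions share a real value at `u`, then `φ(·, w)` takes the same value at
`u + ω_k` and `u + ω_m`, so `2 u + ω_k + ω_m` is a period. -/
lemma phi_im_ne_zero {k m : Fin 4} (hA : Q.toComplex.A ≠ 0) (hs : Q.rootA ^ 2 = Q.toComplex.A)
    (hw : w ∉ P.lattice) (hkm : k ≠ m) (h : Q.toComplex.ConjugateValued Q.rootA P w k m)
    (h' : Q.toComplex.ConjugateValued Q.rootA P w m k) {u : ℝ}
    (hk : ∀ j, j = k ∨ j = m → (u : ℂ) + P.halfPeriod j - w / 2 ∉ P.lattice ∧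
      (u : ℂ) + P.halfPeriod j + w / 2 ∉ P.lattice)
    (hu : (2 * u : ℂ) + P.halfPeriod k + P.halfPeriod m ∉ P.lattice) :
    (Q.toComplex.phi Q.rootA P w (u + P.halfPeriod k)).im ≠ 0 ∧
      (Q.toComplex.phi Q.rootA P w (u + P.halfPeriod m)).im ≠ 0 := by
  have h1 := hk k (Or.inl rfl)
  have h2 := hk m (Or.inr rfl)
  have hne : Q.toComplex.phi Q.rootA P w (u + P.halfPeriod k) ≠
      Q.toComplex.phi Q.rootA P w (u + P.halfPeriod m) := by
    intro heq
    rcases add_mem_or_sub_mem_of_phi_eq (root_ne_zero_of_sq hA hs) hw h1.1 h1.2 h2.1 h2.2 heq with h3 | h3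
    · refine hu ?_
      convert h3 using 1
      ring
    · refine hkm ((P.halfPeriod_sub_mem_iff k m).mp ?_)
      convert h3 using 1
      ring
  constructor
  · intro h0
    exact hne ((Complex.conj_eq_iff_im.mpr h0).symm.trans (h u h1.1 h1.2))
  · intro h0
    exact hne ((Complex.conj_eq_iff_im.mpr h0).symm.trans (h' u h2.1 h2.2)).symm

end QuarticForm

namespace QuarticForm

open scoped PeriodPair ComplexConjugate
open PeriodPair (rectPair rhombPair)

section

variable {Q : QuarticForm ℝ} {d w : ℂ} {P : PeriodPair}

/-- `d² ℘` takes on the axis all real values beyond that at the half period. -/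
lemma exists_parameter_axis (hconj : ∀ z ∈ P.lattice, conj z ∈ P.lattice)
    (hd : (0 < Q.A ∧ d = 1) ∨ (Q.A < 0 ∧ d = Complex.I)) (hg₂ : P.g₂ = Q.g₂) (hg₃ : P.g₃ = Q.g₃)
    {p : ℝ} (hp : 0 < p) (hL : ∀ x : ℝ, x * d ∈ P.lattice ↔ ∃ n : ℤ, x = 2 * n * p)
    (hx : (d ^ 2 * ℘[P] (p * d)).re ≤ (d ^ 2).re * (Q.D / Q.A)) :
    ∃ ε : ℝ, 0 < ε ∧ ε < 1 ∧
      Q.toComplex.IsParameter Q.rootA P (((2 * ε * p : ℝ) : ℂ) * d) := by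
  have hd1 : d = 1 ∨ d = Complex.I := hd.imp And.right And.right
  have hd2 : ((d ^ 2).re : ℂ) = d ^ 2 :=
    Complex.conj_eq_iff_re.mp (PeriodPair.isRealLine_axis (L := P) hd1).conj_sq
  obtain ⟨t, ht, h⟩ := PeriodPair.axis_exists_eq hconj hd1 hp hL hx
  rw [Complex.ofReal_mul, hd2] at h
  have hmem := PeriodPair.axis_notMem hp hL (t := t) ⟨ht.1, by linarith [ht.2]⟩
  have h2p : 2 * (0 + (p : ℂ) * d) ∈ P.lattice := by
    have := (hL (2 * p)).mpr ⟨1, by simp⟩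
    convert this using 1
    push_cast
    ring
  obtain ⟨ε, h0, h1, hw⟩ := exists_parameter_line hd hg₂ hg₃ hp (b := 0) (by simp) h2p
    ⟨ht.1.le, ht.2⟩ (by rwa [zero_add]) (by rwa [zero_add])
  rw [zero_add] at hw
  refine ⟨ε, h0.lt_of_ne ?_, h1, hw⟩
  rintro rfl
  exact hw.1 (by simp)

/-- `d² ℘` takes on the side all values between those at the two half periods. -/
lemma exists_parameter_side (hconj : ∀ z ∈ P.lattice, conj z ∈ P.lattice)
    (hd : (0 < Q.A ∧ d = 1) ∨ (Q.A < 0 ∧ d = Complex.I)) (hg₂ : P.g₂ = Q.g₂) (hg₃ : P.g₃ = Q.g₃)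
    {b : ℂ} {p : ℝ} (hp : 0 < p) (hline : P.IsRealLine b d)
    (hmem : ∀ t : ℝ, b + t * d ∉ P.lattice)
    (hb2 : 2 * b ∈ P.lattice) (hbp : 2 * (b + p * d) ∈ P.lattice)
    (hx1 : (d ^ 2 * ℘[P] b).re ≤ (d ^ 2).re * (Q.D / Q.A))
    (hx2 : (d ^ 2).re * (Q.D / Q.A) ≤ (d ^ 2 * ℘[P] (b + p * d)).re) :
    ∃ ε : ℝ, 0 ≤ ε ∧ ε < 1 ∧
      Q.toComplex.IsParameter Q.rootA P (b + ((2 * ε * p : ℝ) : ℂ) * d) := by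
  have hd2 : ((d ^ 2).re : ℂ) = d ^ 2 := Complex.conj_eq_iff_re.mp hline.conj_sq
  obtain ⟨t, ht, h⟩ := PeriodPair.line_exists_eq hconj hline hp hmem hx1 hx2
  rw [Complex.ofReal_mul, hd2] at h
  exact exists_parameter_line hd hg₂ hg₃ hp hb2 hbp ht (hmem t) h

lemma conj_sigmaRatio_div (hconj : ∀ z ∈ P.lattice, conj z ∈ P.lattice)
    (hd : (0 < Q.A ∧ d = 1) ∨ (Q.A < 0 ∧ d = Complex.I)) (hw : w ∉ P.lattice)
    (hwd : d ^ 2 * conj w = w) {j k : Fin 4} (hj : j ≠ 0) (hk : k ≠ 0)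
    (hjk : conj (P.e j) = P.e k) :
    conj (P.sigmaRatio j w / Q.rootA) = P.sigmaRatio k w / Q.rootA := by
  rw [map_div₀, ← PeriodPair.conj_sigmaRatio hconj hj hk hjk hw, (rootA_eq hd).1, map_mul,
    Complex.conj_ofReal]
  rcases hd with ⟨-, rfl⟩ | ⟨-, rfl⟩
  · rw [one_pow, one_mul] at hwd
    rw [hwd, map_one]
  · rw [Complex.I_sq, neg_one_mul] at hwd
    rw [← neg_neg (conj w), hwd, P.sigmaRatio_neg hj, map_neg, Complex.conj_I, mul_neg, div_neg,
      neg_div]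

end

lemma le_or_mem_of_cubic_nonneg {a b c x : ℝ} (hbc : c < b)
    (h : 0 ≤ 4 * (x - a) * (x - b) * (x - c)) : a ≤ x ∨ (c ≤ x ∧ x ≤ b) := by
  by_contra! hcon
  obtain ⟨h1, h2⟩ := hcon
  rcases lt_or_ge x c with h3 | h3
  · have := mul_pos (mul_pos (sub_pos.mpr h1) (sub_pos.mpr (h3.trans hbc))) (sub_pos.mpr h3)
    nlinarith
  · have h4 := h2 h3
    have := mul_pos (mul_pos (sub_pos.mpr h1) (sub_pos.mpr h4)) (sub_pos.mpr (hbc.trans h4))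
    nlinarith

lemma le_or_mem_of_cubic_nonpos {a b c x : ℝ} (hab : b < a)
    (h : 4 * (x - a) * (x - b) * (x - c) ≤ 0) : x ≤ c ∨ (b ≤ x ∧ x ≤ a) := by
  have := le_or_mem_of_cubic_nonneg (a := -c) (b := -b) (c := -a) (x := -x) (by linarith)
    (by linarith)
  rcases this with h1 | h1
  · exact Or.inl (by linarith)
  · exact Or.inr ⟨by linarith, by linarith⟩

/-- Multiples of `p` by integers and by proper half integers are different. -/
lemma half_odd_mul_ne {p : ℝ} (hp : p ≠ 0) (k n : ℤ) : (k + 1 / 2 : ℝ) * p ≠ n * p := by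
  intro h
  have h1 := mul_right_cancel₀ hp h
  have h2 : (2 * k + 1 : ℝ) = 2 * n := by linarith
  have h3 : 2 * k + 1 = 2 * n := by exact_mod_cast h2
  omega

/-! ### Real quartics with a rectangular lattice -/

section Rect

variable {Q : QuarticForm ℝ} {d w : ℂ} {ω ω' p : ℝ} (hω : 0 < ω) (hω' : 0 < ω')

lemma int_mem_rectPair (m n : ℤ) :
    2 * m * (ω : ℂ) + 2 * n * ω' * Complex.I ∈ (rectPair hω hω').lattice := by
  rw [PeriodPair.mem_rectPair]
  exact ⟨m, n, by simp, by simp⟩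

lemma conj_halfPeriod_rectPair (k : Fin 4) :
    conj ((rectPair hω hω').halfPeriod k) + 0 / 2 - (rectPair hω hω').halfPeriod k ∈
      (rectPair hω hω').lattice := by
  obtain ⟨h1, h2, h3⟩ := PeriodPair.halfPeriod_rectPair hω hω'
  fin_cases k
  · simp [PeriodPair.halfPeriod_zero]
  · simp [h1]
  · convert int_mem_rectPair hω hω' 0 (-1) using 1
    simp [h2]; ring
  · convert int_mem_rectPair hω hω' 0 (-1) using 1
    simp [h3]; ring

/-- Parameters on the axes of a rectangular lattice, where `w` is its own reflection, so that all
four functions are real. -/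
lemma rectPair_axis_real
    (hd : (0 < Q.A ∧ d = 1 ∧ p = ω) ∨ (Q.A < 0 ∧ d = Complex.I ∧ p = ω'))
    (he : ∀ j : Fin 4, j ≠ 0 → ∃ e : ℝ, (rectPair hω hω').e j = e ∧ 0 ≤ (Q.D / Q.A - e) / Q.A)
    {ε : ℝ} (h0 : 0 < ε) (h1 : ε < 1) (hwε : w = ((2 * ε * p : ℝ) : ℂ) * d)
    (hw : Q.toComplex.IsParameter Q.rootA (rectPair hω hω') w) :
    (ε < 1 / 2 ↔ 0 < Q.E) ∧ (1 / 2 < ε ↔ Q.E < 0) ∧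
      (∀ j : Fin 4, j ≠ 0 → ((rectPair hω hω').sigmaRatio j w / Q.rootA).im = 0) ∧
      (∀ k, (Q.toComplex.root Q.rootA (rectPair hω hω') w k).im = 0) ∧
      ∀ k, Q.toComplex.RealValued Q.rootA (rectPair hω hω') w k := by
  have hconj := PeriodPair.conj_mem_lattice_rectPair hω hω'
  have hd' : (0 < Q.A ∧ d = 1) ∨ (Q.A < 0 ∧ d = Complex.I) :=
    hd.imp (fun h ↦ ⟨h.1, h.2.1⟩) fun h ↦ ⟨h.1, h.2.1⟩
  obtain ⟨-, hp, hL⟩ := PeriodPair.rectPair_axis hω hω' (hd.imp And.right And.right)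
  have hwl : d ^ 2 * conj w = w + 0 := by
    rw [hwε]
    rcases hd with ⟨-, rfl, -⟩ | ⟨-, rfl, -⟩ <;> simp [map_ofNat]
  have hcv (k : Fin 4) : Q.toComplex.ConjugateValued Q.rootA (rectPair hω hω') w k k :=
    conjugateValued hconj hd' hw.1 (zero_mem _) hwl (conj_halfPeriod_rectPair hω hω' k)
  have hsign := sign_E_axis hconj hd' hp hL h0 h1 (hwε ▸ hw)
  refine ⟨hsign.1, hsign.2, fun j hj ↦ ?_, fun k ↦ root_im_eq_zero hw.1 (hcv k),
    fun k ↦ realValued (hcv k)⟩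
  obtain ⟨e, he, he'⟩ := he j hj
  exact Complex.im_eq_zero_of_sq_eq (sigmaRatio_div_sq hd' hw hj he) he'

/-- The sign of `E` for parameters on the sides of the half period rectangle opposite to the
origin. -/
lemma rectPair_sign_E_side {b : ℂ}
    (hd : (0 < Q.A ∧ b = ω' * Complex.I ∧ d = 1 ∧ p = ω) ∨
      (Q.A < 0 ∧ b = ω ∧ d = Complex.I ∧ p = ω')) {ε : ℝ} (h0 : 0 ≤ ε) (h1 : ε < 1)
    (hw : Q.toComplex.IsParameter Q.rootA (rectPair hω hω') (b + ((2 * ε * p : ℝ) : ℂ) * d)) :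
    (0 < ε ∧ ε < 1 / 2 ↔ Q.E < 0) ∧ (1 / 2 < ε ↔ 0 < Q.E) := by
  have hconj := PeriodPair.conj_mem_lattice_rectPair hω hω'
  have hd' : (0 < Q.A ∧ d = 1) ∨ (Q.A < 0 ∧ d = Complex.I) :=
    hd.imp (fun h ↦ ⟨h.1, h.2.2.1⟩) fun h ↦ ⟨h.1, h.2.2.1⟩
  obtain ⟨hline, hp, hmem, hmem2, hvert⟩ :=
    PeriodPair.rectPair_side hω hω' (hd.imp And.right And.right)
  obtain ⟨e₁, e₂, e₃, he1, he2, he3, h12, h23⟩ := PeriodPair.e_rectPair hω hω'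
  obtain ⟨hh1, hh2, hh3⟩ := PeriodPair.halfPeriod_rectPair hω hω'
  rw [PeriodPair.e, hh1] at he1
  rw [PeriodPair.e, hh2] at he2
  rw [PeriodPair.e, hh3] at he3
  have hbmem : b ∉ (rectPair hω hω').lattice := by simpa using hmem 0
  have hvp : 2 * (b + p * d) ∈ (rectPair hω hω').lattice := by
    rw [hvert, ← hh2]; exact PeriodPair.two_mul_halfPeriod_mem _ _
  have hb2 : 2 * b ∈ (rectPair hω hω').lattice := by
    rcases hd with ⟨-, rfl, -⟩ | ⟨-, rfl, -⟩
    · rw [← hh3]; exact PeriodPair.two_mul_halfPeriod_mem _ _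
    · rw [← hh1]; exact PeriodPair.two_mul_halfPeriod_mem _ _
  refine sign_E_side hd' hp hbmem hb2 hvp (PeriodPair.line_deriv_pos hconj hline hp hmem hmem2 ?_)
    h0 h1 hw
  rw [hvert, he2]
  rcases hd with ⟨-, rfl, rfl, -⟩ | ⟨-, rfl, rfl, -⟩
  · rw [he3]
    simpa using h23
  · rw [he1]
    simpa using h12

/-- Parameters on the line through `ω' i` parallel to the real axis. The conjugate of `w` is
`w - 2 ω' i`, so conjugation exchanges the functions with `k = 0, 3` and those with `k = 1, 2`. -/
lemma rectPair_horizontal_side (hA : 0 < Q.A) {e₁ e₂ e₃ : ℝ} (he1 : (rectPair hω hω').e 1 = e₁)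
    (he2 : (rectPair hω hω').e 2 = e₂) (he3 : (rectPair hω hω').e 3 = e₃) (h12 : e₂ < e₁)
    (hx3 : e₃ ≤ Q.D / Q.A) (hx2 : Q.D / Q.A ≤ e₂)
    {ε : ℝ} (h0 : 0 ≤ ε) (h1 : ε < 1) (hwε : w = 2 * (ε : ℂ) * ω + ω' * Complex.I)
    (hw : Q.toComplex.IsParameter Q.rootA (rectPair hω hω') w) :
    (0 < ε ∧ ε < 1 / 2 ↔ Q.E < 0) ∧ (1 / 2 < ε ↔ 0 < Q.E) ∧
      ((rectPair hω hω').sigmaRatio 1 w / Q.rootA).re = 0 ∧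
      ((rectPair hω hω').sigmaRatio 2 w / Q.rootA).re = 0 ∧
      ((rectPair hω hω').sigmaRatio 3 w / Q.rootA).im = 0 ∧
      (∀ k, (Q.toComplex.root Q.rootA (rectPair hω hω') w k).im ≠ 0) ∧
      conj (Q.toComplex.root Q.rootA (rectPair hω hω') w 0) =
        Q.toComplex.root Q.rootA (rectPair hω hω') w 3 ∧
      conj (Q.toComplex.root Q.rootA (rectPair hω hω') w 1) =
        Q.toComplex.root Q.rootA (rectPair hω hω') w 2 ∧
      Q.toComplex.ConjugateValued Q.rootA (rectPair hω hω') w 0 3 ∧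
      Q.toComplex.ConjugateValued Q.rootA (rectPair hω hω') w 1 2 ∧
      ∀ (k : Fin 4) (u : ℝ),
        (Q.toComplex.phi Q.rootA (rectPair hω hω') w
          (u + (rectPair hω hω').halfPeriod k)).im ≠ 0 := by
  have hconj := PeriodPair.conj_mem_lattice_rectPair hω hω'
  have hd : (0 < Q.A ∧ (1 : ℂ) = 1) ∨ (Q.A < 0 ∧ (1 : ℂ) = Complex.I) := Or.inl ⟨hA, rfl⟩
  obtain ⟨-, hA', -⟩ := ne_zero_of_sign hd
  have hs := rootA_sq hd
  obtain ⟨hh1, hh2, hh3⟩ := PeriodPair.halfPeriod_rectPair hω hω'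
  have hh0 := PeriodPair.halfPeriod_zero (rectPair hω hω')
  have hw' : w = ω' * Complex.I + ((2 * ε * ω : ℝ) : ℂ) * 1 := by
    rw [hwε]; push_cast; ring
  have hsign := rectPair_sign_E_side hω hω' (Or.inl ⟨hA, rfl, rfl, rfl⟩) h0 h1 (hw' ▸ hw)
  have hl : (-(2 * ω' * Complex.I) : ℂ) ∈ (rectPair hω hω').lattice := by
    convert int_mem_rectPair hω hω' 0 (-1) using 1
    push_cast; ring
  have hwl : (1 : ℂ) ^ 2 * conj w = w + -(2 * ω' * Complex.I) := by
    rw [hwε]; simp [map_ofNat]; ring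
  have c03 : Q.toComplex.ConjugateValued Q.rootA (rectPair hω hω') w 0 3 := by
    refine conjugateValued hconj hd hw.1 hl hwl ?_
    convert int_mem_rectPair hω hω' 0 (-1) using 1
    rw [hh0, hh3, map_zero]; push_cast; ring
  have c30 : Q.toComplex.ConjugateValued Q.rootA (rectPair hω hω') w 3 0 := by
    refine conjugateValued hconj hd hw.1 hl hwl ?_
    convert int_mem_rectPair hω hω' 0 (-1) using 1
    simp [hh0, hh3]; ring
  have c12 : Q.toComplex.ConjugateValued Q.rootA (rectPair hω hω') w 1 2 := by
    refine conjugateValued hconj hd hw.1 hl hwl ?_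
    convert int_mem_rectPair hω hω' 0 (-1) using 1
    simp [hh1, hh2]; ring
  have c21 : Q.toComplex.ConjugateValued Q.rootA (rectPair hω hω') w 2 1 := by
    refine conjugateValued hconj hd hw.1 hl hwl ?_
    convert int_mem_rectPair hω hω' 0 (-1) using 1
    simp [hh1, hh2]; ring
  have hsq {j : Fin 4} (hj : j ≠ 0) {e : ℝ} (he : (rectPair hω hω').e j = e) :=
    sigmaRatio_div_sq hd hw hj he
  -- The imaginary parts are odd multiples of `ω' / 2`.
  have hpole (u : ℝ) (j : Fin 4) :
      (u : ℂ) + (rectPair hω hω').halfPeriod j - w / 2 ∉ (rectPair hω hω').lattice ∧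
        (u : ℂ) + (rectPair hω hω').halfPeriod j + w / 2 ∉ (rectPair hω hω').lattice := by
    have him : (w / 2).im = ω' / 2 := by rw [hwε]; simp
    constructor <;> rw [PeriodPair.mem_rectPair] <;> rintro ⟨m, n, -, hn⟩
    · rw [Complex.sub_im, Complex.add_im, him] at hn
      fin_cases j
      · exact half_odd_mul_ne hω'.ne' (-1) (2 * n) (by simp [hh0] at hn; push_cast; linarith)
      · exact half_odd_mul_ne hω'.ne' (-1) (2 * n) (by simp [hh1] at hn; push_cast; linarith)
      · exact half_odd_mul_ne hω'.ne' 0 (2 * n) (by simp [hh2] at hn; push_cast; linarith)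
      · exact half_odd_mul_ne hω'.ne' 0 (2 * n) (by simp [hh3] at hn; push_cast; linarith)
    · rw [Complex.add_im, Complex.add_im, him] at hn
      fin_cases j
      · exact half_odd_mul_ne hω'.ne' 0 (2 * n) (by simp [hh0] at hn; push_cast; linarith)
      · exact half_odd_mul_ne hω'.ne' 0 (2 * n) (by simp [hh1] at hn; push_cast; linarith)
      · exact half_odd_mul_ne hω'.ne' 1 (2 * n) (by simp [hh2] at hn; push_cast; linarith)
      · exact half_odd_mul_ne hω'.ne' 1 (2 * n) (by simp [hh3] at hn; push_cast; linarith)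
  have n03 (u : ℝ) := phi_im_ne_zero (k := 0) (m := 3) hA' hs hw.1 (by decide) c03 c30
    (fun j _ ↦ hpole u j) (by
      rw [PeriodPair.mem_rectPair]
      rintro ⟨m, n, -, hn⟩
      exact PeriodPair.not_eq_two_mul_int_mul hω'.ne' (n := n) (by simpa [hh0, hh3] using hn))
  have n12 (u : ℝ) := phi_im_ne_zero (k := 1) (m := 2) hA' hs hw.1 (by decide) c12 c21
    (fun j _ ↦ hpole u j) (by
      rw [PeriodPair.mem_rectPair]
      rintro ⟨m, n, -, hn⟩
      exact PeriodPair.not_eq_two_mul_int_mul hω'.ne' (n := n) (by simpa [hh1, hh2] using hn))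
  refine ⟨hsign.1, hsign.2,
    Complex.re_eq_zero_of_sq_eq (hsq (by decide) he1)
      (div_nonpos_of_nonpos_of_nonneg (by linarith) hA.le),
    Complex.re_eq_zero_of_sq_eq (hsq (by decide) he2)
      (div_nonpos_of_nonpos_of_nonneg (by linarith) hA.le),
    Complex.im_eq_zero_of_sq_eq (hsq (by decide) he3) (div_nonneg (by linarith) hA.le),
    fun k ↦ ?_, conj_root hw.1 c03, conj_root hw.1 c12, c03, c12, fun k u ↦ ?_⟩
  · fin_cases k
    · exact root_im_ne_zero hA' hs hw.1 (by decide) c03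
    · exact root_im_ne_zero hA' hs hw.1 (by decide) c12
    · exact root_im_ne_zero hA' hs hw.1 (by decide) c21
    · exact root_im_ne_zero hA' hs hw.1 (by decide) c30
  · fin_cases k
    exacts [(n03 u).1, (n12 u).1, (n12 u).2, (n03 u).2]

/-- Parameters on the line through `ω` parallel to the imaginary axis. The reflection of `w` in the
imaginary axis is `w - 2 ω`, so conjugation exchanges the functions with `k = 0, 1` and those with
`k = 2, 3`. -/
lemma rectPair_vertical_side (hA : Q.A < 0) {e₁ e₂ e₃ : ℝ} (he1 : (rectPair hω hω').e 1 = e₁)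
    (he2 : (rectPair hω hω').e 2 = e₂) (he3 : (rectPair hω hω').e 3 = e₃) (h23 : e₃ < e₂)
    (hx2 : e₂ ≤ Q.D / Q.A) (hx1 : Q.D / Q.A ≤ e₁)
    {ε : ℝ} (h0 : 0 ≤ ε) (h1 : ε < 1) (hwε : w = ω + 2 * (ε : ℂ) * ω' * Complex.I)
    (hw : Q.toComplex.IsParameter Q.rootA (rectPair hω hω') w) :
    (0 < ε ∧ ε < 1 / 2 ↔ Q.E < 0) ∧ (1 / 2 < ε ↔ 0 < Q.E) ∧
      ((rectPair hω hω').sigmaRatio 1 w / Q.rootA).im = 0 ∧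
      ((rectPair hω hω').sigmaRatio 2 w / Q.rootA).re = 0 ∧
      ((rectPair hω hω').sigmaRatio 3 w / Q.rootA).re = 0 ∧
      (∀ k, (Q.toComplex.root Q.rootA (rectPair hω hω') w k).im ≠ 0) ∧
      conj (Q.toComplex.root Q.rootA (rectPair hω hω') w 0) =
        Q.toComplex.root Q.rootA (rectPair hω hω') w 1 ∧
      conj (Q.toComplex.root Q.rootA (rectPair hω hω') w 2) =
        Q.toComplex.root Q.rootA (rectPair hω hω') w 3 ∧
      Q.toComplex.ConjugateValued Q.rootA (rectPair hω hω') w 0 1 ∧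
      Q.toComplex.ConjugateValued Q.rootA (rectPair hω hω') w 2 3 ∧
      ∀ (k : Fin 4) (u : ℝ), (∀ n : ℤ, u ≠ (2 * n + 1) * ω / 2) →
        (Q.toComplex.phi Q.rootA (rectPair hω hω') w
          (u + (rectPair hω hω').halfPeriod k)).im ≠ 0 := by
  have hconj := PeriodPair.conj_mem_lattice_rectPair hω hω'
  have hd : (0 < Q.A ∧ Complex.I = 1) ∨ (Q.A < 0 ∧ Complex.I = Complex.I) := Or.inr ⟨hA, rfl⟩
  obtain ⟨-, hA', -⟩ := ne_zero_of_sign hd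
  have hs := rootA_sq hd
  obtain ⟨hh1, hh2, hh3⟩ := PeriodPair.halfPeriod_rectPair hω hω'
  have hh0 := PeriodPair.halfPeriod_zero (rectPair hω hω')
  have hw' : w = ω + ((2 * ε * ω' : ℝ) : ℂ) * Complex.I := by
    rw [hwε]; push_cast; ring
  have hsign := rectPair_sign_E_side hω hω' (Or.inr ⟨hA, rfl, rfl, rfl⟩) h0 h1 (hw' ▸ hw)
  have hl : (-(2 * ω) : ℂ) ∈ (rectPair hω hω').lattice := by
    convert int_mem_rectPair hω hω' (-1) 0 using 1
    push_cast; ring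
  have hwl : Complex.I ^ 2 * conj w = w + -(2 * ω) := by
    rw [hwε, Complex.I_sq]; simp [map_ofNat]; ring
  have c01 : Q.toComplex.ConjugateValued Q.rootA (rectPair hω hω') w 0 1 := by
    refine conjugateValued hconj hd hw.1 hl hwl ?_
    convert int_mem_rectPair hω hω' (-1) 0 using 1
    rw [hh0, hh1, map_zero]; push_cast; ring
  have c10 : Q.toComplex.ConjugateValued Q.rootA (rectPair hω hω') w 1 0 := by
    refine conjugateValued hconj hd hw.1 hl hwl ?_
    convert int_mem_rectPair hω hω' 0 0 using 1
    simp [hh0, hh1]; ring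
  have c23 : Q.toComplex.ConjugateValued Q.rootA (rectPair hω hω') w 2 3 := by
    refine conjugateValued hconj hd hw.1 hl hwl ?_
    convert int_mem_rectPair hω hω' 0 (-1) using 1
    simp [hh2, hh3]; ring
  have c32 : Q.toComplex.ConjugateValued Q.rootA (rectPair hω hω') w 3 2 := by
    refine conjugateValued hconj hd hw.1 hl hwl ?_
    convert int_mem_rectPair hω hω' (-1) (-1) using 1
    simp [hh2, hh3]; ring
  have hsq {j : Fin 4} (hj : j ≠ 0) {e : ℝ} (he : (rectPair hω hω').e j = e) :=
    sigmaRatio_div_sq hd hw hj he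
  have hpole {u : ℝ} (hu : ∀ n : ℤ, u ≠ (2 * n + 1) * ω / 2) (j : Fin 4) :
      (u : ℂ) + (rectPair hω hω').halfPeriod j - w / 2 ∉ (rectPair hω hω').lattice ∧
        (u : ℂ) + (rectPair hω hω').halfPeriod j + w / 2 ∉ (rectPair hω hω').lattice := by
    have hre : (w / 2).re = ω / 2 := by rw [hwε]; simp
    constructor <;> rw [PeriodPair.mem_rectPair] <;> rintro ⟨m, n, hn, -⟩
    · rw [Complex.sub_re, Complex.add_re, hre] at hn
      fin_cases j
      · exact hu (2 * m) (by simp [hh0] at hn; push_cast; linarith)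
      · exact hu (2 * m - 1) (by simp [hh1] at hn; push_cast; linarith)
      · exact hu (2 * m - 1) (by simp [hh2] at hn; push_cast; linarith)
      · exact hu (2 * m) (by simp [hh3] at hn; push_cast; linarith)
    · rw [Complex.add_re, Complex.add_re, hre] at hn
      fin_cases j
      · exact hu (2 * m - 1) (by simp [hh0] at hn; push_cast; linarith)
      · exact hu (2 * m - 2) (by simp [hh1] at hn; push_cast; linarith)
      · exact hu (2 * m - 2) (by simp [hh2] at hn; push_cast; linarith)
      · exact hu (2 * m - 1) (by simp [hh3] at hn; push_cast; linarith)
  have n01 {u : ℝ} (hu : ∀ n : ℤ, u ≠ (2 * n + 1) * ω / 2) :=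
    phi_im_ne_zero (k := 0) (m := 1) hA' hs hw.1 (by decide) c01 c10 (fun j _ ↦ hpole hu j) (by
      rw [PeriodPair.mem_rectPair]
      rintro ⟨m, n, hn, -⟩
      exact hu (m - 1) (by simp [hh0, hh1] at hn; push_cast; linarith))
  have n23 {u : ℝ} (hu : ∀ n : ℤ, u ≠ (2 * n + 1) * ω / 2) :=
    phi_im_ne_zero (k := 2) (m := 3) hA' hs hw.1 (by decide) c23 c32 (fun j _ ↦ hpole hu j) (by
      rw [PeriodPair.mem_rectPair]
      rintro ⟨m, n, hn, -⟩
      exact hu (m - 1) (by simp [hh2, hh3] at hn; push_cast; linarith))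
  refine ⟨hsign.1, hsign.2,
    Complex.im_eq_zero_of_sq_eq (hsq (by decide) he1) (div_nonneg_of_nonpos (by linarith) hA.le),
    Complex.re_eq_zero_of_sq_eq (hsq (by decide) he2)
      (div_nonpos_of_nonneg_of_nonpos (by linarith) hA.le),
    Complex.re_eq_zero_of_sq_eq (hsq (by decide) he3)
      (div_nonpos_of_nonneg_of_nonpos (by linarith) hA.le),
    fun k ↦ ?_, conj_root hw.1 c01, conj_root hw.1 c23, c01, c23, fun k u hu ↦ ?_⟩
  · fin_cases k
    · exact root_im_ne_zero hA' hs hw.1 (by decide) c01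
    · exact root_im_ne_zero hA' hs hw.1 (by decide) c10
    · exact root_im_ne_zero hA' hs hw.1 (by decide) c23
    · exact root_im_ne_zero hA' hs hw.1 (by decide) c32
  · fin_cases k
    exacts [(n01 hu).1, (n01 hu).2, (n23 hu).1, (n23 hu).2]

end Rect

/-! ### Real quartics with a rhombic lattice -/

section Rhomb

variable {Q : QuarticForm ℝ} {d w : ℂ} {ω ω' p : ℝ} (hω : 0 < ω) (hω' : 0 < ω')

/-- Parameters on the axes of a rhombic lattice. The parameter is its own reflection, and conjugation
exchanges the half periods `ω₁` and `ω₃` and fixes the other two. -/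
lemma rhombPair_axis_real
    (hd : (0 < Q.A ∧ d = 1 ∧ p = ω) ∨ (Q.A < 0 ∧ d = Complex.I ∧ p = ω'))
    {e₂ : ℝ} (he2 : (rhombPair hω hω').e 2 = e₂) (hx : 0 ≤ (Q.D / Q.A - e₂) / Q.A)
    {ε : ℝ} (h0 : 0 < ε) (h1 : ε < 1) (hwε : w = ((2 * ε * p : ℝ) : ℂ) * d)
    (hw : Q.toComplex.IsParameter Q.rootA (rhombPair hω hω') w) :
    (ε < 1 / 2 ↔ 0 < Q.E) ∧ (1 / 2 < ε ↔ Q.E < 0) ∧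
      conj ((rhombPair hω hω').sigmaRatio 1 w / Q.rootA) =
        (rhombPair hω hω').sigmaRatio 3 w / Q.rootA ∧
      ((rhombPair hω hω').sigmaRatio 2 w / Q.rootA).im = 0 ∧
      (Q.toComplex.root Q.rootA (rhombPair hω hω') w 0).im = 0 ∧
      (Q.toComplex.root Q.rootA (rhombPair hω hω') w 2).im = 0 ∧
      (Q.toComplex.root Q.rootA (rhombPair hω hω') w 1).im ≠ 0 ∧
      conj (Q.toComplex.root Q.rootA (rhombPair hω hω') w 1) =
        Q.toComplex.root Q.rootA (rhombPair hω hω') w 3 ∧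
      Q.toComplex.RealValued Q.rootA (rhombPair hω hω') w 0 ∧
      Q.toComplex.RealValued Q.rootA (rhombPair hω hω') w 2 ∧
      Q.toComplex.ConjugateValued Q.rootA (rhombPair hω hω') w 1 3 ∧
      ∀ u : ℝ, (∀ n : ℤ, u ≠ (2 * n + 1) * ω / 2) →
        (Q.toComplex.phi Q.rootA (rhombPair hω hω') w
          (u + (rhombPair hω hω').halfPeriod 1)).im ≠ 0 ∧
        (Q.toComplex.phi Q.rootA (rhombPair hω hω') w
          (u + (rhombPair hω hω').halfPeriod 3)).im ≠ 0 := by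
  have hconj := PeriodPair.conj_mem_lattice_rhombPair hω hω'
  have hd' : (0 < Q.A ∧ d = 1) ∨ (Q.A < 0 ∧ d = Complex.I) :=
    hd.imp (fun h ↦ ⟨h.1, h.2.1⟩) fun h ↦ ⟨h.1, h.2.1⟩
  obtain ⟨-, hA', -⟩ := ne_zero_of_sign hd'
  have hs := rootA_sq hd'
  obtain ⟨hh1, hh2, hh3⟩ := PeriodPair.halfPeriod_rhombPair hω hω'
  obtain ⟨hc1, hc2⟩ := PeriodPair.conj_e_rhombPair hω hω'
  have hh0 := PeriodPair.halfPeriod_zero (rhombPair hω hω')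
  obtain ⟨-, hp, hL⟩ := PeriodPair.rhombPair_axis hω hω' (hd.imp And.right And.right)
  have hwd : d ^ 2 * conj w = w := by
    rw [hwε]
    rcases hd with ⟨-, rfl, -⟩ | ⟨-, rfl, -⟩ <;> simp [map_ofNat]
  have hcv {k m : Fin 4} (h : conj ((rhombPair hω hω').halfPeriod k) =
      (rhombPair hω hω').halfPeriod m) :
      Q.toComplex.ConjugateValued Q.rootA (rhombPair hω hω') w k m :=
    conjugateValued hconj hd' hw.1 (zero_mem _) (by rw [hwd, add_zero]) (by
      rw [h]
      simp)
  have c00 := hcv (k := 0) (m := 0) (by rw [hh0, map_zero])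
  have c22 := hcv (k := 2) (m := 2) (by rw [hh2, Complex.conj_ofReal])
  have c13 := hcv (k := 1) (m := 3) (by rw [hh1, hh3]; simp [map_ofNat])
  have c31 := hcv (k := 3) (m := 1) (by rw [hh1, hh3]; simp [map_ofNat, sub_eq_add_neg])
  have hsign := sign_E_axis hconj hd' hp hL h0 h1 (hwε ▸ hw)
  refine ⟨hsign.1, hsign.2, conj_sigmaRatio_div hconj hd' hw.1 hwd (by decide) (by decide) hc1,
    Complex.im_eq_zero_of_sq_eq (sigmaRatio_div_sq hd' hw (by decide) he2) hx,
    root_im_eq_zero hw.1 c00, root_im_eq_zero hw.1 c22,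
    root_im_ne_zero hA' hs hw.1 (by decide) c13, conj_root hw.1 c13, realValued c00,
    realValued c22, c13, fun u hu ↦ ?_⟩
  refine phi_im_ne_zero hA' hs hw.1 (by decide) c13 c31 (fun j hj ↦ ?_) ?_
  · have hre : ((rhombPair hω hω').halfPeriod j).re = ω / 2 := by
      rcases hj with rfl | rfl
      · rw [hh1]; simp
      · rw [hh3]; simp
    obtain ⟨k, hk⟩ : ∃ k : ℤ, ((rhombPair hω hω').halfPeriod j).im = (k + 1 / 2) * ω' := by
      rcases hj with rfl | rfl
      · exact ⟨-1, by rw [hh1]; simp; ring⟩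
      · exact ⟨0, by rw [hh3]; simp; ring⟩
    rw [PeriodPair.mem_rhombPair, PeriodPair.mem_rhombPair]
    -- For horizontal `w` the imaginary part is not a multiple of `ω'`; for vertical `w` the real
    -- part is a multiple of `ω` only for the excluded `u`.
    rcases hd with ⟨-, rfl, -⟩ | ⟨-, rfl, -⟩
    · have him : (w / 2).im = 0 := by rw [hwε]; simp
      constructor <;> rintro ⟨m, n, -, -, hn⟩
      · rw [Complex.sub_im, Complex.add_im, him, hk, Complex.ofReal_im, zero_add, sub_zero] at hn
        exact half_odd_mul_ne hω'.ne' k n hn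
      · rw [Complex.add_im, Complex.add_im, him, hk, Complex.ofReal_im, zero_add, add_zero] at hn
        exact half_odd_mul_ne hω'.ne' k n hn
    · have hre' : (w / 2).re = 0 := by rw [hwε]; simp
      constructor <;> rintro ⟨m, n, -, hm, -⟩
      · rw [Complex.sub_re, Complex.add_re, hre, hre', Complex.ofReal_re] at hm
        exact hu (m - 1) (by push_cast; linarith)
      · rw [Complex.add_re, Complex.add_re, hre, hre', Complex.ofReal_re] at hm
        exact hu (m - 1) (by push_cast; linarith)
  · have h2 : (2 * u : ℂ) + (rhombPair hω hω').halfPeriod 1 + (rhombPair hω hω').halfPeriod 3 =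
        ((2 * u + ω : ℝ) : ℂ) := by
      rw [hh1, hh3]
      push_cast
      ring
    rw [h2, PeriodPair.ofReal_mem_rhombPair]
    rintro ⟨n, hn⟩
    exact hu (n - 1) (by push_cast; linarith)

end Rhomb

end QuarticForm

/-! ### Existence of the parameter for real quartics -/

namespace PeriodPair

open scoped ComplexConjugate

/-- A lattice with real invariants is rectangular or rhombic, and its half axes are the least real
zeros of `℘'` for the invariants `g₂, ± g₃`. -/
lemma exists_isLeastRealZero {L M : PeriodPair} {a b : ℝ} (hL2 : L.g₂ = a) (hL3 : L.g₃ = b)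
    (hM2 : M.g₂ = a) (hM3 : M.g₃ = -(b : ℂ)) :
    ∃ (ω ω' : ℝ) (hω : 0 < ω) (hω' : 0 < ω'), IsLeastRealZero L ω ∧ IsLeastRealZero M ω' ∧
      ((rectPair hω hω').lattice = L.lattice ∨ (rhombPair hω hω').lattice = L.lattice) := by
  obtain ⟨ω, ω', hω, hω', h⟩ := L.exists_lattice_eq_rectPair_or_rhombPair fun z hz ↦
    conj_mem_lattice (by rw [hL2, Complex.conj_ofReal]) (by rw [hL3, Complex.conj_ofReal]) hz
  have hML := ofReal_mem_lattice_of_neg_g₃ (hM2.trans hL2.symm) (by rw [hM3, hL3])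
  refine ⟨ω, ω', hω, hω', isLeastRealZero_of_mem_iff hω fun x ↦ ?_,
    isLeastRealZero_of_mem_iff hω' fun x ↦ ?_, h⟩
  · rcases h with h | h <;> rw [← h]
    · exact ofReal_mem_rectPair hω hω'
    · exact ofReal_mem_rhombPair hω hω'
  · rw [hML]
    rcases h with h | h <;> rw [← h]
    · exact ofReal_mul_I_mem_rectPair hω hω'
    · exact ofReal_mul_I_mem_rhombPair hω hω'

lemma cubic_rectPair {ω ω' : ℝ} (hω : 0 < ω) (hω' : 0 < ω') {a b e₁ e₂ e₃ : ℝ}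
    (h2 : (rectPair hω hω').g₂ = a) (h3 : (rectPair hω hω').g₃ = b)
    (he1 : (rectPair hω hω').e 1 = e₁) (he2 : (rectPair hω hω').e 2 = e₂)
    (he3 : (rectPair hω hω').e 3 = e₃) (t : ℝ) :
    4 * t ^ 3 - a * t - b = 4 * (t - e₁) * (t - e₂) * (t - e₃) := by
  have := (rectPair hω hω').cubic_eq t
  rw [h2, h3, he1, he2, he3] at this
  exact_mod_cast this

end PeriodPair

namespace QuarticForm

open scoped PeriodPair ComplexConjugate
open PeriodPair (rectPair rhombPair)

variable {Q : QuarticForm ℝ} {ω ω' : ℝ} (hω : 0 < ω) (hω' : 0 < ω')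

lemma exists_parameter_rectPair_axis {d : ℂ} {p : ℝ} {j : Fin 4}
    (hd : (0 < Q.A ∧ d = 1 ∧ p = ω ∧ j = 1) ∨ (Q.A < 0 ∧ d = Complex.I ∧ p = ω' ∧ j = 3))
    (hg₂ : (rectPair hω hω').g₂ = Q.g₂) (hg₃ : (rectPair hω hω').g₃ = Q.g₃)
    (hx : (d ^ 2 * (rectPair hω hω').e j).re ≤ (d ^ 2).re * (Q.D / Q.A)) :
    ∃ ε : ℝ, 0 < ε ∧ ε < 1 ∧
      Q.toComplex.IsParameter Q.rootA (rectPair hω hω') (((2 * ε * p : ℝ) : ℂ) * d) := by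
  obtain ⟨-, hp, hL⟩ := PeriodPair.rectPair_axis hω hω'
    (hd.imp (fun h ↦ ⟨h.2.1, h.2.2.1⟩) fun h ↦ ⟨h.2.1, h.2.2.1⟩)
  obtain ⟨hh1, hh2, hh3⟩ := PeriodPair.halfPeriod_rectPair hω hω'
  refine exists_parameter_axis (PeriodPair.conj_mem_lattice_rectPair hω hω')
    (hd.imp (fun h ↦ ⟨h.1, h.2.1⟩) fun h ↦ ⟨h.1, h.2.1⟩) hg₂ hg₃ hp hL ?_
  convert hx using 4
  rcases hd with ⟨-, rfl, rfl, rfl⟩ | ⟨-, rfl, rfl, rfl⟩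
  · rw [PeriodPair.e, hh1, mul_one]
  · rw [PeriodPair.e, hh3]

lemma exists_parameter_rectPair_side {b d : ℂ} {p : ℝ} {j : Fin 4}
    (hd : (0 < Q.A ∧ b = ω' * Complex.I ∧ d = 1 ∧ p = ω ∧ j = 3) ∨
      (Q.A < 0 ∧ b = ω ∧ d = Complex.I ∧ p = ω' ∧ j = 1))
    (hg₂ : (rectPair hω hω').g₂ = Q.g₂) (hg₃ : (rectPair hω hω').g₃ = Q.g₃)
    (hx1 : (d ^ 2 * (rectPair hω hω').e j).re ≤ (d ^ 2).re * (Q.D / Q.A))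
    (hx2 : (d ^ 2).re * (Q.D / Q.A) ≤ (d ^ 2 * (rectPair hω hω').e 2).re) :
    ∃ ε : ℝ, 0 ≤ ε ∧ ε < 1 ∧
      Q.toComplex.IsParameter Q.rootA (rectPair hω hω') (b + ((2 * ε * p : ℝ) : ℂ) * d) := by
  obtain ⟨hline, hp, hmem, -, hvert⟩ := PeriodPair.rectPair_side hω hω'
    (hd.imp (fun h ↦ ⟨h.2.1, h.2.2.1, h.2.2.2.1⟩) fun h ↦ ⟨h.2.1, h.2.2.1, h.2.2.2.1⟩)
  obtain ⟨hh1, hh2, hh3⟩ := PeriodPair.halfPeriod_rectPair hω hω'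
  have hb : (rectPair hω hω').halfPeriod j = b := by
    rcases hd with ⟨-, rfl, -, -, rfl⟩ | ⟨-, rfl, -, -, rfl⟩
    exacts [hh3, hh1]
  refine exists_parameter_side (PeriodPair.conj_mem_lattice_rectPair hω hω')
    (hd.imp (fun h ↦ ⟨h.1, h.2.2.1⟩) fun h ↦ ⟨h.1, h.2.2.1⟩) hg₂ hg₃ hp hline hmem ?_ ?_ ?_ ?_
  · rw [← hb]
    exact PeriodPair.two_mul_halfPeriod_mem _ _
  · rw [hvert, ← hh2]
    exact PeriodPair.two_mul_halfPeriod_mem _ _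
  · rwa [← hb]
  · rwa [hvert, ← hh2]

/-- `D / A` lies on the side of the real root of the cubic determined by the sign of `A`. -/
lemma D_div_sub_div_nonneg (hA : Q.A ≠ 0) (hg₂ : (rhombPair hω hω').g₂ = Q.g₂)
    (hg₃ : (rhombPair hω hω').g₃ = Q.g₃) {e₂ : ℝ} (he2 : (rhombPair hω hω').e 2 = e₂) :
    0 ≤ (Q.D / Q.A - e₂) / Q.A := by
  have him := PeriodPair.e_rhombPair_im_neg hω hω'
  have h := (rhombPair hω hω').cubic_eq ((Q.D / Q.A : ℝ) : ℂ)
  obtain ⟨hc, -⟩ := PeriodPair.conj_e_rhombPair hω hω'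
  set z := ((Q.D / Q.A : ℝ) : ℂ) - (rhombPair hω hω').e 1 with hz
  have hz' : ((Q.D / Q.A : ℝ) : ℂ) - (rhombPair hω hω').e 3 = conj z := by
    rw [hz, map_sub, hc, Complex.conj_ofReal]
  have hpos : 0 < Complex.normSq z := by
    rw [Complex.normSq_pos, ← map_ne_zero (starRingEnd ℂ), ← hz']
    intro h0
    have := congrArg Complex.im h0
    rw [Complex.sub_im, Complex.ofReal_im, Complex.zero_im] at this
    linarith
  rw [hg₂, hg₃, hz', he2] at h
  have h1 : 4 * (Q.D / Q.A) ^ 3 - Q.g₂ * (Q.D / Q.A) - Q.g₃ =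
      4 * (Q.D / Q.A - e₂) * Complex.normSq z := by
    rw [← Complex.ofReal_inj]
    push_cast [← Complex.mul_conj]
    rw [Complex.ofReal_div] at h
    rw [h]
    ring
  rw [cubic_eq_sq_div hA] at h1
  have h2 : (Q.D / Q.A - e₂) / Q.A = (Q.E / Q.A ^ 2) ^ 2 / (4 * Complex.normSq z) := by
    rw [eq_div_iff (by positivity), div_mul_eq_mul_div, div_eq_iff hA]
    calc _ = 4 * (Q.D / Q.A - e₂) * Complex.normSq z := by ring
      _ = _ := by
        rw [← h1]
        field_simp
  rw [h2]
  positivity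

lemma exists_parameter_rhombPair_axis {d : ℂ} {p : ℝ}
    (hd : (0 < Q.A ∧ d = 1 ∧ p = ω) ∨ (Q.A < 0 ∧ d = Complex.I ∧ p = ω'))
    (hg₂ : (rhombPair hω hω').g₂ = Q.g₂) (hg₃ : (rhombPair hω hω').g₃ = Q.g₃)
    (hx : (d ^ 2 * (rhombPair hω hω').e 2).re ≤ (d ^ 2).re * (Q.D / Q.A)) :
    ∃ ε : ℝ, 0 < ε ∧ ε < 1 ∧
      Q.toComplex.IsParameter Q.rootA (rhombPair hω hω') (((2 * ε * p : ℝ) : ℂ) * d) := by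
  have hd' := hd.imp And.right And.right
  obtain ⟨-, hp, hL⟩ := PeriodPair.rhombPair_axis hω hω' hd'
  refine exists_parameter_axis (PeriodPair.conj_mem_lattice_rhombPair hω hω')
    (hd.imp (fun h ↦ ⟨h.1, h.2.1⟩) fun h ↦ ⟨h.1, h.2.1⟩) hg₂ hg₃ hp hL ?_
  rwa [PeriodPair.weierstrassP_axis_rhombPair hω hω' hd']

end QuarticForm

end

theorem mainTheorem7 :
    -- complex coefficients
    (∀ Q : QuarticForm ℂ, Q.A ≠ 0 → Squarefree Q.poly →
      Q.g₂ ^ 3 - 27 * Q.g₃ ^ 2 ≠ 0 ∧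
      (∃ L : PeriodPair, L.g₂ = Q.g₂ ∧ L.g₃ = Q.g₃) ∧
      ∀ s : ℂ, s ^ 2 = Q.A → ∀ L : PeriodPair, L.g₂ = Q.g₂ → L.g₃ = Q.g₃ →
        (∃ w, Q.IsParameter s L w) ∧
        ∀ w, Q.IsParameter s L w →
          -- the two expressions of `φ₀`
          (∀ u, u ∉ L.lattice → L.weierstrassP u ≠ L.weierstrassP w →
            Q.phi0 s L w u = -Q.B / Q.A + 1 / (2 * s) *
              ((L.derivWeierstrassP u + L.derivWeierstrassP w) /
                (L.weierstrassP u - L.weierstrassP w))) ∧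
          -- `φ₀` satisfies the differential equation away from its poles
          (∀ u, u ∉ L.lattice → u - w ∉ L.lattice →
            DifferentiableAt ℂ (Q.phi0 s L w) u ∧
              deriv (Q.phi0 s L w) u ^ 2 = Q.poly.eval (Q.phi0 s L w u)) ∧
          -- the general solution
          (∀ U : Set ℂ, IsOpen U → IsConnected U → ∀ x : ℂ → ℂ,
            IsQuarticSolution Q.poly U x ↔
              ∃ u₀ : ℂ, x =ᶠ[codiscreteWithin U] fun u => Q.phi0 s L w (u - u₀)) ∧
          -- behaviour at `u = u₀`
          Tendsto (Q.phi0 s L w) (𝓝[≠] 0) (Bornology.cobounded ℂ) ∧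
          Tendsto (fun u => deriv (Q.phi0 s L w) u / Q.phi0 s L w u ^ 2) (𝓝[≠] 0) (𝓝 s) ∧
          -- symmetry of `φ₀`, and change of `w` by a period
          (∀ u, Q.phi0 s L w (-u + w) = Q.phi0 s L w u) ∧
          (∀ l ∈ L.lattice, Q.IsParameter s L (w + l) ∧
            ∀ u, u + l / 2 - w / 2 ∉ L.lattice → u + l / 2 + w / 2 ∉ L.lattice →
              Q.phi s L (w + l) u = Q.phi s L w (u + l / 2)) ∧
          -- `φ(u, w)` through `℘`
          L.derivWeierstrassP (w / 2) ≠ 0 ∧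
          (∀ u, u ∉ L.lattice → u - w / 2 ∉ L.lattice → u + w / 2 ∉ L.lattice →
            L.weierstrassP u - L.weierstrassP (w / 2) ≠ 0 ∧
            Q.phi s L w u = -Q.B / Q.A + 1 / s *
              (L.derivWeierstrassP (w / 2) / (L.weierstrassP u - L.weierstrassP (w / 2)) +
                1 / 2 * (deriv L.derivWeierstrassP (w / 2) / L.derivWeierstrassP (w / 2)))) ∧
          -- four even solutions, and no others
          (∀ k : Fin 4,
            IsQuarticSolution Q.poly Set.univ (fun u => Q.phi s L w (u + L.halfPeriod k)) ∧
            ∀ u, u + L.halfPeriod k - w / 2 ∉ L.lattice →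
              u + L.halfPeriod k + w / 2 ∉ L.lattice →
              Q.phi s L w (-u + L.halfPeriod k) = Q.phi s L w (u + L.halfPeriod k)) ∧
          (∀ x : ℂ → ℂ, IsQuarticSolution Q.poly Set.univ x →
            (∀ᶠ u in codiscrete ℂ, x (-u) = x u) →
            ∃ k : Fin 4, x =ᶠ[codiscrete ℂ] fun u => Q.phi s L w (u + L.halfPeriod k)) ∧
          -- their values at `u = 0` are the four different roots of `R`
          (∀ k : Fin 4, L.halfPeriod k - w / 2 ∉ L.lattice ∧ L.halfPeriod k + w / 2 ∉ L.lattice) ∧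
          Function.Injective (Q.root s L w) ∧
          Q.poly = Polynomial.C Q.A * ∏ k : Fin 4, (X - Polynomial.C (Q.root s L w k)) ∧
          -- explicit formulas
          (∀ k : Fin 4, L.derivWeierstrassP (w / 2 + L.halfPeriod k) ≠ 0 ∧
            Q.root s L w k = -Q.B / Q.A + 1 / (2 * s) *
              (deriv L.derivWeierstrassP (w / 2 + L.halfPeriod k) /
                L.derivWeierstrassP (w / 2 + L.halfPeriod k))) ∧
          L.weierstrassSigma w ≠ 0 ∧
          (∀ j : Fin 4, j ≠ 0 → L.sigmaRatio j w ^ 2 = Q.D / Q.A - L.e j) ∧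
          L.sigmaRatio 1 w * L.sigmaRatio 2 w * L.sigmaRatio 3 w = Q.E / (2 * Q.A * s) ∧
          (∀ k : Fin 4, Q.root s L w k = -Q.B / Q.A - L.h0 k w / s) ∧
          (∀ k : Fin 4, ∀ u, u ∉ L.lattice → u + L.halfPeriod k - w / 2 ∉ L.lattice →
            u + L.halfPeriod k + w / 2 ∉ L.lattice →
            L.h1 k w * L.weierstrassP u + L.h2 k w ≠ 0 ∧
            Q.phi s L w (u + L.halfPeriod k) = -Q.B / Q.A - L.h0 k w / s -
              2 / s * ((L.e 2 - L.e 3) * (L.e 3 - L.e 1) * (L.e 1 - L.e 2) /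
                (L.h1 k w * L.weierstrassP u + L.h2 k w)))) ∧
    -- real coefficients
    (∀ Q : QuarticForm ℝ, Q.A ≠ 0 → Squarefree Q.toComplex.poly →
      (∃ M : PeriodPair, M.g₂ = (Q.g₂ : ℂ) ∧ M.g₃ = -(Q.g₃ : ℂ)) ∧
      ∀ L M : PeriodPair, L.g₂ = (Q.g₂ : ℂ) → L.g₃ = (Q.g₃ : ℂ) →
        M.g₂ = (Q.g₂ : ℂ) → M.g₃ = -(Q.g₃ : ℂ) →
        ∃ ω ω' : ℝ, IsLeastRealZero L ω ∧ IsLeastRealZero M ω' ∧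
          -- case I
          (0 < Q.g₂ ^ 3 - 27 * Q.g₃ ^ 2 →
            ∃ P : PeriodPair, P.lattice = L.lattice ∧
              P.ω₁ = 2 * (ω : ℂ) ∧ P.ω₂ = 2 * (ω' : ℂ) * Complex.I ∧
              ∃ e₁ e₂ e₃ : ℝ, P.e 1 = (e₁ : ℂ) ∧ P.e 2 = (e₂ : ℂ) ∧ P.e 3 = (e₃ : ℂ) ∧
                e₂ < e₁ ∧ e₃ < e₂ ∧
                (∀ t : ℝ, 4 * t ^ 3 - Q.g₂ * t - Q.g₃ = 4 * (t - e₁) * (t - e₂) * (t - e₃)) ∧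
                (0 < Q.A → e₁ ≤ Q.D / Q.A ∨ (e₃ ≤ Q.D / Q.A ∧ Q.D / Q.A ≤ e₂)) ∧
                (Q.A < 0 → Q.D / Q.A ≤ e₃ ∨ (e₂ ≤ Q.D / Q.A ∧ Q.D / Q.A ≤ e₁)) ∧
                -- 1)
                (0 < Q.A → e₁ ≤ Q.D / Q.A →
                  (∃ ε : ℝ, 0 < ε ∧ ε < 1 ∧
                    Q.toComplex.IsParameter Q.rootA P (2 * (ε : ℂ) * ω)) ∧
                  ∀ (ε : ℝ) (w : ℂ), 0 < ε → ε < 1 → w = 2 * (ε : ℂ) * ω →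
                    Q.toComplex.IsParameter Q.rootA P w →
                    (ε < 1 / 2 ↔ 0 < Q.E) ∧ (1 / 2 < ε ↔ Q.E < 0) ∧
                    (∀ j : Fin 4, j ≠ 0 → (P.sigmaRatio j w / Q.rootA).im = 0) ∧
                    (∀ k, (Q.toComplex.root Q.rootA P w k).im = 0) ∧
                    ∀ k, Q.toComplex.RealValued Q.rootA P w k) ∧
                -- 2)
                (Q.A < 0 → Q.D / Q.A ≤ e₃ →
                  (∃ ε : ℝ, 0 < ε ∧ ε < 1 ∧
                    Q.toComplex.IsParameter Q.rootA P (2 * (ε : ℂ) * ω' * Complex.I)) ∧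
                  ∀ (ε : ℝ) (w : ℂ), 0 < ε → ε < 1 → w = 2 * (ε : ℂ) * ω' * Complex.I →
                    Q.toComplex.IsParameter Q.rootA P w →
                    (ε < 1 / 2 ↔ 0 < Q.E) ∧ (1 / 2 < ε ↔ Q.E < 0) ∧
                    (∀ j : Fin 4, j ≠ 0 → (P.sigmaRatio j w / Q.rootA).im = 0) ∧
                    (∀ k, (Q.toComplex.root Q.rootA P w k).im = 0) ∧
                    ∀ k, Q.toComplex.RealValued Q.rootA P w k) ∧
                -- 3)
                (0 < Q.A → e₃ ≤ Q.D / Q.A → Q.D / Q.A ≤ e₂ →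
                  (∃ ε : ℝ, 0 ≤ ε ∧ ε < 1 ∧
                    Q.toComplex.IsParameter Q.rootA P (2 * (ε : ℂ) * ω + ω' * Complex.I)) ∧
                  ∀ (ε : ℝ) (w : ℂ), 0 ≤ ε → ε < 1 → w = 2 * (ε : ℂ) * ω + ω' * Complex.I →
                    Q.toComplex.IsParameter Q.rootA P w →
                    (0 < ε ∧ ε < 1 / 2 ↔ Q.E < 0) ∧ (1 / 2 < ε ↔ 0 < Q.E) ∧
                    (P.sigmaRatio 1 w / Q.rootA).re = 0 ∧
                    (P.sigmaRatio 2 w / Q.rootA).re = 0 ∧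
                    (P.sigmaRatio 3 w / Q.rootA).im = 0 ∧
                    (∀ k, (Q.toComplex.root Q.rootA P w k).im ≠ 0) ∧
                    (starRingEnd ℂ) (Q.toComplex.root Q.rootA P w 0) =
                      Q.toComplex.root Q.rootA P w 3 ∧
                    (starRingEnd ℂ) (Q.toComplex.root Q.rootA P w 1) =
                      Q.toComplex.root Q.rootA P w 2 ∧
                    Q.toComplex.ConjugateValued Q.rootA P w 0 3 ∧
                    Q.toComplex.ConjugateValued Q.rootA P w 1 2 ∧
                    ∀ (k : Fin 4) (u : ℝ),
                      (Q.toComplex.phi Q.rootA P w (u + P.halfPeriod k)).im ≠ 0) ∧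
                -- 4)
                (Q.A < 0 → e₂ ≤ Q.D / Q.A → Q.D / Q.A ≤ e₁ →
                  (∃ ε : ℝ, 0 ≤ ε ∧ ε < 1 ∧
                    Q.toComplex.IsParameter Q.rootA P (ω + 2 * (ε : ℂ) * ω' * Complex.I)) ∧
                  ∀ (ε : ℝ) (w : ℂ), 0 ≤ ε → ε < 1 → w = ω + 2 * (ε : ℂ) * ω' * Complex.I →
                    Q.toComplex.IsParameter Q.rootA P w →
                    (0 < ε ∧ ε < 1 / 2 ↔ Q.E < 0) ∧ (1 / 2 < ε ↔ 0 < Q.E) ∧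
                    (P.sigmaRatio 1 w / Q.rootA).im = 0 ∧
                    (P.sigmaRatio 2 w / Q.rootA).re = 0 ∧
                    (P.sigmaRatio 3 w / Q.rootA).re = 0 ∧
                    (∀ k, (Q.toComplex.root Q.rootA P w k).im ≠ 0) ∧
                    (starRingEnd ℂ) (Q.toComplex.root Q.rootA P w 0) =
                      Q.toComplex.root Q.rootA P w 1 ∧
                    (starRingEnd ℂ) (Q.toComplex.root Q.rootA P w 2) =
                      Q.toComplex.root Q.rootA P w 3 ∧
                    Q.toComplex.ConjugateValued Q.rootA P w 0 1 ∧
                    Q.toComplex.ConjugateValued Q.rootA P w 2 3 ∧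
                    ∀ (k : Fin 4) (u : ℝ), (∀ n : ℤ, u ≠ (2 * n + 1) * ω / 2) →
                      (Q.toComplex.phi Q.rootA P w (u + P.halfPeriod k)).im ≠ 0)) ∧
          -- case II
          (Q.g₂ ^ 3 - 27 * Q.g₃ ^ 2 < 0 →
            ∃ P : PeriodPair, P.lattice = L.lattice ∧
              P.ω₁ = (ω : ℂ) - ω' * Complex.I ∧ P.ω₂ = (ω : ℂ) + ω' * Complex.I ∧
              ∃ e₂ : ℝ, P.e 2 = (e₂ : ℂ) ∧ (starRingEnd ℂ) (P.e 1) = P.e 3 ∧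
                P.e 2 = -(P.e 1 + P.e 3) ∧
                (∃ r : ℝ, 0 < r ∧ (P.e 1 - P.e 3) / Complex.I = (r : ℂ)) ∧
                (∀ t : ℂ, 4 * t ^ 3 - Q.g₂ * t - Q.g₃ =
                  4 * (t - P.e 1) * (t - P.e 2) * (t - P.e 3)) ∧
                (0 < Q.A → e₂ ≤ Q.D / Q.A) ∧
                (Q.A < 0 → Q.D / Q.A ≤ e₂) ∧
                -- existence of `w`: 5) and 6)
                (0 < Q.A → ∃ ε : ℝ, 0 < ε ∧ ε < 1 ∧
                  Q.toComplex.IsParameter Q.rootA P (2 * (ε : ℂ) * ω)) ∧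
                (Q.A < 0 → ∃ ε : ℝ, 0 < ε ∧ ε < 1 ∧
                  Q.toComplex.IsParameter Q.rootA P (2 * (ε : ℂ) * ω' * Complex.I)) ∧
                -- properties common to 5) and 6)
                ∀ (ε : ℝ) (w : ℂ), 0 < ε → ε < 1 →
                  ((0 < Q.A ∧ w = 2 * (ε : ℂ) * ω) ∨
                    (Q.A < 0 ∧ w = 2 * (ε : ℂ) * ω' * Complex.I)) →
                  Q.toComplex.IsParameter Q.rootA P w →
                  (ε < 1 / 2 ↔ 0 < Q.E) ∧ (1 / 2 < ε ↔ Q.E < 0) ∧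
                  (starRingEnd ℂ) (P.sigmaRatio 1 w / Q.rootA) = P.sigmaRatio 3 w / Q.rootA ∧
                  (P.sigmaRatio 2 w / Q.rootA).im = 0 ∧
                  (Q.toComplex.root Q.rootA P w 0).im = 0 ∧
                  (Q.toComplex.root Q.rootA P w 2).im = 0 ∧
                  (Q.toComplex.root Q.rootA P w 1).im ≠ 0 ∧
                  (starRingEnd ℂ) (Q.toComplex.root Q.rootA P w 1) =
                    Q.toComplex.root Q.rootA P w 3 ∧
                  Q.toComplex.RealValued Q.rootA P w 0 ∧
                  Q.toComplex.RealValued Q.rootA P w 2 ∧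
                  Q.toComplex.ConjugateValued Q.rootA P w 1 3 ∧
                  ∀ u : ℝ, (∀ n : ℤ, u ≠ (2 * n + 1) * ω / 2) →
                    (Q.toComplex.phi Q.rootA P w (u + P.halfPeriod 1)).im ≠ 0 ∧
                    (Q.toComplex.phi Q.rootA P w (u + P.halfPeriod 3)).im ≠ 0)) := by
  refine ⟨fun Q hA hsq ↦ ⟨Q.discriminant_ne_zero hA hsq,
    PeriodPair.exists_g₂_eq_and_g₃_eq (Q.discriminant_ne_zero hA hsq),
    fun s hs L hg₂ hg₃ ↦ ⟨QuarticForm.exists_isParameter hA hs hg₂ hg₃, fun w hw ↦ ?_⟩⟩, ?_⟩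
  · have hs0 := QuarticForm.root_ne_zero_of_sq hA hs
    have h0 (k : Fin 4) : L.halfPeriod k - w / 2 ∉ L.lattice ∧ L.halfPeriod k + w / 2 ∉ L.lattice :=
      QuarticForm.halfPeriod_half_notMem hw.1 k
    refine ⟨fun u hu hne ↦ ?_,
      fun u hu huw ↦ ⟨(QuarticForm.analyticAt_phi0 hu huw).differentiableAt,
        QuarticForm.deriv_phi0_sq hA hs hg₂ hw hu huw⟩,
      fun U hU hUc x ↦ QuarticForm.isQuarticSolution_iff hA hs hg₂ hw hU hUc x,
      QuarticForm.tendsto_phi0_cobounded hs0 hw.1,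
      QuarticForm.tendsto_deriv_phi0_div_sq hs0 hw.1,
      QuarticForm.phi0_reflect,
      fun l hl ↦ ⟨hw.add_mem hl, fun u h1 _ ↦ QuarticForm.phi_parameter_add hw.1 hl h1⟩,
      by simpa using (QuarticForm.root_eq (Q := Q) (s := s) hw.1 0).1,
      fun u hu h1 h2 ↦ QuarticForm.phi_eq hw.1 hu h1 h2,
      fun k ↦ ⟨QuarticForm.isQuarticSolution_phi_add hA hs hg₂ hw k,
        fun u h1 h2 ↦ QuarticForm.phi_neg_add_halfPeriod k h1 h2⟩,
      fun x hx hev ↦ QuarticForm.exists_eq_phi_add_of_even hA hs hg₂ hw hx hev,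
      h0,
      QuarticForm.root_injective hs0 hw.1,
      QuarticForm.poly_eq_prod hA hs hg₂ hw,
      QuarticForm.root_eq hw.1,
      L.weierstrassSigma_ne_zero hw.1,
      fun j hj ↦ by rw [L.sigmaRatio_sq hj hw.1, hw.2.1],
      ?_,
      QuarticForm.root_eq_h0 hw.1,
      fun k u hu h1 h2 ↦ QuarticForm.phi_add_halfPeriod_eq_h hw.1 k hu h1 h2⟩
    · rw [QuarticForm.phi0, L.zeta_sub_sub_zeta_add_zeta hu hw.1 hne]
      ring
    · rw [L.sigmaRatio_mul hw.1, hw.2.2]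
      field_simp
  · refine fun Q hA hsq ↦ ⟨?_, fun L M hL2 hL3 hM2 hM3 ↦ ?_⟩
    · refine PeriodPair.exists_g₂_eq_and_g₃_eq ?_
      rw [neg_sq, ← QuarticForm.toComplex_g₂, ← QuarticForm.toComplex_g₃]
      exact Q.toComplex.discriminant_ne_zero (Complex.ofReal_ne_zero.mpr hA) hsq
    obtain ⟨ω, ω', hω, hω', hωL, hωM, hcase⟩ :=
      PeriodPair.exists_isLeastRealZero hL2 hL3 hM2 hM3
    refine ⟨ω, ω', hωL, hωM, fun hdisc ↦ ?_, fun hdisc ↦ ?_⟩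
    · have hlat : (PeriodPair.rectPair hω hω').lattice = L.lattice := hcase.resolve_right fun h ↦
        hdisc.not_gt <| PeriodPair.discriminant_rhombPair hω hω'
          ((PeriodPair.g₂_congr h).trans hL2) ((PeriodPair.g₃_congr h).trans hL3)
      have hg₂ := (PeriodPair.g₂_congr hlat).trans hL2
      have hg₃ := (PeriodPair.g₃_congr hlat).trans hL3
      obtain ⟨e₁, e₂, e₃, he1, he2, he3, h12, h23⟩ := PeriodPair.e_rectPair hω hω'
      have hcubic := PeriodPair.cubic_rectPair hω hω' hg₂ hg₃ he1 he2 he3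
      have hsq := (hcubic _).symm.trans (QuarticForm.cubic_eq_sq_div hA)
      have hreal {x : ℝ} (h : ∀ e ∈ ({e₁, e₂, e₃} : Set ℝ), 0 ≤ (x - e) / Q.A) (j : Fin 4)
          (hj : j ≠ 0) : ∃ e : ℝ, (PeriodPair.rectPair hω hω').e j = e ∧ 0 ≤ (x - e) / Q.A := by
        fin_cases j
        · exact absurd rfl hj
        · exact ⟨e₁, he1, h _ (by simp)⟩
        · exact ⟨e₂, he2, h _ (by simp)⟩
        · exact ⟨e₃, he3, h _ (by simp)⟩
      refine ⟨PeriodPair.rectPair hω hω', hlat, rfl, rfl, e₁, e₂, e₃, he1, he2, he3, h12, h23,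
        hcubic, fun hA ↦ QuarticForm.le_or_mem_of_cubic_nonneg h23 ?_,
        fun hA ↦ QuarticForm.le_or_mem_of_cubic_nonpos h12 ?_, fun hA hx ↦ ⟨?_, ?_⟩,
        fun hA hx ↦ ⟨?_, ?_⟩, fun hA hx3 hx2 ↦ ⟨?_, fun ε w h0 h1 hwε hw ↦
          QuarticForm.rectPair_horizontal_side hω hω' hA he1 he2 he3 h12 hx3 hx2 h0 h1 hwε hw⟩,
        fun hA hx2 hx1 ↦ ⟨?_, fun ε w h0 h1 hwε hw ↦
          QuarticForm.rectPair_vertical_side hω hω' hA he1 he2 he3 h23 hx2 hx1 h0 h1 hwε hw⟩⟩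
      · rw [hsq]
        positivity
      · rw [hsq]
        exact div_nonpos_of_nonneg_of_nonpos (sq_nonneg _) (Odd.pow_neg ⟨1, rfl⟩ hA).le
      · obtain ⟨ε, h0, h1, hw⟩ := QuarticForm.exists_parameter_rectPair_axis hω hω'
          (Or.inl ⟨hA, rfl, rfl, rfl⟩) hg₂ hg₃ (by simpa [he1] using hx)
        exact ⟨ε, h0, h1, by simpa using hw⟩
      · refine fun ε w h0 h1 hwε hw ↦ QuarticForm.rectPair_axis_real hω hω'
          (Or.inl ⟨hA, rfl, rfl⟩) (hreal fun e he ↦ div_nonneg (sub_nonneg.mpr ?_) hA.le) h0 h1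
          (by simpa using hwε) hw
        rcases he with rfl | rfl | rfl <;> linarith
      · obtain ⟨ε, h0, h1, hw⟩ := QuarticForm.exists_parameter_rectPair_axis hω hω'
          (Or.inr ⟨hA, rfl, rfl, rfl⟩) hg₂ hg₃ (by simpa [he3] using hx)
        exact ⟨ε, h0, h1, by simpa using hw⟩
      · refine fun ε w h0 h1 hwε hw ↦ QuarticForm.rectPair_axis_real hω hω'
          (Or.inr ⟨hA, rfl, rfl⟩)
          (hreal fun e he ↦ div_nonneg_of_nonpos (sub_nonpos.mpr ?_) hA.le) h0 h1
          (by simpa using hwε) hw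
        rcases he with rfl | rfl | rfl <;> linarith
      · obtain ⟨ε, h0, h1, hw⟩ := QuarticForm.exists_parameter_rectPair_side hω hω'
          (Or.inl ⟨hA, rfl, rfl, rfl, rfl⟩) hg₂ hg₃ (by simpa [he3] using hx3)
          (by simpa [he2] using hx2)
        exact ⟨ε, h0, h1, by simpa [add_comm] using hw⟩
      · obtain ⟨ε, h0, h1, hw⟩ := QuarticForm.exists_parameter_rectPair_side hω hω'
          (Or.inr ⟨hA, rfl, rfl, rfl, rfl⟩) hg₂ hg₃ (by simpa [he1] using hx1)
          (by simpa [he2] using hx2)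
        exact ⟨ε, h0, h1, by simpa using hw⟩
    · have hlat : (PeriodPair.rhombPair hω hω').lattice = L.lattice := hcase.resolve_left fun h ↦
        hdisc.not_gt <| PeriodPair.discriminant_rectPair hω hω'
          ((PeriodPair.g₂_congr h).trans hL2) ((PeriodPair.g₃_congr h).trans hL3)
      have hg₂ := (PeriodPair.g₂_congr hlat).trans hL2
      have hg₃ := (PeriodPair.g₃_congr hlat).trans hL3
      obtain ⟨hc1, hc2⟩ := PeriodPair.conj_e_rhombPair hω hω'
      obtain ⟨e₂, he2⟩ := Complex.conj_eq_iff_real.mp hc2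
      have hnn := QuarticForm.D_div_sub_div_nonneg hω hω' hA hg₂ hg₃ he2
      have hpos (hA : 0 < Q.A) : e₂ ≤ Q.D / Q.A := by
        have := mul_nonneg hnn hA.le
        rw [div_mul_cancel₀ _ hA.ne'] at this
        linarith
      have hneg (hA : Q.A < 0) : Q.D / Q.A ≤ e₂ := by
        have := mul_nonpos_of_nonneg_of_nonpos hnn hA.le
        rw [div_mul_cancel₀ _ hA.ne] at this
        linarith
      refine ⟨PeriodPair.rhombPair hω hω', hlat, rfl, rfl, e₂, he2, hc1, ?_, ?_, fun t ↦ ?_,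
        hpos, hneg, fun hA ↦ ?_, fun hA ↦ ?_, fun ε w h0 h1 hwε hw ↦ ?_⟩
      · linear_combination (PeriodPair.rhombPair hω hω').e_symm.1
      · refine ⟨-2 * ((PeriodPair.rhombPair hω hω').e 3).im,
          by linarith [PeriodPair.e_rhombPair_im_neg hω hω'], ?_⟩
        rw [← Complex.conj_conj ((PeriodPair.rhombPair hω hω').e 1), hc1, div_eq_iff Complex.I_ne_zero,
          ← neg_sub, Complex.sub_conj]
        push_cast
        ring
      · rw [← hg₂, ← hg₃, PeriodPair.cubic_eq]
      · obtain ⟨ε, h0, h1, hw⟩ := QuarticForm.exists_parameter_rhombPair_axis hω hω'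
          (Or.inl ⟨hA, rfl, rfl⟩) hg₂ hg₃ (by simpa [he2] using hpos hA)
        exact ⟨ε, h0, h1, by simpa using hw⟩
      · obtain ⟨ε, h0, h1, hw⟩ := QuarticForm.exists_parameter_rhombPair_axis hω hω'
          (Or.inr ⟨hA, rfl, rfl⟩) hg₂ hg₃ (by simpa [he2] using hneg hA)
        exact ⟨ε, h0, h1, by simpa using hw⟩
      · rcases hwε with ⟨hA, hwε⟩ | ⟨hA, hwε⟩
        · exact QuarticForm.rhombPair_axis_real hω hω' (Or.inl ⟨hA, rfl, rfl⟩) he2 hnn h0 h1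
            (by simpa using hwε) hw
        · exact QuarticForm.rhombPair_axis_real hω hω' (Or.inr ⟨hA, rfl, rfl⟩) he2 hnn h0 h1
            (by simpa using hwε) hw
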